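/- Let $k\ge 1$ be an integer and $0<\varepsilon<\tfrac13$. For $T\ge 1$ put $H=T^{\frac13+2\varepsilon}$ and, for real $y$, $z=T^{-1}+iy$. All complex powers are principal. Let $H_s(w)={}_2F_1(s,1-s;1;w)$ denote the branch holomorphic on $\mathbf{C}\setminus[1,\infty)$ (the analytic continuation of the hypergeometric series), and for $s=\sigma+it$ let $\widetilde H_s=H_s$ if $t\le 1$ and $\widetilde H_s=t^{4k-2}e^{-\pi t}H_s$ if $t>1$. Define the averaged t-channel block $$\widecheck W(s)=T^{-4k+\frac52}\,H\int_{-T^{\varepsilon}/H}^{T^{\varepsilon}/H}e^{-(Hy)^2}e^{2iTy}\,z^{-4k+\frac12}\,\widetilde H_s(1-z^{-2})\,dy$$ and the phase $$\alpha(t)=\frac{3\pi}{4}+2t\Big(1+\log 2-\log\frac tT+\frac14\Big(\frac tT\Big)^2\Big).$$ Proposition. There are $T_0\ge1$, a threshold function $\tau(T)$ and a function $E(T,t)\ge 0$ (all depending only on $k,\varepsilon$) such that the following hold, uniformly for all $T\ge T_0$ and all $t>1$. (a) For every $\delta>0$, $\tau(T)\le C_{\delta}\,T^{\delta}\,T/H$;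 and for every integer $n\ge0$, $E(T,t)\le C_n\,t^{-n}$. (That is, $t\le\tau(T)$ is a cutoff to $t\lessapprox T/H$, and $E$ is a quantity $t^{-\infty}$.) (b) For every $\delta>0$, with $s=\tfrac12+it$, $$\Big|\widecheck W(s)-e^{-2}Ht^{-\frac12}\exp\Big(-\Big(\frac{t}{T/H}\Big)^2\Big)\cos\alpha(t)\Big|\le C_{\delta}\,T^{\delta}\big(\mathbf 1_{t\le\tau(T)}\,H\,t^{-1}+E(T,t)\big).$$ (c) With $s=\tfrac12+it$, $$|\widecheck W(s)|\le C\big(\mathbf 1_{t\le\tau(T)}\,H\,t^{-\frac12}+E(T,t)\big).$$ Here $C_\delta,C_n,C$ depend only on $k$, $\varepsilon$ and the indicated subscript. -/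

import Mathlib

/-- The slit plane `ℂ ∖ [1, ∞)`. -/
def hypDomain : Set ℂ := {w | w.re < 1 ∨ w.im ≠ 0}

/-- `F` is holomorphic on `ℂ ∖ [1, ∞)` and equals the hypergeometric series on the unit disc. -/
def IsHypBranch (a b c : ℂ) (F : ℂ → ℂ) : Prop :=
  DifferentiableOn ℂ F hypDomain ∧ ∀ w : ℂ, ‖w‖ < 1 → F w = ₂F₁ a b c w

/-- The branch of the Gauss hypergeometric function on `ℂ ∖ [1, ∞)`: the analytic continuation of
the hypergeometric series. It is unique on `ℂ ∖ [1, ∞)` by `IsHypBranch.eqOn`; it exists and is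
given there by Euler's integral when `0 < re b < re c`, see `hyp2F1_eq_euler`. -/
noncomputable def hyp2F1 (a b c : ℂ) : ℂ → ℂ :=
  Classical.epsilon (IsHypBranch a b c)

section HypergeometricBranch

open Complex MeasureTheory Set Filter Topology

theorem isOpen_hypDomain : IsOpen hypDomain :=
  (isOpen_lt continuous_re continuous_const).union
    (isOpen_ne_fun continuous_im continuous_const)

theorem one_sub_mem_slitPlane_of_mem_hypDomain {w : ℂ} (hw : w ∈ hypDomain) {x : ℝ}
    (hx0 : 0 ≤ x) (hx1 : x ≤ 1) : 1 - w * x ∈ slitPlane := by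
  rw [mem_slitPlane_iff]
  simp only [sub_re, one_re, mul_re, ofReal_re, ofReal_im, mul_zero, sub_zero, sub_im, one_im,
    mul_im, zero_add, zero_sub]
  rcases hx0.eq_or_lt with rfl | hx
  · left; simp
  · rcases hw with h | h
    · left; nlinarith
    · right; simp [h, hx.ne']

theorem IsHypBranch.eqOn {a b c : ℂ} {F G : ℂ → ℂ} (hF : IsHypBranch a b c F)
    (hG : IsHypBranch a b c G) : EqOn F G hypDomain := by
  have hstar : StarConvex ℝ (0 : ℂ) hypDomain := by
    rw [starConvex_zero_iff]
    rintro w hw r hr0 hr1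
    have := one_sub_mem_slitPlane_of_mem_hypDomain hw hr0 hr1
    rw [mem_slitPlane_iff] at this
    simp only [sub_re, one_re, mul_re, ofReal_re, ofReal_im, mul_zero, sub_zero, sub_im, one_im,
      mul_im, zero_add, zero_sub] at this
    rcases this with h | h
    · left; simp; nlinarith
    · right; simp; simpa [mul_comm, or_comm] using h
  refine (hF.1.analyticOnNhd isOpen_hypDomain).eqOn_of_preconnected_of_eventuallyEq
    (hG.1.analyticOnNhd isOpen_hypDomain) (hstar.isPathConnected ?_).isConnected.isPreconnected
    (z₀ := 0) ?_ ?_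
  · exact Or.inl (by simp)
  · left; simp
  · filter_upwards [Metric.ball_mem_nhds (0 : ℂ) one_pos] with w hw
    rw [mem_ball_zero_iff] at hw
    rw [hF.2 w hw, hG.2 w hw]

theorem isHypBranch_euler {a b c : ℂ} (hb : 0 < b.re) (hbc : b.re < c.re) :
    IsHypBranch a b c (fun w => Gamma c / (Gamma b * Gamma (c - b)) *
      ∫ x : ℝ in 0..1, (x : ℂ) ^ (b - 1) * (1 - (x : ℂ)) ^ (c - b - 1) *
        (1 - w * (x : ℂ)) ^ (-a)) := by
  have hcb : 0 < (c - b).re := by simpa using hbc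
  have hcont : ∀ e : ℂ, ContinuousOn (fun p : ℂ × ℝ => (1 - p.1 * (p.2 : ℂ)) ^ e)
      (hypDomain ×ˢ Icc 0 1) := by
    intro e
    refine ContinuousOn.cpow_const (by fun_prop) ?_
    rintro ⟨w, x⟩ ⟨hw, hx⟩
    exact one_sub_mem_slitPlane_of_mem_hypDomain hw hx.1 hx.2
  have hcont' : ∀ e : ℂ, ∀ w ∈ hypDomain,
      ContinuousOn (fun x : ℝ => (1 - w * (x : ℂ)) ^ e) (uIcc 0 1) := by
    intro e w hw
    rw [uIcc_of_le zero_le_one]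
    exact (hcont e).comp (f := fun x : ℝ => (w, x)) (by fun_prop) fun x hx => ⟨hw, hx⟩
  have hg := betaIntegral_convergent hb hcb
  constructor
  · intro w₀ hw₀
    obtain ⟨r, hr, hball⟩ := Metric.nhds_basis_closedBall.mem_iff.1
      (isOpen_hypDomain.mem_nhds hw₀)
    have hcomp : IsCompact (Metric.closedBall w₀ r ×ˢ Icc (0 : ℝ) 1) :=
      (isCompact_closedBall _ _).prod isCompact_Icc
    have hsub : Metric.closedBall w₀ r ×ˢ Icc (0 : ℝ) 1 ⊆ hypDomain ×ˢ Icc 0 1 :=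
      prod_mono hball subset_rfl
    obtain ⟨C, hC⟩ := hcomp.exists_bound_of_continuousOn
      (f := fun p : ℂ × ℝ => a * (p.2 : ℂ) * (1 - p.1 * (p.2 : ℂ)) ^ (-a - 1))
      (((by fun_prop : Continuous fun p : ℂ × ℝ => a * (p.2 : ℂ)).continuousOn).mul
        ((hcont _).mono hsub))
    refine DifferentiableAt.differentiableWithinAt ?_
    refine DifferentiableAt.const_mul ?_ _
    refine (intervalIntegral.hasDerivAt_integral_of_dominated_loc_of_deriv_le
      (F := fun w x => (x : ℂ) ^ (b - 1) * (1 - (x : ℂ)) ^ (c - b - 1) *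
        (1 - w * (x : ℂ)) ^ (-a))
      (F' := fun w x => (x : ℂ) ^ (b - 1) * (1 - (x : ℂ)) ^ (c - b - 1) *
        (a * (x : ℂ) * (1 - w * (x : ℂ)) ^ (-a - 1)))
      (bound := fun x => ‖(x : ℂ) ^ (b - 1) * (1 - (x : ℂ)) ^ (c - b - 1)‖ * C)
      (Metric.closedBall_mem_nhds w₀ hr) ?_ ?_ ?_ ?_ ?_ ?_).2.differentiableAt
    · filter_upwards [isOpen_hypDomain.mem_nhds hw₀] with w hw
      have := hg.mul_continuousOn (hcont' (-a) w hw)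
      exact (intervalIntegrable_iff.1 this).aestronglyMeasurable
    · exact hg.mul_continuousOn (hcont' (-a) w₀ hw₀)
    · have := hg.mul_continuousOn (g := fun x : ℝ => a * (x : ℂ) * (1 - w₀ * (x : ℂ)) ^ (-a - 1))
        (((by fun_prop : Continuous fun x : ℝ => a * (x : ℂ)).continuousOn).mul
          (hcont' (-a - 1) w₀ hw₀))
      exact (intervalIntegrable_iff.1 this).aestronglyMeasurable
    · refine Eventually.of_forall fun x hx w hw => ?_
      rw [uIoc_of_le zero_le_one] at hx
      rw [norm_mul]
      gcongr
      exact hC (w, x) ⟨hw, hx.1.le, hx.2⟩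
    · exact hg.norm.mul_const C
    · refine Eventually.of_forall fun x hx w hw => ?_
      rw [uIoc_of_le zero_le_one] at hx
      refine HasDerivAt.const_mul _ ?_
      have h1 : HasDerivAt (fun w : ℂ => 1 - w * (x : ℂ)) (-(x : ℂ)) w := by
        simpa using ((hasDerivAt_id w).mul_const (x : ℂ)).const_sub 1
      exact (h1.cpow_const (c := -a)
        (one_sub_mem_slitPlane_of_mem_hypDomain (hball hw) hx.1.le hx.2)).congr_deriv (by ring)
  · intro w hw
    have hwD : w ∈ hypDomain := Or.inl (lt_of_le_of_lt (re_le_norm w) hw)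
    set p := ordinaryHypergeometricSeries ℂ a (1 : ℂ) 1 with hp
    have hps : HasFPowerSeriesOnBall (fun x : ℂ => (1 + x) ^ (-a))
        (p.compContinuousLinearMap (-(.id ℂ ℂ))) 0 1 := by
      have := one_add_cpow_hasFPowerSeriesOnBall_zero (a := -a)
      rwa [binomialSeries_eq_ordinaryHypergeometricSeries (b := (1 : ℂ)) (by
        intro k h
        have := congrArg re h
        simp at this
        linarith [Nat.cast_nonneg (α := ℝ) k]), neg_neg] at this
    have hterm : ∀ (n : ℕ) (v : ℂ), p n (fun _ => v) =
        ((n.factorial : ℂ)⁻¹ * (ascPochhammer ℂ n).eval a) * v ^ n := by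
      intro n v
      rw [hp, ordinaryHypergeometricSeries_apply_eq, smul_eq_mul, mul_inv_cancel_right₀]
      simp [ascPochhammer_eval_one, Nat.factorial_ne_zero]
    have hsum : ∀ v : ℂ, ‖v‖ < 1 → HasSum (fun n : ℕ =>
        ((n.factorial : ℂ)⁻¹ * (ascPochhammer ℂ n).eval a) * v ^ n) ((1 - v) ^ (-a)) := by
      intro v hv
      have := hps.hasSum (y := -v) (by
        rw [mem_eball_zero_iff, enorm_neg]
        simpa [enorm_eq_nnnorm, ← NNReal.coe_lt_one] using hv)
      have h2 : (fun n : ℕ => (p.compContinuousLinearMap (-(.id ℂ ℂ))) n fun _ => -v) =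
          fun n : ℕ => ((n.factorial : ℂ)⁻¹ * (ascPochhammer ℂ n).eval a) * v ^ n := by
        funext n
        rw [← hterm, FormalMultilinearSeries.compContinuousLinearMap_apply]
        congr 1
        funext i
        simp
      rwa [h2, zero_add, ← sub_eq_add_neg] at this
    have hsumm : Summable fun n : ℕ =>
        ‖((n.factorial : ℂ)⁻¹ * (ascPochhammer ℂ n).eval a) * w ^ n‖ := (hsum w hw).summable.norm
    have hle : ∀ x : ℝ, 0 ≤ x → x ≤ 1 → ∀ n : ℕ, ‖(x : ℂ) ^ n‖ ≤ 1 := by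
      intro x h0 h1 n
      rw [norm_pow, norm_real, Real.norm_of_nonneg h0]
      exact pow_le_one₀ h0 h1
    have key := intervalIntegral.hasSum_integral_of_dominated_convergence (μ := volume)
      (a := 0) (b := 1)
      (F := fun (n : ℕ) (x : ℝ) => (x : ℂ) ^ (b - 1) * (1 - (x : ℂ)) ^ (c - b - 1) *
        (((n.factorial : ℂ)⁻¹ * (ascPochhammer ℂ n).eval a) * (w * x) ^ n))
      (f := fun x : ℝ => (x : ℂ) ^ (b - 1) * (1 - (x : ℂ)) ^ (c - b - 1) *
        (1 - w * (x : ℂ)) ^ (-a))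
      (fun n x => ‖(x : ℂ) ^ (b - 1) * (1 - (x : ℂ)) ^ (c - b - 1)‖ *
        ‖((n.factorial : ℂ)⁻¹ * (ascPochhammer ℂ n).eval a) * w ^ n‖)
      (fun n => (intervalIntegrable_iff.1 (hg.mul_continuousOn
        (by fun_prop))).aestronglyMeasurable)
      (fun n => Eventually.of_forall fun x hx => by
        rw [uIoc_of_le zero_le_one] at hx
        rw [norm_mul, mul_pow, ← mul_assoc _ (w ^ n), norm_mul (_ * w ^ n)]
        exact mul_le_mul_of_nonneg_left
          (mul_le_of_le_one_right (norm_nonneg _) (hle x hx.1.le hx.2 n)) (norm_nonneg _))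
      (Eventually.of_forall fun x _ => hsumm.mul_left _)
      (by
        simp only [tsum_mul_left]
        exact hg.norm.mul_const _)
      (Eventually.of_forall fun x hx => by
        rw [uIoc_of_le zero_le_one] at hx
        refine (hsum (w * x) ?_).mul_left _
        rw [norm_mul]
        exact (mul_le_of_le_one_right (norm_nonneg _)
          (by simpa using hle x hx.1.le hx.2 1)).trans_lt hw)
    have hb0 : ∀ m : ℕ, b ≠ -m := by
      intro m h
      have := congrArg re h
      simp at this
      linarith [Nat.cast_nonneg (α := ℝ) m]
    have hc0 : ∀ m : ℕ, c ≠ -m := by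
      intro m h
      have := congrArg re h
      simp at this
      linarith [Nat.cast_nonneg (α := ℝ) m]
    have hGb : Gamma b ≠ 0 := Gamma_ne_zero_of_re_pos hb
    have hGc : Gamma c ≠ 0 := Gamma_ne_zero_of_re_pos (hb.trans hbc)
    have hGcb : Gamma (c - b) ≠ 0 := Gamma_ne_zero_of_re_pos hcb
    rw [ordinaryHypergeometric_eq_tsum]
    refine ((key.mul_left (Gamma c / (Gamma b * Gamma (c - b)))).tsum_eq.symm).trans ?_
    refine tsum_congr fun n => ?_
    have hint : ∫ x : ℝ in 0..1, (x : ℂ) ^ (b - 1) * (1 - (x : ℂ)) ^ (c - b - 1) *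
        (((n.factorial : ℂ)⁻¹ * (ascPochhammer ℂ n).eval a) * (w * x) ^ n) =
        (((n.factorial : ℂ)⁻¹ * (ascPochhammer ℂ n).eval a) * w ^ n) *
          betaIntegral (b + n) (c - b) := by
      rw [betaIntegral, ← intervalIntegral.integral_const_mul]
      refine intervalIntegral.integral_congr_ae (Eventually.of_forall fun x hx => ?_)
      rw [uIoc_of_le zero_le_one] at hx
      have hx0 : (x : ℂ) ≠ 0 := by exact_mod_cast hx.1.ne'
      rw [show b + n - 1 = (b - 1) + n by ring, cpow_add _ _ hx0, cpow_natCast, mul_pow]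
      ring
    have hbn : 0 < (b + n).re := by
      simp only [add_re, natCast_re]; positivity
    have hcn : Gamma (c + n) ≠ 0 := Gamma_ne_zero_of_re_pos (by
      simp only [add_re, natCast_re]; linarith [hb.trans hbc, Nat.cast_nonneg (α := ℝ) n])
    rw [hint, betaIntegral_eq_Gamma_mul_div _ _ hbn hcb, show b + n + (c - b) = c + n by ring,
      ← Gamma_add_nat_div_Gamma_eq b hb0, ← Gamma_add_nat_div_Gamma_eq c hc0, smul_eq_mul]
    field_simp

theorem isHypBranch_hyp2F1 {a b c : ℂ} (hb : 0 < b.re) (hbc : b.re < c.re) :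
    IsHypBranch a b c (hyp2F1 a b c) :=
  Classical.epsilon_spec ⟨_, isHypBranch_euler hb hbc⟩

theorem hyp2F1_eq_euler {a b c : ℂ} (hb : 0 < b.re) (hbc : b.re < c.re) {w : ℂ}
    (hw : w ∈ hypDomain) :
    hyp2F1 a b c w = Gamma c / (Gamma b * Gamma (c - b)) *
      ∫ x : ℝ in 0..1, (x : ℂ) ^ (b - 1) * (1 - (x : ℂ)) ^ (c - b - 1) *
        (1 - w * (x : ℂ)) ^ (-a) :=
  (isHypBranch_hyp2F1 hb hbc).eqOn (isHypBranch_euler hb hbc) hw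

end HypergeometricBranch

/-- `H_s(w) = ₂F₁(s, 1 - s; 1; w)` for `w ∈ ℂ ∖ [1, ∞)`. -/
noncomputable def blockH (s w : ℂ) : ℂ :=
  hyp2F1 s (1 - s) 1 w

/-- The renormalized block: for `s = σ + it` it is `H_s` if `t ≤ 1`, and
`t ^ (4k - 2) * exp (-π t) * H_s` if `t > 1`. -/
noncomputable def blockHTilde (k : ℕ) (s w : ℂ) : ℂ :=
  if s.im ≤ 1 then blockH s w
  else ((s.im ^ (4 * (k : ℤ) - 2) * Real.exp (-Real.pi * s.im) : ℝ) : ℂ) * blockH s w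

/-- The window length `H = T ^ (1/3 + 2ε)`. -/
noncomputable def windowH (ε T : ℝ) : ℝ :=
  T ^ (1 / 3 + 2 * ε)

/-- The point `z = T⁻¹ + i y` of the line of integration. -/
noncomputable def linePoint (T y : ℝ) : ℂ :=
  ((T⁻¹ : ℝ) : ℂ) + Complex.I * (y : ℂ)

/-- The averaged t-channel block
`T ^ (-4k + 5/2) H ∫_{|y| ≤ T^ε / H} e^{-(H y)²} e^{2iTy} z^{-4k + 1/2} H̃_s(1 - z⁻²) dy`,
where `z = T⁻¹ + i y`. -/
noncomputable def WCheck (k : ℕ) (ε T : ℝ) (s : ℂ) : ℂ :=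
  ((T ^ (-4 * (k : ℝ) + 5 / 2) * windowH ε T : ℝ) : ℂ) *
    ∫ y in (-(T ^ ε / windowH ε T))..(T ^ ε / windowH ε T),
      (Real.exp (-(windowH ε T * y) ^ 2) : ℂ) * Complex.exp (2 * Complex.I * T * y) *
        linePoint T y ^ (-4 * (k : ℂ) + 1 / 2) *
        blockHTilde k s (1 - (linePoint T y ^ 2)⁻¹)

/-- The phase
`α(t) = 3π/4 + 2t (1 + log 2 - log (t/T) + (t/T)² / 4)`. -/
noncomputable def phaseAlpha (T t : ℝ) : ℝ :=
  3 * Real.pi / 4 +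
    2 * t * (1 + Real.log 2 - Real.log (t / T) + 1 / 4 * (t / T) ^ 2)

/-!
The block is evaluated by the saddle point method, carried out with one integration by parts.

Close to `z = 0` the argument `1 - z⁻²` is large, so the block is first expanded at infinity. For
`re s = 1/2` the connection formula `blockH_connection` writes `H_s(1 - z⁻²)` as a combination of
`z^(2s) J(s, z²)` and `z^(2-2s) J(1 - s, z²)`, where `J(s, w)` is the Euler integral of
`₂F₁(s, s; 2s; w)`. It is Cauchy's theorem for `ζ⁻ˢ (ζ - 1)ˢ⁻¹ (ζ + a)⁻ˢ` in the upper half-plane,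
combined with its conjugate and continued analytically from real `z`. On the critical line the two
terms are conjugate to each other, so `WCheck` is twice the real part of one integral
(`WCheck_eq_two_mul_re`).

On the line `re z = 1/T` the weight `e^{-(Hy)²} e^{2iTy}` is, up to `e⁻²`, the restriction of the
entire function `e^{H²(z - 1/T)²} e^{2Tz}`. The remaining integral is therefore that of
`b(z) e^{2Tz} z^{-q}` with `q = 4k - 3/2 + 2it` and a slowly varying amplitude `b`, the product of
the Gaussian and `₂F₁(p, p; 2p; z²)`, `p = 1/2 - it`. For constant `b` the full integral is Laplace's
`2π (2T)^{q-1} / Γ(q)` (`integral_exp_mul_cpow_neg`). With the saddle point `z₀ = (q - 1)/(2T)`, the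
product `2T (z - z₀) e^{2Tz} z^{-q}` is the derivative of `e^{2Tz} z^{1-q}`; writing `b(z) = b(z₀)
+ (z - z₀) D(z)` and integrating by parts replaces `b` by `b(z₀)` at the cost of `|D'|`, which
Cauchy's estimate bounds by a multiple of `H²` (`norm_integral_amplitude_sub_le`,
`norm_deriv_blockAmplitude_sub_le`). Hence the error is `O(H (1/t + t H²/T²))`.

The main term comes from Stirling's formula for the constant (`exists_norm_blockConst_sub_le`) and
from `b(z₀) = exp (-(tH/T)² + i t³/(2T²)) + O(t H²/T² + 1/t)` (`norm_blockAmplitude_saddle_sub_le`);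
the last phase is the correction `(t/T)²/4` in `phaseAlpha`.

The cutoff is `τ(T) = (log T)⁴ T/H` (`blockCutoff`). Below it `t H²/T²` is at most `(log T)⁸ / t` and
at most `t^(-1/2)`. Above it, at each point of the line of integration, either the Gaussian weight
or the factor `exp (-t re z / |z|)` in the decay of the normalized block is smaller than every power
of `t` (`weight_mul_block_decay_le`). So `E(T, t)` may be taken to be zero below the cutoff and the
sum of the moduli of the averaged block and of the main term above it.
-/

open Complex MeasureTheory Set Filter Topology

/-! ### The product of three powers near the real axis -/

/-- The principal power takes its boundary values on the negative real axis from above. -/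
theorem tendsto_cpow_of_real_add_mul_I {x : ℝ} (hx : x ≠ 0) (w : ℂ) :
    Tendsto (fun η : ℝ => ((x : ℂ) + η * I) ^ w) (𝓝[>] 0) (𝓝 ((x : ℂ) ^ w)) := by
  have hx' : (x : ℂ) ≠ 0 := by exact_mod_cast hx
  have h1 : Tendsto (fun η : ℝ => (x : ℂ) + η * I) (𝓝[>] 0) (𝓝[{z : ℂ | 0 ≤ z.im}] (x : ℂ)) := by
    rw [tendsto_nhdsWithin_iff]
    constructor
    · have : Continuous fun η : ℝ => (x : ℂ) + η * I := by fun_prop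
      have := this.tendsto 0
      simp only [ofReal_zero, zero_mul, add_zero] at this
      exact this.mono_left nhdsWithin_le_nhds
    · filter_upwards [self_mem_nhdsWithin] with η hη
      simpa using le_of_lt hη
  have h2 : ContinuousWithinAt log {z : ℂ | 0 ≤ z.im} (x : ℂ) := by
    rcases lt_or_gt_of_ne hx with h | h
    · exact continuousWithinAt_log_of_re_neg_of_im_zero (by simpa using h) (by simp)
    · exact (continuousAt_clog (Or.inl (by simpa using h))).continuousWithinAt
  have h3 := (h2.tendsto.comp h1).mul_const w
  have h4 := (Complex.continuous_exp.tendsto _).comp h3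
  rw [cpow_def_of_ne_zero hx']
  refine h4.congr' ?_
  filter_upwards [self_mem_nhdsWithin] with η hη
  rw [cpow_def_of_ne_zero]
  · rfl
  · intro h
    have := congrArg im h
    simp at this
    exact (ne_of_gt hη) this

theorem norm_cpow_le_mul_exp (z w : ℂ) :
    ‖z ^ w‖ ≤ ‖z‖ ^ w.re * Real.exp (Real.pi * |w.im|) := by
  refine (norm_cpow_le z w).trans ?_
  rw [div_eq_mul_inv, ← Real.exp_neg]
  gcongr
  calc -(z.arg * w.im) ≤ |z.arg * w.im| := neg_le_abs _
    _ = |z.arg| * |w.im| := abs_mul _ _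
    _ ≤ _ := by gcongr; exact abs_arg_le_pi z

/-- The integrand `ζ⁻ˢ (ζ - 1)ˢ⁻¹ (ζ + a)⁻ˢ` whose integrals over the components of
`ℝ ∖ {-a, 0, 1}` are Euler integrals. -/
noncomputable def triplePow (s : ℂ) (a : ℝ) (ζ : ℂ) : ℂ :=
  ζ ^ (-s) * (ζ - 1) ^ (s - 1) * (ζ + a) ^ (-s)

/-- The modulus of `triplePow` on the real line for `re s = 1/2`, up to a constant. -/
noncomputable def tripleMajorant (a x : ℝ) : ℝ :=
  |x| ^ (-(1 / 2) : ℝ) * |x - 1| ^ (-(1 / 2) : ℝ) * |x + a| ^ (-(1 / 2) : ℝ)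

theorem norm_triplePow_le {s : ℂ} (hs : s.re = 1 / 2) (a : ℝ) (ζ : ℂ) :
    ‖triplePow s a ζ‖ ≤ Real.exp (Real.pi * |s.im|) ^ 3 *
      (‖ζ‖ ^ (-(1 / 2) : ℝ) * ‖ζ - 1‖ ^ (-(1 / 2) : ℝ) * ‖ζ + a‖ ^ (-(1 / 2) : ℝ)) := by
  have h1 := norm_cpow_le_mul_exp ζ (-s)
  have h2 := norm_cpow_le_mul_exp (ζ - 1) (s - 1)
  have h3 := norm_cpow_le_mul_exp (ζ + a) (-s)
  have e : (s - 1).re = -(1 / 2) := by simp [hs]; norm_num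
  simp only [neg_re, neg_im, abs_neg, hs, e] at h1 h2 h3
  have e2 : (s - 1).im = s.im := by simp
  rw [e2] at h2
  rw [triplePow, norm_mul, norm_mul]
  calc _ ≤ (‖ζ‖ ^ (-(1 / 2) : ℝ) * Real.exp (Real.pi * |s.im|)) *
        (‖ζ - 1‖ ^ (-(1 / 2) : ℝ) * Real.exp (Real.pi * |s.im|)) *
        (‖ζ + a‖ ^ (-(1 / 2) : ℝ) * Real.exp (Real.pi * |s.im|)) := by gcongr
    _ = _ := by ring

theorem intervalIntegrable_abs_sub_rpow_mul {p u v : ℝ} {h : ℝ → ℝ}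
    (hh : ContinuousOn h (uIcc u v)) :
    IntervalIntegrable (fun x => |x - p| ^ (-(1 / 2) : ℝ) * h x) volume u v := by
  refine IntervalIntegrable.mul_continuousOn ?_ hh
  have h0 : IntervalIntegrable (fun x : ℝ => ‖(x : ℂ) ^ (-(1 / 2) : ℂ)‖) volume (u - p) (v - p) :=
    (intervalIntegral.intervalIntegrable_cpow' (by norm_num)).norm
  have h1 : IntervalIntegrable (fun x : ℝ => |x| ^ (-(1 / 2) : ℝ)) volume (u - p) (v - p) := by
    refine h0.congr_ae ?_
    have : ∀ᵐ x : ℝ, x ≠ 0 := by simp [ae_iff, measure_singleton]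
    refine ae_restrict_of_ae ?_
    filter_upwards [this] with x hx
    rw [norm_cpow_of_ne_zero (by exact_mod_cast hx)]
    norm_num
  have := h1.comp_sub_right p
  simpa using this

theorem integrableOn_abs_rpow_neg {q : ℝ} (hq : 1 < q) {c : ℝ} (hc : 0 < c) :
    IntegrableOn (fun x : ℝ => |x| ^ (-q)) (Iic (-c)) := by
  have h := (integrableOn_Ioi_rpow_of_lt (a := -q) (by linarith) hc)
  have h2 : IntegrableOn (fun x : ℝ => |x| ^ (-q)) (Ioi c) := by
    refine h.congr_fun (fun x hx => ?_) measurableSet_Ioi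
    rw [abs_of_pos (hc.trans hx)]
  rw [← integrableOn_Ici_iff_integrableOn_Ioi] at h2
  have h3 := (Measure.measurePreserving_neg (volume : Measure ℝ)).integrableOn_comp_preimage
    (Homeomorph.neg ℝ).measurableEmbedding (f := fun x : ℝ => |x| ^ (-q)) (s := Ici c)
  have := h3.2 h2
  simpa [Function.comp_def] using this

theorem measurable_tripleMajorant (a : ℝ) : Measurable (tripleMajorant a) := by
  unfold tripleMajorant
  fun_prop

theorem integrable_tripleMajorant {a : ℝ} (ha : 0 < a) : Integrable (tripleMajorant a) := by
  have hmeas := (measurable_tripleMajorant a).aestronglyMeasurable (μ := volume)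
  have cont : ∀ p : ℝ, ∀ S : Set ℝ, p ∉ S →
      ContinuousOn (fun x : ℝ => |x - p| ^ (-(1 / 2) : ℝ)) S := by
    intro p S hp
    refine ContinuousOn.rpow_const (by fun_prop) fun x hx => Or.inl ?_
    have : x ≠ p := fun h => hp (h ▸ hx)
    simpa [sub_eq_zero] using this
  have c0 := cont 0
  have c1 := cont 1
  have ca := cont (-a)
  simp only [sub_zero, sub_neg_eq_add] at c0 ca
  -- each of the three bounded pieces contains exactly one of the singularities `-a`, `0`, `1`
  have i1 : IntervalIntegrable (tripleMajorant a) volume (-a - 1) (-a / 2) := by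
    have hS : uIcc (-a - 1) (-a / 2) = Icc (-a - 1) (-a / 2) := uIcc_of_le (by linarith)
    have := intervalIntegrable_abs_sub_rpow_mul (p := -a) (u := -a - 1) (v := -a / 2)
      (h := fun x => |x| ^ (-(1 / 2) : ℝ) * |x - 1| ^ (-(1 / 2) : ℝ))
      ((c0 _ (by rw [hS]; rintro ⟨_, h⟩; linarith)).mul
        (c1 _ (by rw [hS]; rintro ⟨_, h⟩; linarith)))
    refine this.congr fun x _ => ?_
    simp only [tripleMajorant, sub_neg_eq_add]; ring
  have i2 : IntervalIntegrable (tripleMajorant a) volume (-a / 2) (1 / 2) := by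
    have hS : uIcc (-a / 2) (1 / 2) = Icc (-a / 2) (1 / 2) := uIcc_of_le (by linarith)
    have := intervalIntegrable_abs_sub_rpow_mul (p := 0) (u := -a / 2) (v := 1 / 2)
      (h := fun x => |x - 1| ^ (-(1 / 2) : ℝ) * |x + a| ^ (-(1 / 2) : ℝ))
      ((c1 _ (by rw [hS]; rintro ⟨_, h⟩; linarith)).mul
        (ca _ (by rw [hS]; rintro ⟨h, _⟩; linarith)))
    refine this.congr fun x _ => ?_
    simp only [tripleMajorant, sub_zero]; ring
  have i3 : IntervalIntegrable (tripleMajorant a) volume (1 / 2) 2 := by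
    have hS : uIcc (1 / 2 : ℝ) 2 = Icc (1 / 2) 2 := uIcc_of_le (by norm_num)
    have := intervalIntegrable_abs_sub_rpow_mul (p := 1) (u := 1 / 2) (v := 2)
      (h := fun x => |x| ^ (-(1 / 2) : ℝ) * |x + a| ^ (-(1 / 2) : ℝ))
      ((c0 _ (by rw [hS]; rintro ⟨h, _⟩; linarith)).mul
        (ca _ (by rw [hS]; rintro ⟨h, _⟩; linarith)))
    refine this.congr fun x _ => ?_
    simp only [tripleMajorant]; ring
  have i4 : IntegrableOn (tripleMajorant a) (Ioi 2) := by
    have h := (integrableOn_Ioi_rpow_of_lt (a := -(3 / 2)) (by norm_num)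
      (zero_lt_two' ℝ)).const_mul ((2⁻¹ : ℝ) ^ (-(1 / 2) : ℝ))
    refine Integrable.mono' h hmeas.restrict ?_
    refine (ae_restrict_mem measurableSet_Ioi).mono fun x (hx : 2 < x) => ?_
    have hx0 : 0 < x := by linarith
    have hn : 0 ≤ tripleMajorant a x := by unfold tripleMajorant; positivity
    rw [Real.norm_of_nonneg hn, tripleMajorant, abs_of_pos hx0, abs_of_pos (by linarith : 0 < x - 1),
      abs_of_pos (by linarith : 0 < x + a)]
    calc x ^ (-(1 / 2) : ℝ) * (x - 1) ^ (-(1 / 2) : ℝ) * (x + a) ^ (-(1 / 2) : ℝ)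
        ≤ x ^ (-(1 / 2) : ℝ) * (2⁻¹ * x) ^ (-(1 / 2) : ℝ) * x ^ (-(1 / 2) : ℝ) := by
          gcongr x ^ _ * ?_ * ?_
          · exact Real.rpow_le_rpow_of_nonpos (by positivity) (by linarith) (by norm_num)
          · exact Real.rpow_le_rpow_of_nonpos (by positivity) (by linarith) (by norm_num)
      _ = _ := by
          rw [Real.mul_rpow (by norm_num) hx0.le,
            show (-(3 / 2) : ℝ) = -(1 / 2) + -(1 / 2) + -(1 / 2) by norm_num,
            Real.rpow_add hx0, Real.rpow_add hx0]
          ring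
  have i0 : IntegrableOn (tripleMajorant a) (Iic (-a - 1)) := by
    have h := (integrableOn_abs_rpow_neg (q := 3 / 2) (by norm_num)
      (by linarith : 0 < a + 1)).const_mul (((a + 1)⁻¹ : ℝ) ^ (-(1 / 2) : ℝ))
    rw [show -(a + 1) = -a - 1 by ring] at h
    refine Integrable.mono' h hmeas.restrict ?_
    refine (ae_restrict_mem measurableSet_Iic).mono fun x (hx : x ≤ -a - 1) => ?_
    have hx0 : 0 < |x| := abs_pos.2 (by linarith)
    have hxa : |x| = -x := abs_of_neg (by linarith)
    have hn : 0 ≤ tripleMajorant a x := by unfold tripleMajorant; positivity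
    rw [Real.norm_of_nonneg hn, tripleMajorant]
    calc |x| ^ (-(1 / 2) : ℝ) * |x - 1| ^ (-(1 / 2) : ℝ) * |x + a| ^ (-(1 / 2) : ℝ)
        ≤ |x| ^ (-(1 / 2) : ℝ) * |x| ^ (-(1 / 2) : ℝ) * ((a + 1)⁻¹ * |x|) ^ (-(1 / 2) : ℝ) := by
          gcongr |x| ^ _ * ?_ * ?_
          · refine Real.rpow_le_rpow_of_nonpos hx0 ?_ (by norm_num)
            rw [hxa, abs_of_neg (by linarith)]; linarith
          · refine Real.rpow_le_rpow_of_nonpos (by positivity) ?_ (by norm_num)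
            rw [hxa, abs_of_neg (by linarith), inv_mul_le_iff₀ (by linarith)]
            nlinarith
      _ = _ := by
          rw [Real.mul_rpow (by positivity) hx0.le,
            show (-(3 / 2) : ℝ) = -(1 / 2) + -(1 / 2) + -(1 / 2) by norm_num,
            Real.rpow_add hx0, Real.rpow_add hx0]
          ring
  have i123 := (i1.trans i2).trans i3
  rw [intervalIntegrable_iff_integrableOn_Ioc_of_le (by linarith)] at i123
  have := (i0.union i123).union i4
  rwa [Iic_union_Ioc_eq_Iic (by linarith), Iic_union_Ioi, integrableOn_univ] at this

/-! ### A vanishing contour integral -/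

/-- The exponents of `triplePow` have real parts adding up to `-3/2`, so it decays faster than
`1/|ζ|`. -/
theorem norm_triplePow_le_of_le_norm {s : ℂ} (hs : s.re = 1 / 2) {a R : ℝ} (ha : 0 < a)
    (hR : 2 ≤ R) (hRa : 2 * a ≤ R) {ζ : ℂ} (hζ : R ≤ ‖ζ‖) :
    ‖triplePow s a ζ‖ ≤ Real.exp (Real.pi * |s.im|) ^ 3 * (2 * R ^ (-(3 / 2) : ℝ)) := by
  have hR0 : 0 < R := by linarith
  refine (norm_triplePow_le hs a ζ).trans ?_
  have h1 : R / 2 ≤ ‖ζ - 1‖ := by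
    have := norm_sub_norm_le ζ 1
    rw [norm_one] at this
    linarith
  have h2 : R / 2 ≤ ‖ζ + a‖ := by
    have := norm_sub_norm_le ζ (-(a : ℂ))
    rw [norm_neg, norm_real, Real.norm_of_nonneg ha.le, sub_neg_eq_add] at this
    linarith
  have e : ∀ x y : ℝ, 0 < x → x ≤ y → y ^ (-(1 / 2) : ℝ) ≤ x ^ (-(1 / 2) : ℝ) := fun x y hx hxy =>
    Real.rpow_le_rpow_of_nonpos hx hxy (by norm_num)
  refine mul_le_mul_of_nonneg_left ?_ (by positivity)
  calc ‖ζ‖ ^ (-(1 / 2) : ℝ) * ‖ζ - 1‖ ^ (-(1 / 2) : ℝ) * ‖ζ + a‖ ^ (-(1 / 2) : ℝ)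
      ≤ R ^ (-(1 / 2) : ℝ) * (R / 2) ^ (-(1 / 2) : ℝ) * (R / 2) ^ (-(1 / 2) : ℝ) := by
        gcongr ?_ * ?_ * ?_
        · exact e _ _ hR0 hζ
        · exact e _ _ (by positivity) h1
        · exact e _ _ (by positivity) h2
    _ = 2 * R ^ (-(3 / 2) : ℝ) := by
        rw [mul_assoc, ← Real.rpow_add (by positivity), show (-(1 / 2) + -(1 / 2) : ℝ) = -1 by
          norm_num, Real.rpow_neg_one, show (-(3 / 2) : ℝ) = -(1 / 2) - 1 by norm_num,
          Real.rpow_sub hR0, Real.rpow_one]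
        field_simp

theorem differentiableAt_triplePow (s : ℂ) (a : ℝ) {ζ : ℂ} (hζ : 0 < ζ.im) :
    DifferentiableAt ℂ (triplePow s a) ζ := by
  have h0 : ζ ∈ slitPlane := Or.inr hζ.ne'
  have h1 : ζ - 1 ∈ slitPlane := Or.inr (by simpa using hζ.ne')
  have h2 : ζ + a ∈ slitPlane := Or.inr (by simpa using hζ.ne')
  unfold triplePow
  refine DifferentiableAt.mul (DifferentiableAt.mul ?_ ?_) ?_
  · exact differentiableAt_id.cpow_const h0
  · exact (differentiableAt_id.sub_const 1).cpow_const h1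
  · exact (differentiableAt_id.add_const (a : ℂ)).cpow_const h2

/-- The integral over a horizontal segment just above the real line equals the integral over the
other three sides of a large rectangle. -/
theorem norm_integral_triplePow_shift_le {s : ℂ} (hs : s.re = 1 / 2) {a R η : ℝ} (ha : 0 < a)
    (hR : 2 ≤ R) (hRa : 2 * a ≤ R) (hη : 0 < η) (hη1 : η ≤ 1) :
    ‖∫ x in (-R)..R, triplePow s a (x + η * I)‖ ≤
      Real.exp (Real.pi * |s.im|) ^ 3 * (2 * R ^ (-(3 / 2) : ℝ)) * (4 * R) := by
  set M := Real.exp (Real.pi * |s.im|) ^ 3 * (2 * R ^ (-(3 / 2) : ℝ)) with hM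
  have hM0 : 0 ≤ M := by positivity
  have key := integral_boundary_rect_eq_zero_of_differentiableOn (triplePow s a)
    (⟨-R, η⟩ : ℂ) (⟨R, R⟩ : ℂ) (by
      intro ζ hζ
      rw [mem_reProdIm] at hζ
      refine (differentiableAt_triplePow s a ?_).differentiableWithinAt
      have := hζ.2
      simp only [uIcc_of_le (by linarith : η ≤ R)] at this
      exact hη.trans_le this.1)
  simp only at key
  have hb : ∀ ζ : ℂ, R ≤ ‖ζ‖ → ‖triplePow s a ζ‖ ≤ M := fun ζ h =>
    norm_triplePow_le_of_le_norm hs ha hR hRa h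
  have htop : ‖∫ x in (-R)..R, triplePow s a (x + R * I)‖ ≤ M * (2 * R) := by
    refine (intervalIntegral.norm_integral_le_of_norm_le_const (C := M) fun x _ => hb _ ?_).trans ?_
    · have := abs_im_le_norm (x + R * I : ℂ)
      simp only [add_im, ofReal_im, mul_im, ofReal_re, I_im, mul_one, I_re, mul_zero, add_zero,
        zero_add] at this
      exact (le_abs_self R).trans this
    · rw [abs_of_nonneg (by linarith)]; linarith
  have hside : ∀ r : ℝ, |r| = R → ‖∫ y in η..R, triplePow s a (r + y * I)‖ ≤ M * R := by
    intro r hr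
    refine (intervalIntegral.norm_integral_le_of_norm_le_const (C := M) fun x _ => hb _ ?_).trans ?_
    · have := abs_re_le_norm (r + x * I : ℂ)
      simp only [add_re, ofReal_re, mul_re, ofReal_im, I_im, mul_one, I_re, mul_zero,
        sub_self, add_zero] at this
      rwa [hr] at this
    · rw [abs_of_nonneg (by linarith)]; gcongr; linarith
  have hl := hside (-R) (by rw [abs_neg, abs_of_pos (by linarith)])
  have hr := hside R (abs_of_pos (by linarith))
  have e : ∫ x in (-R)..R, triplePow s a (x + η * I) =
      (∫ x in (-R)..R, triplePow s a (x + R * I)) -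
      I • (∫ y in η..R, triplePow s a (R + y * I)) +
      I • (∫ y in η..R, triplePow s a ((-R : ℝ) + y * I)) := by
    linear_combination key
  rw [e]
  refine (norm_add_le _ _).trans ?_
  refine (add_le_add (norm_sub_le _ _) le_rfl).trans ?_
  rw [norm_smul, norm_smul, norm_I, one_mul, one_mul]
  linarith

theorem tendsto_triplePow_shift {s : ℂ} {a x : ℝ} (h0 : x ≠ 0) (h1 : x ≠ 1) (h2 : x ≠ -a) :
    Tendsto (fun η : ℝ => triplePow s a (x + η * I)) (𝓝[>] 0) (𝓝 (triplePow s a x)) := by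
  have t0 := tendsto_cpow_of_real_add_mul_I h0 (-s)
  have t1 := tendsto_cpow_of_real_add_mul_I (sub_ne_zero.2 h1) (s - 1)
  have t2 := tendsto_cpow_of_real_add_mul_I (x := x + a) (by
    intro h; exact h2 (by linarith)) (-s)
  have := (t0.mul t1).mul t2
  unfold triplePow
  push_cast at this
  refine this.congr fun η => ?_
  congr 2 <;> ring_nf

theorem ae_ne_zero_one_neg (a : ℝ) : ∀ᵐ x : ℝ, x ≠ 0 ∧ x ≠ 1 ∧ x ≠ -a := by
  have h : ∀ c : ℝ, ∀ᵐ x : ℝ, x ≠ c := fun c => by simp [ae_iff, measure_singleton]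
  filter_upwards [h 0, h 1, h (-a)] with x h0 h1 h2 using ⟨h0, h1, h2⟩

theorem norm_triplePow_shift_le {s : ℂ} (hs : s.re = 1 / 2) {a x η : ℝ}
    (h0 : x ≠ 0) (h1 : x ≠ 1) (h2 : x ≠ -a) :
    ‖triplePow s a (x + η * I)‖ ≤ Real.exp (Real.pi * |s.im|) ^ 3 * tripleMajorant a x := by
  refine (norm_triplePow_le hs a _).trans ?_
  have e : ∀ (y : ℝ) (z : ℂ), y ≠ 0 → z.re = y →
      ‖z‖ ^ (-(1 / 2) : ℝ) ≤ |y| ^ (-(1 / 2) : ℝ) := fun y z hy h =>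
    Real.rpow_le_rpow_of_nonpos (abs_pos.2 hy) (h ▸ abs_re_le_norm z) (by norm_num)
  unfold tripleMajorant
  gcongr ?_ * (?_ * ?_ * ?_)
  · exact e _ _ h0 (by simp)
  · exact e _ _ (sub_ne_zero.2 h1) (by simp)
  · exact e _ _ (by intro h; exact h2 (by linarith)) (by simp)

theorem measurable_triplePow_real (s : ℂ) (a : ℝ) (η : ℝ) :
    Measurable fun x : ℝ => triplePow s a (x + η * I) := by
  unfold triplePow; fun_prop

theorem integrable_triplePow {s : ℂ} (hs : s.re = 1 / 2) {a : ℝ} (ha : 0 < a) :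
    Integrable fun x : ℝ => triplePow s a x := by
  refine Integrable.mono'
    ((integrable_tripleMajorant ha).const_mul (Real.exp (Real.pi * |s.im|) ^ 3))
    (by simpa using (measurable_triplePow_real s a 0).aestronglyMeasurable) ?_
  filter_upwards [ae_ne_zero_one_neg a] with x hx
  simpa using norm_triplePow_shift_le (η := 0) hs hx.1 hx.2.1 hx.2.2

theorem norm_integral_triplePow_le {s : ℂ} (hs : s.re = 1 / 2) {a R : ℝ} (ha : 0 < a)
    (hR : 2 ≤ R) (hRa : 2 * a ≤ R) :
    ‖∫ x in (-R)..R, triplePow s a x‖ ≤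
      Real.exp (Real.pi * |s.im|) ^ 3 * (2 * R ^ (-(3 / 2) : ℝ)) * (4 * R) := by
  have hlim : Tendsto (fun η : ℝ => ∫ x in (-R)..R, triplePow s a (x + η * I)) (𝓝[>] 0)
      (𝓝 (∫ x in (-R)..R, triplePow s a x)) := by
    refine intervalIntegral.tendsto_integral_filter_of_dominated_convergence
      (fun x => Real.exp (Real.pi * |s.im|) ^ 3 * tripleMajorant a x) ?_ ?_ ?_ ?_
    · exact Eventually.of_forall fun η => (measurable_triplePow_real s a η).aestronglyMeasurable
    · refine Eventually.of_forall fun η => ?_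
      filter_upwards [ae_ne_zero_one_neg a] with x hx _
      exact norm_triplePow_shift_le hs hx.1 hx.2.1 hx.2.2
    · exact ((integrable_tripleMajorant ha).const_mul _).intervalIntegrable
    · filter_upwards [ae_ne_zero_one_neg a] with x hx _
      exact tendsto_triplePow_shift hx.1 hx.2.1 hx.2.2
  refine le_of_tendsto hlim.norm ?_
  filter_upwards [Ioc_mem_nhdsGT (zero_lt_one' ℝ)] with η hη
  exact norm_integral_triplePow_shift_le hs ha hR hRa hη.1 hη.2

/-- Cauchy's theorem in the upper half-plane: all boundary values are taken from above. -/
theorem integral_triplePow {s : ℂ} (hs : s.re = 1 / 2) {a : ℝ} (ha : 0 < a) :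
    ∫ x : ℝ, triplePow s a x = 0 := by
  have h1 : Tendsto (fun R : ℝ => ∫ x in (-R)..R, triplePow s a x) atTop
      (𝓝 (∫ x : ℝ, triplePow s a x)) :=
    intervalIntegral_tendsto_integral (integrable_triplePow hs ha) tendsto_neg_atTop_atBot
      tendsto_id
  have h2 : Tendsto (fun R : ℝ => ∫ x in (-R)..R, triplePow s a x) atTop (𝓝 0) := by
    have h3 : Tendsto (fun R : ℝ => Real.exp (Real.pi * |s.im|) ^ 3 * 8 * R ^ (-(1 / 2) : ℝ)) atTop
        (𝓝 0) := by
      have := (tendsto_rpow_neg_atTop (by norm_num : (0 : ℝ) < 1 / 2)).const_mul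
        (Real.exp (Real.pi * |s.im|) ^ 3 * 8)
      simpa using this
    refine squeeze_zero_norm' ?_ h3
    filter_upwards [eventually_ge_atTop 2, eventually_ge_atTop (2 * a)] with R hR hRa
    refine (norm_integral_triplePow_le hs ha hR hRa).trans (le_of_eq ?_)
    have hR0 : 0 < R := by linarith
    rw [show (-(1 / 2) : ℝ) = -(3 / 2) + 1 by norm_num, Real.rpow_add hR0, Real.rpow_one]
    ring
  exact tendsto_nhds_unique h1 h2

/-! ### Relation between the Euler integrals on four intervals of the real line -/

theorem ofReal_cpow_eq_exp {x : ℝ} (hx : 0 < x) (w : ℂ) :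
    (x : ℂ) ^ w = cexp (Real.log x * w) := by
  rw [cpow_def_of_ne_zero (by exact_mod_cast hx.ne'), ofReal_log hx.le]

theorem neg_ofReal_cpow {x : ℝ} (hx : 0 < x) (w : ℂ) :
    (-(x : ℂ)) ^ w = cexp (Real.pi * I * w) * (x : ℂ) ^ w := by
  have h : log (-(x : ℂ)) = Real.log x + Real.pi * I := by
    rw [← ofReal_neg]
    apply Complex.ext
    · simp [log_re]
    · simp [log_im, -ofReal_neg, arg_ofReal_of_neg (neg_lt_zero.2 hx)]
  rw [cpow_def_of_ne_zero (by simpa using hx.ne'), h, ofReal_cpow_eq_exp hx, ← Complex.exp_add]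
  ring_nf

theorem conj_ofReal_cpow {x : ℝ} (hx : 0 ≤ x) (w : ℂ) :
    (starRingEnd ℂ) ((x : ℂ) ^ w) = (x : ℂ) ^ ((starRingEnd ℂ) w) := by
  have := conj_cpow (x : ℂ) ((starRingEnd ℂ) w) (by
    rw [arg_ofReal_of_nonneg hx]; exact Real.pi_pos.ne)
  simpa using this.symm

/-- `triplePow` on the real line with its phases removed. -/
noncomputable def tripleAbs (s : ℂ) (a x : ℝ) : ℂ :=
  ((|x| : ℝ) : ℂ) ^ (-s) * ((|x - 1| : ℝ) : ℂ) ^ (s - 1) * ((|x + a| : ℝ) : ℂ) ^ (-s)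

theorem conj_tripleAbs (s : ℂ) (a x : ℝ) :
    (starRingEnd ℂ) (tripleAbs s a x) = tripleAbs ((starRingEnd ℂ) s) a x := by
  simp only [tripleAbs, map_mul, conj_ofReal_cpow (abs_nonneg _), map_neg, map_sub, map_one]

theorem exp_pi_mul_I_mul_sub_one (s : ℂ) :
    cexp (Real.pi * I * (s - 1)) = -cexp (Real.pi * I * s) := by
  rw [mul_sub, mul_one, Complex.exp_sub, Complex.exp_pi_mul_I]; ring

theorem triplePow_of_one_lt (s : ℂ) {a x : ℝ} (ha : 0 < a) (hx : 1 < x) :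
    triplePow s a x = tripleAbs s a x := by
  rw [triplePow, tripleAbs, abs_of_pos (by linarith : 0 < x), abs_of_pos (by linarith : 0 < x - 1),
    abs_of_pos (by linarith : 0 < x + a)]
  push_cast; rfl

theorem triplePow_of_mem_Ioo (s : ℂ) {a x : ℝ} (ha : 0 < a) (hx : x ∈ Ioo (0 : ℝ) 1) :
    triplePow s a x = -cexp (Real.pi * I * s) * tripleAbs s a x := by
  rw [triplePow, tripleAbs, abs_of_pos hx.1, abs_of_neg (by linarith [hx.2] : x - 1 < 0),
    abs_of_pos (by linarith [hx.1] : 0 < x + a),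
    show (x : ℂ) - 1 = -((-(x - 1) : ℝ) : ℂ) by push_cast; ring,
    neg_ofReal_cpow (by linarith [hx.2]), exp_pi_mul_I_mul_sub_one]
  push_cast; ring

theorem triplePow_of_mem_Ioo_neg (s : ℂ) {a x : ℝ} (hx : x ∈ Ioo (-a) 0) :
    triplePow s a x = -tripleAbs s a x := by
  have h := Complex.exp_ne_zero (Real.pi * I * s)
  rw [triplePow, tripleAbs, abs_of_neg hx.2, abs_of_neg (by linarith [hx.2] : x - 1 < 0),
    abs_of_pos (by linarith [hx.1] : 0 < x + a),
    show (x : ℂ) - 1 = -((-(x - 1) : ℝ) : ℂ) by push_cast; ring,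
    show (x : ℂ) ^ (-s) = (-((-x : ℝ) : ℂ)) ^ (-s) by push_cast; ring_nf,
    neg_ofReal_cpow (by linarith [hx.2]), neg_ofReal_cpow (by linarith [hx.2]),
    exp_pi_mul_I_mul_sub_one, mul_neg, Complex.exp_neg]
  push_cast; field_simp

theorem triplePow_of_lt_neg (s : ℂ) {a x : ℝ} (ha : 0 < a) (hx : x < -a) :
    triplePow s a x = -cexp (-(Real.pi * I * s)) * tripleAbs s a x := by
  have h := Complex.exp_ne_zero (Real.pi * I * s)
  rw [triplePow, tripleAbs, abs_of_neg (by linarith : x < 0),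
    abs_of_neg (by linarith : x - 1 < 0), abs_of_neg (by linarith : x + a < 0),
    show (x : ℂ) - 1 = -((-(x - 1) : ℝ) : ℂ) by push_cast; ring,
    show (x : ℂ) + a = -((-(x + a) : ℝ) : ℂ) by push_cast; ring,
    show (x : ℂ) ^ (-s) = (-((-x : ℝ) : ℂ)) ^ (-s) by push_cast; ring_nf,
    neg_ofReal_cpow (by linarith), neg_ofReal_cpow (by linarith), neg_ofReal_cpow (by linarith),
    exp_pi_mul_I_mul_sub_one, mul_neg, Complex.exp_neg]
  push_cast; field_simp

/-- The vanishing of the integral of `triplePow` over the real line, split at `-a`, `0` and `1`. Each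
component carries a constant phase. -/
theorem integral_tripleAbs_relation {s : ℂ} (hs : s.re = 1 / 2) {a : ℝ} (ha : 0 < a) :
    (∫ x in Ioi (1 : ℝ), tripleAbs s a x) -
      cexp (Real.pi * I * s) * (∫ x in Ioo (0 : ℝ) 1, tripleAbs s a x) -
      (∫ x in Ioo (-a) 0, tripleAbs s a x) -
      cexp (-(Real.pi * I * s)) * (∫ x in Iio (-a), tripleAbs s a x) = 0 := by
  have h := integral_triplePow hs ha
  have hi := integrable_triplePow hs ha
  have e1 : ∫ x : ℝ, triplePow s a x =
      (∫ x in Iic (-a), triplePow s a x) + (∫ x in Ioc (-a) 0, triplePow s a x) +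
      (∫ x in Ioc (0 : ℝ) 1, triplePow s a x) + ∫ x in Ioi (1 : ℝ), triplePow s a x := by
    rw [← setIntegral_union (Iic_disjoint_Ioc le_rfl) measurableSet_Ioc hi.integrableOn
      hi.integrableOn, Iic_union_Ioc_eq_Iic (by linarith),
      ← setIntegral_union (Iic_disjoint_Ioc le_rfl) measurableSet_Ioc hi.integrableOn
      hi.integrableOn, Iic_union_Ioc_eq_Iic (by linarith),
      ← setIntegral_union (Iic_disjoint_Ioi le_rfl) measurableSet_Ioi hi.integrableOn
      hi.integrableOn, Iic_union_Ioi, setIntegral_univ]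
  rw [integral_Iic_eq_integral_Iio, integral_Ioc_eq_integral_Ioo, integral_Ioc_eq_integral_Ioo,
    setIntegral_congr_fun measurableSet_Iio (fun x hx => triplePow_of_lt_neg s ha hx),
    setIntegral_congr_fun measurableSet_Ioo (fun x hx => triplePow_of_mem_Ioo_neg s hx),
    setIntegral_congr_fun measurableSet_Ioo (fun x hx => triplePow_of_mem_Ioo s ha hx),
    setIntegral_congr_fun measurableSet_Ioi (fun x hx => triplePow_of_one_lt s ha hx),
    integral_const_mul, integral_const_mul, integral_neg, h] at e1
  linear_combination -e1

/-- Closing the contour in the upper and in the lower half-plane gives two relations between the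
four Euler integrals; eliminating the one over `(-∞, -a)` leaves this connection formula. -/
theorem integral_tripleAbs_connection {s : ℂ} (hs : s.re = 1 / 2) {a : ℝ} (ha : 0 < a) :
    (∫ x in Ioi (1 : ℝ), tripleAbs s a x) - (∫ x in Ioo (-a) 0, tripleAbs s a x) =
      2 * cos (Real.pi * s) * ∫ x in Ioo (0 : ℝ) 1, tripleAbs s a x := by
  have h1 := integral_tripleAbs_relation hs ha
  have h2 := integral_tripleAbs_relation (s := (starRingEnd ℂ) s) (by simpa using hs) ha
  have h3 := congrArg (starRingEnd ℂ) h2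
  have e : ∀ S : Set ℝ, (starRingEnd ℂ) (∫ x in S, tripleAbs ((starRingEnd ℂ) s) a x) =
      ∫ x in S, tripleAbs s a x := by
    intro S
    rw [← integral_conj]
    simp only [conj_tripleAbs, conj_conj]
  simp only [map_sub, map_mul, e, ← Complex.exp_conj, map_neg, conj_ofReal, conj_I, conj_conj,
    map_zero] at h3
  rw [show (Real.pi : ℂ) * -I * s = -(Real.pi * I * s) by ring, neg_neg] at h3
  set u := cexp (Real.pi * I * s) with hu
  set v := cexp (-(Real.pi * I * s)) with hv
  have huv : u * v = 1 := by rw [hu, hv, ← Complex.exp_add]; simp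
  have hcos : 2 * cos (Real.pi * s) = u + v := by
    rw [Complex.cos, hu, hv]
    rw [show (Real.pi : ℂ) * s * I = Real.pi * I * s by ring,
      show -((Real.pi : ℂ) * s) * I = -(Real.pi * I * s) by ring]
    ring
  have hne : u - v ≠ 0 := by
    have hsin : sin (Real.pi * s) ≠ 0 := by
      rw [Complex.sin_ne_zero_iff]
      intro n hn
      have hp : (Real.pi : ℂ) ≠ 0 := by exact_mod_cast Real.pi_ne_zero
      have : s = n := by
        have : (Real.pi : ℂ) * s = Real.pi * n := by rw [hn]; ring
        exact mul_left_cancel₀ hp this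
      rw [this] at hs
      simp only [intCast_re] at hs
      have h4 : ((2 * n : ℤ) : ℝ) = ((1 : ℤ) : ℝ) := by push_cast; linarith
      have := Int.cast_injective h4
      omega
    intro h0
    apply hsin
    rw [Complex.sin, show (Real.pi : ℂ) * s * I = Real.pi * I * s by ring,
      show -((Real.pi : ℂ) * s) * I = -(Real.pi * I * s) by ring, ← hu, ← hv]
    linear_combination -h0 * I / 2
  rw [hcos]
  -- eliminate the integral over `(-∞, -a)`
  refine mul_left_cancel₀ hne ?_
  linear_combination u * h1 - v * h3

/-! ### The connection formula on the critical line -/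

/-- The Euler integral `∫₀¹ yˢ⁻¹ (1 - y)ˢ⁻¹ (1 - w y)⁻ˢ dy`, a multiple of `₂F₁(s, s; 2s; w)`. -/
noncomputable def eulerJ (s w : ℂ) : ℂ :=
  ∫ y : ℝ in 0..1, (y : ℂ) ^ (s - 1) * (1 - (y : ℂ)) ^ (s - 1) * (1 - w * (y : ℂ)) ^ (-s)

/-- The substitution `x = 1/(1 - y)` turns the integral over `(1, ∞)` into an Euler integral. -/
theorem integral_tripleAbs_Ioi {s : ℂ} {a : ℝ} (ha : 0 < a) :
    ∫ x in Ioi (1 : ℝ), tripleAbs s a x =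
      ((1 + a : ℝ) : ℂ) ^ (-s) * eulerJ s ((a / (1 + a) : ℝ) : ℂ) := by
  have himg : (fun y : ℝ => (1 - y)⁻¹) '' Ioo 0 1 = Ioi 1 := by
    ext x
    constructor
    · rintro ⟨y, hy, rfl⟩
      have h1 : 0 < 1 - y := by linarith [hy.2]
      exact (one_lt_inv₀ h1).2 (by linarith [hy.1])
    · intro hx
      have hx : 1 < x := hx
      refine ⟨1 - x⁻¹, ⟨?_, ?_⟩, by simp⟩
      · have := inv_lt_one_of_one_lt₀ hx; linarith
      · have : 0 < x⁻¹ := by positivity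
        linarith
  have hder : ∀ y ∈ Ioo (0 : ℝ) 1, HasDerivWithinAt (fun y : ℝ => (1 - y)⁻¹)
      (((1 - y) ^ 2)⁻¹) (Ioo 0 1) y := by
    intro y hy
    have h1 : HasDerivAt (fun y : ℝ => 1 - y) (-1) y := by
      simpa using (hasDerivAt_id y).const_sub 1
    have := h1.inv (by linarith [hy.2])
    refine (this.congr_deriv ?_).hasDerivWithinAt
    field_simp
  have hinj : InjOn (fun y : ℝ => (1 - y)⁻¹) (Ioo 0 1) := by
    intro x _ y _ h
    have := inv_injective h
    linarith
  rw [← himg, integral_image_eq_integral_abs_deriv_smul measurableSet_Ioo hder hinj, eulerJ,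
    intervalIntegral.integral_of_le zero_le_one, integral_Ioc_eq_integral_Ioo,
    ← integral_const_mul]
  refine setIntegral_congr_fun measurableSet_Ioo fun y hy => ?_
  have hy0 := hy.1
  have hy1 : 0 < 1 - y := by linarith [hy.2]
  have h2 : 0 < 1 - a / (1 + a) * y := by
    have : a / (1 + a) < 1 := (div_lt_one (by linarith)).2 (by linarith)
    nlinarith [div_pos ha (by linarith : 0 < 1 + a), hy.2]
  have e1 : |(1 - y)⁻¹ - 1| = y / (1 - y) := by
    rw [abs_of_pos]
    · field_simp; ring
    · rw [sub_pos]; exact (one_lt_inv₀ hy1).2 (by linarith)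
  have e2 : |(1 - y)⁻¹ + a| = (1 + a) * (1 - a / (1 + a) * y) / (1 - y) := by
    rw [abs_of_pos (by positivity)]
    field_simp; ring
  simp only [tripleAbs]
  rw [e1, e2, abs_of_pos (inv_pos.2 hy1), abs_of_pos (by positivity), real_smul,
    show (1 : ℂ) - (y : ℂ) = ((1 - y : ℝ) : ℂ) by push_cast; ring,
    show (1 : ℂ) - ((a / (1 + a) : ℝ) : ℂ) * (y : ℂ) = ((1 - a / (1 + a) * y : ℝ) : ℂ) by
      push_cast; ring]
  have e3 : ((((1 - y) ^ 2)⁻¹ : ℝ) : ℂ) = cexp (-(2 * Real.log (1 - y) : ℝ)) := by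
    rw [← ofReal_neg, ← ofReal_exp, Real.exp_neg, two_mul, Real.exp_add, Real.exp_log hy1, sq]
  rw [e3, ofReal_cpow_eq_exp (by positivity), ofReal_cpow_eq_exp (by positivity),
    ofReal_cpow_eq_exp (by positivity), ofReal_cpow_eq_exp (by positivity),
    ofReal_cpow_eq_exp (by positivity), ofReal_cpow_eq_exp (by positivity),
    ofReal_cpow_eq_exp (by positivity)]
  simp only [← Complex.exp_add]
  rw [Real.log_inv, Real.log_div (by positivity) (by positivity),
    Real.log_div (by positivity) (by positivity), Real.log_mul (by positivity) (by positivity)]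
  push_cast
  congr 1
  ring

/-- The substitution `x = -a (1 - y)` turns the integral over `(-a, 0)` into an Euler integral. -/
theorem integral_tripleAbs_Ioo_neg {s : ℂ} {a : ℝ} (ha : 0 < a) :
    ∫ x in Ioo (-a) 0, tripleAbs s a x =
      (a : ℂ) ^ (1 - 2 * s) * ((1 + a : ℝ) : ℂ) ^ (s - 1) *
        eulerJ (1 - s) ((a / (1 + a) : ℝ) : ℂ) := by
  have himg : (fun y : ℝ => -a * (1 - y)) '' Ioo 0 1 = Ioo (-a) 0 := by
    ext x
    constructor
    · rintro ⟨y, hy, rfl⟩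
      constructor <;> nlinarith [hy.1, hy.2]
    · intro hx
      refine ⟨1 + x / a, ⟨?_, ?_⟩, by field_simp; ring⟩
      · have : -1 < x / a := by rw [lt_div_iff₀ ha]; linarith [hx.1]
        linarith
      · have : x / a < 0 := div_neg_of_neg_of_pos hx.2 ha
        linarith
  have hder : ∀ y ∈ Ioo (0 : ℝ) 1, HasDerivWithinAt (fun y : ℝ => -a * (1 - y))
      a (Ioo 0 1) y := by
    intro y hy
    have h1 : HasDerivAt (fun y : ℝ => 1 - y) (-1) y := by
      simpa using (hasDerivAt_id y).const_sub 1
    exact ((h1.const_mul (-a)).congr_deriv (by ring)).hasDerivWithinAt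
  have hinj : InjOn (fun y : ℝ => -a * (1 - y)) (Ioo 0 1) := by
    intro x _ y _ h
    have := mul_left_cancel₀ (by linarith : -a ≠ 0) h
    linarith
  rw [← himg, integral_image_eq_integral_abs_deriv_smul measurableSet_Ioo hder hinj, eulerJ,
    intervalIntegral.integral_of_le zero_le_one, integral_Ioc_eq_integral_Ioo,
    ← integral_const_mul]
  refine setIntegral_congr_fun measurableSet_Ioo fun y hy => ?_
  have hy0 := hy.1
  have hy1 : 0 < 1 - y := by linarith [hy.2]
  have h2 : 0 < 1 - a / (1 + a) * y := by
    have : a / (1 + a) < 1 := (div_lt_one (by linarith)).2 (by linarith)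
    nlinarith [div_pos ha (by linarith : 0 < 1 + a), hy.2]
  have e0 : |(-a * (1 - y))| = a * (1 - y) := by
    rw [abs_of_neg (by nlinarith)]; ring
  have e1 : |-a * (1 - y) - 1| = (1 + a) * (1 - a / (1 + a) * y) := by
    rw [abs_of_neg (by nlinarith)]
    field_simp; ring
  have e2 : |-a * (1 - y) + a| = a * y := by
    rw [abs_of_pos (by nlinarith)]; ring
  simp only [tripleAbs]
  rw [e0, e1, e2, abs_of_pos ha, real_smul,
    show (1 : ℂ) - (y : ℂ) = ((1 - y : ℝ) : ℂ) by push_cast; ring,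
    show (1 : ℂ) - ((a / (1 + a) : ℝ) : ℂ) * (y : ℂ) = ((1 - a / (1 + a) * y : ℝ) : ℂ) by
      push_cast; ring]
  have e3 : (a : ℂ) = cexp (Real.log a : ℝ) := by
    rw [← ofReal_exp, Real.exp_log ha]
  rw [ofReal_cpow_eq_exp (by positivity), ofReal_cpow_eq_exp (by positivity),
    ofReal_cpow_eq_exp (by positivity), ofReal_cpow_eq_exp (by positivity),
    ofReal_cpow_eq_exp (by positivity), ofReal_cpow_eq_exp (by positivity),
    ofReal_cpow_eq_exp (by positivity), ofReal_cpow_eq_exp (by positivity)]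
  rw [e3]
  simp only [← Complex.exp_add]
  rw [Real.log_mul (by positivity) (by positivity), Real.log_mul (by positivity) (by positivity),
    Real.log_mul (by positivity) (by positivity)]
  push_cast
  congr 1
  ring

/-- Euler's integral for the block at a negative argument. -/
theorem blockH_eq_integral_tripleAbs {s : ℂ} (hs : s.re = 1 / 2) {a : ℝ} (ha : 0 < a) :
    blockH s (-(a⁻¹ : ℝ)) = sin (Real.pi * s) / Real.pi * (a : ℂ) ^ s *
      ∫ x in Ioo (0 : ℝ) 1, tripleAbs s a x := by
  have hb : 0 < (1 - s).re := by simp [hs]; norm_num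
  have hbc : (1 - s).re < (1 : ℂ).re := by simp [hs]
  have hw0 : 0 < a⁻¹ := by positivity
  have hw : (-(a⁻¹ : ℝ) : ℂ) ∈ hypDomain := by
    left
    rw [neg_re, ofReal_re]
    linarith
  have hG : 1 / (Gamma (1 - s) * Gamma s) = sin (Real.pi * s) / Real.pi := by
    rw [mul_comm (Gamma (1 - s)), Complex.Gamma_mul_Gamma_one_sub, one_div_div]
  rw [blockH, hyp2F1_eq_euler hb hbc hw, sub_sub_cancel, Gamma_one, hG, mul_assoc]
  congr 1
  rw [intervalIntegral.integral_of_le zero_le_one, integral_Ioc_eq_integral_Ioo,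
    ← integral_const_mul]
  refine setIntegral_congr_fun measurableSet_Ioo fun y hy => ?_
  have hy0 := hy.1
  have hy1 : 0 < 1 - y := by linarith [hy.2]
  have e1 : (1 : ℂ) - -((a⁻¹ : ℝ) : ℂ) * (y : ℂ) = (((y + a) / a : ℝ) : ℂ) := by
    have : (a : ℂ) ≠ 0 := by exact_mod_cast ha.ne'
    push_cast; field_simp; ring
  simp only [tripleAbs]
  rw [e1, abs_of_pos hy0, abs_of_neg (by linarith : y - 1 < 0), abs_of_pos (by positivity),
    show (1 : ℂ) - (y : ℂ) = ((1 - y : ℝ) : ℂ) by push_cast; ring, neg_sub]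
  rw [ofReal_cpow_eq_exp (by positivity), ofReal_cpow_eq_exp (by positivity),
    ofReal_cpow_eq_exp (by positivity), ofReal_cpow_eq_exp (by positivity),
    ofReal_cpow_eq_exp (by positivity), ofReal_cpow_eq_exp (by positivity)]
  simp only [← Complex.exp_add]
  rw [Real.log_div (by positivity) (by positivity)]
  push_cast
  congr 1
  ring

/-- The connection formula for real `z`, obtained with `a = z²/(1 - z²)`, for which
`-1/a = 1 - z⁻²` and `a/(1 + a) = z²`. -/
theorem blockH_connection_real {s : ℂ} (hs : s.re = 1 / 2) (hcos : cos (Real.pi * s) ≠ 0) {z : ℝ}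
    (hz : 0 < z) (hz1 : z < 1) :
    blockH s (1 - ((z : ℂ) ^ 2)⁻¹) = sin (Real.pi * s) / (2 * Real.pi * cos (Real.pi * s)) *
      ((z : ℂ) ^ (2 * s) * eulerJ s ((z : ℂ) ^ 2) -
        (z : ℂ) ^ (2 - 2 * s) * eulerJ (1 - s) ((z : ℂ) ^ 2)) := by
  have hz2 : 0 < 1 - z ^ 2 := by nlinarith
  obtain ⟨a, ha⟩ : ∃ a, a = z ^ 2 / (1 - z ^ 2) := ⟨_, rfl⟩
  have ha0 : 0 < a := by rw [ha]; positivity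
  have hw : (1 : ℂ) - ((z : ℂ) ^ 2)⁻¹ = -((a⁻¹ : ℝ) : ℂ) := by
    rw [ha]
    have : (z : ℂ) ≠ 0 := by exact_mod_cast hz.ne'
    push_cast
    rw [inv_div]
    field_simp
    ring
  have h1 : a / (1 + a) = z ^ 2 := by rw [ha]; field_simp; ring
  have h2 : 1 + a = (1 - z ^ 2)⁻¹ := by rw [ha]; field_simp; ring
  have key := integral_tripleAbs_connection hs ha0
  rw [integral_tripleAbs_Ioi ha0, integral_tripleAbs_Ioo_neg ha0, h1, ofReal_pow] at key
  have key2 : ∫ x in Ioo (0 : ℝ) 1, tripleAbs s a x = (2 * cos (Real.pi * s))⁻¹ *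
      (((1 + a : ℝ) : ℂ) ^ (-s) * eulerJ s ((z : ℂ) ^ 2) -
      (a : ℂ) ^ (1 - 2 * s) * ((1 + a : ℝ) : ℂ) ^ (s - 1) * eulerJ (1 - s) ((z : ℂ) ^ 2)) := by
    rw [key]; field_simp
  have hla : Real.log a = 2 * Real.log z - Real.log (1 - z ^ 2) := by
    rw [ha, Real.log_div (by positivity) (by positivity), Real.log_pow]; norm_num
  have c1 : (a : ℂ) ^ s * ((1 + a : ℝ) : ℂ) ^ (-s) = (z : ℂ) ^ (2 * s) := by
    rw [ofReal_cpow_eq_exp ha0, ofReal_cpow_eq_exp (by positivity), ofReal_cpow_eq_exp hz,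
      ← Complex.exp_add, hla, h2, Real.log_inv]
    push_cast; congr 1; ring
  have c2 : (a : ℂ) ^ s * ((a : ℂ) ^ (1 - 2 * s) * ((1 + a : ℝ) : ℂ) ^ (s - 1)) =
      (z : ℂ) ^ (2 - 2 * s) := by
    rw [ofReal_cpow_eq_exp ha0, ofReal_cpow_eq_exp ha0, ofReal_cpow_eq_exp (by positivity),
      ofReal_cpow_eq_exp hz, ← Complex.exp_add, ← Complex.exp_add, hla, h2, Real.log_inv]
    push_cast; congr 1; ring
  rw [hw, blockH_eq_integral_tripleAbs hs ha0, key2, ← c1, ← c2]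
  have hpi : (Real.pi : ℂ) ≠ 0 := by exact_mod_cast Real.pi_ne_zero
  field_simp

theorem eulerJ_eq_hyp2F1 {s : ℂ} (hs : s.re = 1 / 2) {w : ℂ} (hw : w ∈ hypDomain) :
    eulerJ s w = Gamma s ^ 2 / Gamma (2 * s) * hyp2F1 s s (2 * s) w := by
  have hs0 : 0 < s.re := by rw [hs]; norm_num
  have hbc : s.re < (2 * s).re := by simp [hs]; norm_num
  have h1 : Gamma s ≠ 0 := Gamma_ne_zero_of_re_pos hs0
  have h2 : Gamma (2 * s) ≠ 0 := Gamma_ne_zero_of_re_pos (by linarith)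
  rw [hyp2F1_eq_euler hs0 hbc hw, show 2 * s - s - 1 = s - 1 by ring, show 2 * s - s = s by ring,
    eulerJ, ← mul_assoc,
    show Gamma s ^ 2 / Gamma (2 * s) * (Gamma (2 * s) / (Gamma s * Gamma s)) = 1 by field_simp,
    one_mul]

theorem differentiableOn_eulerJ {s : ℂ} (hs : s.re = 1 / 2) :
    DifferentiableOn ℂ (eulerJ s) hypDomain := by
  have hs0 : 0 < s.re := by rw [hs]; norm_num
  have hbc : s.re < (2 * s).re := by simp [hs]; norm_num
  refine ((isHypBranch_hyp2F1 (a := s) hs0 hbc).1.const_mul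
    (Gamma s ^ 2 / Gamma (2 * s))).congr fun w hw => ?_
  exact eulerJ_eq_hyp2F1 hs hw

theorem one_sub_inv_sq_mem_hypDomain {z : ℂ} (hz : 0 < z.re) : 1 - (z ^ 2)⁻¹ ∈ hypDomain := by
  by_contra h
  simp only [hypDomain, mem_ofPred_eq, not_or, not_lt, not_not] at h
  obtain ⟨h1, h2⟩ := h
  simp only [sub_re, one_re, sub_im, one_im, inv_re, inv_im] at h1 h2
  have hz0 : z ≠ 0 := by rintro rfl; simp at hz
  have hn : 0 < normSq (z ^ 2) := normSq_pos.2 (pow_ne_zero 2 hz0)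
  have h3 : (z ^ 2).im = 0 := by
    have : -(z ^ 2).im / normSq (z ^ 2) = 0 := by linarith
    rw [div_eq_zero_iff] at this
    rcases this with h | h
    · linarith
    · exact absurd h hn.ne'
  have h4 : (z ^ 2).re ≤ 0 := by
    by_contra h5
    push Not at h5
    have := div_pos h5 hn
    linarith
  rw [sq, mul_im] at h3
  rw [sq, mul_re] at h4
  have : z.im = 0 := by
    have : z.re * z.im = 0 := by linarith
    exact (mul_eq_zero.1 this).resolve_left hz.ne'
  rw [this] at h4
  nlinarith

theorem mem_hypDomain_of_norm_lt_one {w : ℂ} (hw : ‖w‖ < 1) : w ∈ hypDomain :=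
  Or.inl ((re_le_norm w).trans_lt hw)

/-- The connection formula between `0` and `∞`, in the variable `w = 1 - z⁻²`. -/
theorem blockH_connection {s : ℂ} (hs : s.re = 1 / 2) (hcos : cos (Real.pi * s) ≠ 0) {z : ℂ}
    (hz : 0 < z.re) (hz1 : ‖z‖ < 1) :
    blockH s (1 - (z ^ 2)⁻¹) = sin (Real.pi * s) / (2 * Real.pi * cos (Real.pi * s)) *
      (z ^ (2 * s) * eulerJ s (z ^ 2) - z ^ (2 - 2 * s) * eulerJ (1 - s) (z ^ 2)) := by
  set U : Set ℂ := {z | 0 < z.re} ∩ Metric.ball 0 1 with hU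
  have hUo : IsOpen U := (isOpen_lt continuous_const continuous_re).inter Metric.isOpen_ball
  have hUc : IsPreconnected U :=
    ((convex_halfSpace_re_gt 0).inter (convex_ball 0 1)).isPreconnected
  have hn0 : ∀ z ∈ U, z ≠ 0 := by
    rintro z ⟨hz, _⟩ rfl
    simp at hz
  have hL : DifferentiableOn ℂ (fun z => blockH s (1 - (z ^ 2)⁻¹)) U := by
    have hb : 0 < (1 - s).re := by simp [hs]; norm_num
    have hbc : (1 - s).re < (1 : ℂ).re := by simp [hs]
    refine (isHypBranch_hyp2F1 (a := s) hb hbc).1.comp (g := hyp2F1 s (1 - s) 1)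
      (f := fun z : ℂ => 1 - (z ^ 2)⁻¹) ?_ fun z hz => one_sub_inv_sq_mem_hypDomain hz.1
    intro z hz
    exact ((differentiableAt_id.pow 2).inv (pow_ne_zero 2 (hn0 z hz))).const_sub 1
      |>.differentiableWithinAt
  have hJ : ∀ s' : ℂ, s'.re = 1 / 2 → DifferentiableOn ℂ (fun z => eulerJ s' (z ^ 2)) U := by
    intro s' hs'
    refine (differentiableOn_eulerJ hs').comp (f := fun z : ℂ => z ^ 2) (by fun_prop) ?_
    intro z hz
    refine mem_hypDomain_of_norm_lt_one ?_
    have := mem_ball_zero_iff.1 hz.2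
    rw [norm_pow]
    exact pow_lt_one₀ (norm_nonneg _) this two_ne_zero
  have hP : ∀ e : ℂ, DifferentiableOn ℂ (fun z : ℂ => z ^ e) U := fun e z hz =>
    (differentiableAt_id.cpow_const (Or.inl hz.1)).differentiableWithinAt
  have hR : DifferentiableOn ℂ (fun z => sin (Real.pi * s) / (2 * Real.pi * cos (Real.pi * s)) *
      (z ^ (2 * s) * eulerJ s (z ^ 2) - z ^ (2 - 2 * s) * eulerJ (1 - s) (z ^ 2))) U :=
    (((hP _).mul (hJ s hs)).sub ((hP _).mul (hJ (1 - s) (by simp [hs]; norm_num)))).const_mul _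
  -- both sides are holomorphic on the half disc and agree on `(0, 1)`
  refine (hL.analyticOnNhd hUo).eqOn_of_preconnected_of_frequently_eq (hR.analyticOnNhd hUo) hUc
    (z₀ := ((1 / 2 : ℝ) : ℂ)) ?_ ?_ ⟨hz, by simpa using hz1⟩
  · refine ⟨by simp, ?_⟩
    rw [mem_ball_zero_iff, norm_real]
    norm_num
  · have ht : Tendsto (fun x : ℝ => (x : ℂ)) (𝓝[≠] (1 / 2)) (𝓝[≠] ((1 / 2 : ℝ) : ℂ)) := by
      refine tendsto_nhdsWithin_of_tendsto_nhds_of_eventually_within _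
        ((continuous_ofReal.tendsto _).mono_left nhdsWithin_le_nhds) ?_
      filter_upwards [self_mem_nhdsWithin] with x hx
      exact fun h => hx (ofReal_injective h)
    refine ht.frequently (Eventually.frequently ?_)
    have : Ioo (0 : ℝ) 1 ∈ 𝓝 (1 / 2 : ℝ) := Ioo_mem_nhds (by norm_num) (by norm_num)
    filter_upwards [mem_nhdsWithin_of_mem_nhds this] with x hx
    exact blockH_connection_real hs hcos hx.1 hx.2

/-! ### Stirling's formula on vertical lines -/

/-- The one-step defect `(s + 1/2) log (1 + 1/s) - 1` in Stirling's formula. -/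
noncomputable def stirlingDefect (s : ℂ) : ℂ := (s + 1 / 2) * log (1 + s⁻¹) - 1

/-- The defect is `O(1/|s|²)`: the terms of order `1` and `1/s` of the logarithm cancel. -/
theorem norm_stirlingDefect_le {s : ℂ} (hs : 1 / 2 ≤ s.re) (hs' : 1 ≤ |s.im|) :
    ‖stirlingDefect s‖ ≤ 6 / (s.re ^ 2 + s.im ^ 2) := by
  have hsq : ‖s‖ ^ 2 = s.re ^ 2 + s.im ^ 2 := by rw [Complex.sq_norm, normSq_apply]; ring
  have him : 1 ≤ s.im ^ 2 := by rw [← sq_abs]; nlinarith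
  -- `|s|² ≥ 1/4 + 1`, so that `1/s` stays away from the unit circle
  have hn : 10 / 9 ≤ ‖s‖ := by
    by_contra h
    push Not at h
    nlinarith [norm_nonneg s]
  have hs0 : s ≠ 0 := by rintro rfl; norm_num at hn
  set w := s⁻¹ with hw
  have hsw : s * w = 1 := mul_inv_cancel₀ hs0
  have hwn : ‖w‖ ≤ 9 / 10 := by
    rw [hw, norm_inv]
    exact inv_le_of_inv_le₀ (by norm_num) (by norm_num; linarith)
  have hnw : ‖s‖ * ‖w‖ = 1 := by rw [← norm_mul, hsw, norm_one]
  set E := log (1 + w) - logTaylor 3 w with hE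
  have hEn : ‖E‖ ≤ 10 / 3 * ‖w‖ ^ 3 := by
    refine (norm_log_sub_logTaylor_le 2 (by linarith)).trans ?_
    have : (1 - ‖w‖)⁻¹ ≤ 10 := inv_le_of_inv_le₀ (by norm_num) (by norm_num; linarith)
    have h3 : 0 ≤ ‖w‖ ^ 3 := by positivity
    norm_num
    nlinarith
  have hT : logTaylor 3 w = w - w ^ 2 / 2 := by
    simp [logTaylor_succ, logTaylor_zero]; ring
  have e : stirlingDefect s = -(w ^ 2 / 4) + (s + 1 / 2) * E := by
    rw [stirlingDefect, ← hw, show log (1 + w) = E + (w - w ^ 2 / 2) by rw [hE, hT]; ring]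
    linear_combination (1 - w / 2) * hsw
  rw [← hsq, e]
  have h1 : ‖s + 1 / 2‖ ≤ ‖s‖ + 1 / 2 := (norm_add_le _ _).trans (by norm_num)
  have h2 : 6 / ‖s‖ ^ 2 = 6 * ‖w‖ ^ 2 := by
    rw [hw, norm_inv]; field_simp
  rw [h2]
  refine (norm_add_le _ _).trans ?_
  rw [norm_neg, norm_div, norm_pow, norm_mul]
  have h3 : ‖s + 1 / 2‖ * ‖E‖ ≤ (‖s‖ + 1 / 2) * (10 / 3 * ‖w‖ ^ 3) := by gcongr
  have h4 : (‖s‖ + 1 / 2) * (10 / 3 * ‖w‖ ^ 3) = 10 / 3 * (1 + ‖w‖ / 2) * ‖w‖ ^ 2 := by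
    linear_combination (10 / 3 * ‖w‖ ^ 2) * hnw
  have h5 : 0 ≤ ‖w‖ ^ 2 := by positivity
  norm_num
  nlinarith

/-- `Γ(s)` divided by the exponential factor in Stirling's formula. -/
noncomputable def stirlingQuotient (s : ℂ) : ℂ := Gamma s * cexp (s - (s - 1 / 2) * log s)

theorem log_mul_of_re_pos {z w : ℂ} (hz : |arg z| ≤ Real.pi / 2) (hz0 : z ≠ 0) (hw : 0 < w.re) :
    log (z * w) = log z + log w := by
  have hw0 : w ≠ 0 := by rintro rfl; simp at hw
  have h := abs_lt.1 (abs_arg_lt_pi_div_two_iff.2 (Or.inl hw))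
  have h' := abs_le.1 hz
  rw [Complex.log_mul_eq_add_log_iff hz0 hw0]
  constructor <;> linarith

theorem stirlingQuotient_eq_mul_exp {s : ℂ} (hs : 0 < s.re) :
    stirlingQuotient s = stirlingQuotient (s + 1) * cexp (stirlingDefect s) := by
  have hs0 : s ≠ 0 := by rintro rfl; simp at hs
  have h1 : 0 < (1 + s⁻¹).re := by
    rw [add_re, one_re, inv_re]
    have : 0 ≤ s.re / normSq s := div_nonneg hs.le (normSq_nonneg s)
    linarith
  have hlog : log (s + 1) = log s + log (1 + s⁻¹) := by
    rw [← log_mul_of_re_pos (abs_arg_lt_pi_div_two_iff.2 (Or.inl hs)).le hs0 h1]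
    congr 1; field_simp
  rw [stirlingQuotient, stirlingQuotient, stirlingDefect, Gamma_add_one s hs0, hlog,
    mul_assoc, ← Complex.exp_add, mul_comm s, mul_assoc]
  congr 1
  have h2 := Complex.exp_log hs0
  set l := log s
  set m := log (1 + s⁻¹)
  rw [← h2, ← Complex.exp_add, h2]
  congr 1
  ring

theorem stirlingQuotient_eq_mul_exp_sum {s : ℂ} (hs : 0 < s.re) (n : ℕ) :
    stirlingQuotient s =
      stirlingQuotient (s + n) * cexp (∑ j ∈ Finset.range n, stirlingDefect (s + j)) := by
  induction n with
  | zero => simp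
  | succ n ih =>
    rw [ih, stirlingQuotient_eq_mul_exp (s := s + n) (by simp; positivity),
      Finset.sum_range_succ, Complex.exp_add]
    push_cast
    rw [add_assoc s (n : ℂ) 1]
    ring

/-- Euler's limit formula and Stirling's formula for `n!` combine into the value of the quotient at
`s + n + 1`. -/
theorem stirlingQuotient_add_nat {s : ℂ} (hs : 0 < s.re) {n : ℕ} (hn : n ≠ 0) :
    stirlingQuotient (s + (n + 1 : ℕ)) = Gamma s / GammaSeq s n * (Stirling.stirlingSeq n * √2 : ℝ) *
      cexp (s + 1 - (s + n + 1 / 2) * log (1 + (s + 1) / n)) := by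
  have hne : ∀ k : ℕ, s ≠ -k := by
    intro k h
    have := congrArg re h
    simp at this
    linarith [Nat.cast_nonneg (α := ℝ) k]
  have hn0 : (n : ℂ) ≠ 0 := by exact_mod_cast hn
  have hnpos : (0 : ℝ) < n := by exact_mod_cast Nat.pos_of_ne_zero hn
  have h1 := Gamma_add_nat_div_Gamma_eq (n := n + 1) s hne
  have hG : Gamma s ≠ 0 := Gamma_ne_zero_of_re_pos hs
  have hprod : (ascPochhammer ℂ (n + 1)).eval s = ∏ j ∈ Finset.range (n + 1), (s + j) := by
    generalize n + 1 = m
    induction m with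
    | zero => simp
    | succ m ih => rw [ascPochhammer_succ_eval, ih, Finset.prod_range_succ]
  have hprod0 : ∏ j ∈ Finset.range (n + 1), (s + (j : ℂ)) ≠ 0 := by
    rw [Finset.prod_ne_zero_iff]
    intro j _ h
    exact hne j (by linear_combination h)
  rw [hprod, div_eq_iff hG] at h1
  have hpow : (n : ℂ) ^ s = cexp (Real.log n * s) := by
    have := ofReal_cpow_eq_exp hnpos s
    simpa using this
  have hfac : (n.factorial : ℂ) =
      (Stirling.stirlingSeq n * √2 : ℝ) * cexp ((1 / 2 + n) * Real.log n - n) := by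
    have : (n.factorial : ℝ) = Stirling.stirlingSeq n * √2 * Real.exp ((1 / 2 + n) * Real.log n - n) := by
      rw [Stirling.stirlingSeq, Real.sqrt_mul (by norm_num), Real.exp_sub, add_mul, Real.exp_add,
        mul_comm (1 / 2 : ℝ), ← Real.rpow_def_of_pos hnpos, ← Real.sqrt_eq_rpow,
        mul_comm (n : ℝ) (Real.log n), ← Real.rpow_def_of_pos hnpos, Real.rpow_natCast,
        div_pow, ← Real.exp_nat_mul, mul_one]
      have := Real.sqrt_pos.2 hnpos
      field_simp
    rw [← ofReal_natCast n.factorial, this]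
    push_cast; rfl
  have hlog : log (s + n + 1) = Real.log n + log (1 + (s + 1) / n) := by
    have hn1 : log (n : ℂ) = Real.log n := by
      rw [← ofReal_natCast n, ofReal_log hnpos.le]
    rw [← hn1, ← log_mul_of_re_pos _ hn0]
    · congr 1; field_simp; ring
    · rw [add_re, one_re, ← ofReal_natCast, div_ofReal_re, add_re, one_re]
      positivity
    · rw [← ofReal_natCast, arg_ofReal_of_nonneg hnpos.le, abs_zero]
      positivity
  rw [stirlingQuotient, h1, GammaSeq, hpow, hfac]
  generalize Real.log n = ℓ at *
  push_cast
  rw [← add_assoc, hlog]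
  have hst : (Stirling.stirlingSeq n : ℂ) ≠ 0 := by
    obtain ⟨m, rfl⟩ := Nat.exists_eq_succ_of_ne_zero hn
    exact_mod_cast (Stirling.stirlingSeq'_pos m).ne'
  have h2 : ((√2 : ℝ) : ℂ) ≠ 0 := by
    exact_mod_cast (Real.sqrt_pos.2 (by norm_num : (0 : ℝ) < 2)).ne'
  rw [div_div_eq_mul_div]
  have e1 := Complex.exp_ne_zero (ℓ * s)
  have e2 := Complex.exp_ne_zero ((1 / 2 + n) * ℓ - n)
  rw [show Gamma s * (∏ j ∈ Finset.range (n + 1), (s + (j : ℂ))) /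
    (cexp (ℓ * s) * ((Stirling.stirlingSeq n) * (√2 : ℝ) * cexp ((1 / 2 + n) * ℓ - n))) *
    (Stirling.stirlingSeq n * (√2 : ℝ)) =
    Gamma s * (∏ j ∈ Finset.range (n + 1), (s + (j : ℂ))) *
      cexp (-(ℓ * s + ((1 / 2 + n) * ℓ - n))) by
    rw [Complex.exp_neg, Complex.exp_add]
    field_simp, mul_assoc _ (cexp _), ← Complex.exp_add]
  rw [mul_comm (Finset.prod _ _)]
  congr 1
  congr 1
  ring

theorem tendsto_stirlingQuotient {s : ℂ} (hs : 0 < s.re) :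
    Tendsto (fun n : ℕ => stirlingQuotient (s + n)) atTop (𝓝 (√(2 * Real.pi) : ℝ)) := by
  rw [← tendsto_add_atTop_iff_nat 1]
  have hG : Gamma s ≠ 0 := Gamma_ne_zero_of_re_pos hs
  have t1 : Tendsto (fun n => Gamma s / GammaSeq s n) atTop (𝓝 1) := by
    have := (tendsto_const_nhds (x := Gamma s)).div (GammaSeq_tendsto_Gamma s) hG
    rwa [div_self hG] at this
  have t2 : Tendsto (fun n => ((Stirling.stirlingSeq n * √2 : ℝ) : ℂ)) atTop (𝓝 (√(2 * Real.pi) : ℝ)) := by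
    have := Stirling.tendsto_stirlingSeq_sqrt_pi.mul_const (√2)
    rw [← Real.sqrt_mul Real.pi_pos.le, mul_comm] at this
    exact (continuous_ofReal.tendsto _).comp this
  have hdiv : Tendsto (fun n : ℕ => (s + 1) / (n : ℂ)) atTop (𝓝 0) :=
    tendsto_const_div_atTop_nhds_zero_nat (s + 1)
  have t3 : Tendsto (fun n : ℕ => (s + n + 1 / 2) * log (1 + (s + 1) / n)) atTop (𝓝 (s + 1)) := by
    have a1 : Tendsto (fun n : ℕ => (n : ℂ) * log (1 + (s + 1) / n)) atTop (𝓝 (s + 1)) := by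
      refine tendsto_nat_mul_log_one_add_of_tendsto ?_
      refine tendsto_const_nhds.congr' ?_
      filter_upwards [eventually_ne_atTop 0] with n hn
      have : (n : ℂ) ≠ 0 := by exact_mod_cast hn
      field_simp
    have a2 : Tendsto (fun n : ℕ => log (1 + (s + 1) / n)) atTop (𝓝 0) := by
      have h1 : Tendsto (fun n : ℕ => 1 + (s + 1) / (n : ℂ)) atTop (𝓝 1) := by
        simpa using hdiv.const_add 1
      have := h1.clog (Or.inl (by simp))
      simpa using this
    have := (a2.const_mul (s + 1 / 2)).add a1
    simp only [mul_zero, zero_add] at this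
    refine this.congr fun n => ?_
    ring
  have t4 := (Complex.continuous_exp.tendsto _).comp (t3.const_sub (s + 1))
  have t5 := (t1.mul t2).mul t4
  rw [sub_self, Complex.exp_zero, one_mul, mul_one] at t5
  refine t5.congr' ?_
  filter_upwards [eventually_ne_atTop 0] with n hn
  exact (stirlingQuotient_add_nat hs hn).symm

/-- The quotient differs from its limit `√(2π)` by the exponential of the sum of all defects. -/
theorem exists_stirlingQuotient_eq {s : ℂ} (hs : 1 / 2 ≤ s.re) (hs' : 1 ≤ |s.im|) :
    ∃ l : ℂ, stirlingQuotient s = (√(2 * Real.pi) : ℝ) * cexp l ∧ ‖l‖ ≤ 24 / |s.im| := by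
  set τ := |s.im| with hτ
  have hτ0 : 0 < τ := by linarith
  -- a telescoping majorant of the defects
  have hb : ∀ j : ℕ, ‖stirlingDefect (s + j)‖ ≤ 24 * ((j + τ)⁻¹ - (((j + 1 : ℕ) : ℝ) + τ)⁻¹) := by
    intro j
    have hj : (0 : ℝ) ≤ j := Nat.cast_nonneg j
    refine (norm_stirlingDefect_le (s := s + j) (by simp; linarith) (by simpa using hs')).trans ?_
    have h1 : (j : ℝ) ^ 2 + τ ^ 2 ≤ (s + j).re ^ 2 + (s + j).im ^ 2 := by
      simp only [add_re, natCast_re, add_im, natCast_im, add_zero]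
      rw [hτ, sq_abs]
      nlinarith
    have h2 : (j + τ)⁻¹ - (((j + 1 : ℕ) : ℝ) + τ)⁻¹ = 1 / ((j + τ) * (j + 1 + τ)) := by
      push_cast
      field_simp
      ring
    have h3 : 0 < (j : ℝ) ^ 2 + τ ^ 2 := by positivity
    rw [h2, mul_one_div, div_le_div_iff₀ (by linarith) (by positivity)]
    nlinarith [sq_nonneg ((j : ℝ) - τ)]
  have hsum : ∀ n : ℕ, ∑ j ∈ Finset.range n, ‖stirlingDefect (s + j)‖ ≤ 24 / τ := by
    intro n
    refine (Finset.sum_le_sum fun j _ => hb j).trans ?_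
    rw [← Finset.mul_sum, Finset.sum_range_sub' (fun j : ℕ => ((j : ℝ) + τ)⁻¹)]
    have : (0 : ℝ) ≤ ((n : ℝ) + τ)⁻¹ := by positivity
    simp only [Nat.cast_zero, zero_add]
    rw [div_eq_mul_inv]
    linarith
  have hsummable : Summable fun j : ℕ => ‖stirlingDefect (s + j)‖ :=
    summable_of_sum_range_le (fun _ => norm_nonneg _) hsum
  refine ⟨∑' j : ℕ, stirlingDefect (s + j), ?_, ?_⟩
  · have h1 := (Complex.continuous_exp.tendsto _).comp hsummable.of_norm.hasSum.tendsto_sum_nat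
    have h2 := (tendsto_stirlingQuotient (s := s) (by linarith)).mul h1
    refine tendsto_nhds_unique (tendsto_const_nhds.congr fun n => ?_) h2
    exact stirlingQuotient_eq_mul_exp_sum (by linarith) n
  · exact (norm_tsum_le_tsum_norm hsummable).trans
      (Real.tsum_le_of_sum_range_le (fun _ => norm_nonneg _) hsum)

/-- Stirling's formula on vertical lines, with a relative error `exp O(1/τ)`. -/
theorem exists_Gamma_eq_stirling {c τ : ℝ} (hc : 1 / 2 ≤ c) (hc1 : c ≤ 1) (hτ : 2 * c ≤ |τ|) :
    ∃ l : ℂ, Gamma (c + τ * I) = (√(2 * Real.pi) : ℝ) *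
      cexp ((c - 1 / 2 + τ * I) * log (τ * I) - τ * I + l) ∧ ‖l‖ ≤ 26 / |τ| := by
  have hτ1 : 1 ≤ |τ| := by linarith
  have hτ0 : τ ≠ 0 := by rintro rfl; norm_num at hτ1
  set s : ℂ := c + τ * I with hs
  have hre : s.re = c := by simp [hs]
  have him : s.im = τ := by simp [hs]
  obtain ⟨l, hl, hln⟩ := exists_stirlingQuotient_eq (s := s) (by rw [hre]; exact hc)
    (by rw [him]; exact hτ1)
  rw [him] at hln
  have hτI : (τ : ℂ) * I ≠ 0 := mul_ne_zero (by exact_mod_cast hτ0) I_ne_zero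
  set w : ℂ := c / (τ * I) with hw
  have hwn : ‖w‖ = c / |τ| := by
    rw [hw, norm_div, norm_mul, norm_I, norm_real, norm_real, mul_one,
      Real.norm_of_nonneg (by linarith), Real.norm_eq_abs]
  have hw1 : ‖w‖ ≤ 1 / 2 := by
    rw [hwn, div_le_div_iff₀ (by linarith) (by norm_num)]; linarith
  have hw2 : ‖w‖ ≤ 1 / |τ| := by rw [hwn]; gcongr
  have hwτ : (τ : ℂ) * I * w = c := by rw [hw]; exact mul_div_cancel₀ _ hτI
  have hlog : log s = log (τ * I) + log (1 + w) := by
    rw [← log_mul_of_re_pos _ hτI]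
    · congr 1; rw [mul_add, hwτ, hs]; ring
    · have := abs_re_le_norm w
      have := neg_abs_le w.re
      rw [add_re, one_re]; linarith
    · rcases lt_or_gt_of_ne hτ0 with h | h
      · rw [show (τ : ℂ) * I = ((-τ : ℝ) : ℂ) * (-I) by push_cast; ring,
          arg_real_mul _ (by linarith), arg_neg_I, abs_neg, abs_of_pos (by positivity)]
      · rw [arg_real_mul _ h, arg_I, abs_of_pos (by positivity)]
  have hlog1 : ‖log (1 + w) - w‖ ≤ ‖w‖ ^ 2 := by
    refine (norm_log_one_add_sub_self_le (by linarith)).trans ?_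
    have : (1 - ‖w‖)⁻¹ ≤ 2 := inv_le_of_inv_le₀ (by norm_num) (by norm_num; linarith)
    nlinarith [sq_nonneg ‖w‖]
  have hlog2 : ‖log (1 + w)‖ ≤ 2 * ‖w‖ := by
    have : log (1 + w) = (log (1 + w) - w) + w := by ring
    rw [this]
    refine (norm_add_le _ _).trans ?_
    nlinarith [norm_nonneg w]
  refine ⟨l + ((c - 1 / 2) * log (1 + w) + τ * I * (log (1 + w) - w)), ?_, ?_⟩
  · have h1 : Gamma s = stirlingQuotient s * cexp (-(s - (s - 1 / 2) * log s)) := by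
      rw [stirlingQuotient, mul_assoc, ← Complex.exp_add, add_neg_cancel, Complex.exp_zero, mul_one]
    rw [h1, hl, mul_assoc, ← Complex.exp_add, hlog]
    congr 2
    rw [hs]
    linear_combination hwτ
  · have h1 : ‖((c : ℂ) - 1 / 2) * log (1 + w)‖ ≤ 1 / |τ| := by
      rw [norm_mul, show ((c : ℂ) - 1 / 2) = ((c - 1 / 2 : ℝ) : ℂ) by push_cast; ring, norm_real,
        Real.norm_of_nonneg (by linarith)]
      nlinarith [norm_nonneg (log (1 + w)), norm_nonneg w]
    have h2 : ‖(τ : ℂ) * I * (log (1 + w) - w)‖ ≤ 1 / |τ| := by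
      rw [norm_mul, norm_mul, norm_I, norm_real, mul_one, Real.norm_eq_abs]
      calc |τ| * ‖log (1 + w) - w‖ ≤ |τ| * (1 / |τ|) ^ 2 := by
            gcongr
            exact hlog1.trans (by gcongr)
        _ = 1 / |τ| := by field_simp
    have h3 : (26 : ℝ) / |τ| = 24 / |τ| + (1 / |τ| + 1 / |τ|) := by ring
    rw [h3]
    refine (norm_add_le _ _).trans (add_le_add hln ((norm_add_le _ _).trans (add_le_add h1 h2)))

/-! ### The series of `₂F₁(p, p; 2p; x)` for large `p` -/

/-- The coefficients `(p)ₙ² / ((2p)ₙ n!)` of `₂F₁(p, p; 2p; ·)`. -/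
noncomputable def diagCoeff (p : ℂ) (n : ℕ) : ℂ :=
  (n.factorial : ℂ)⁻¹ * (ascPochhammer ℂ n).eval p * (ascPochhammer ℂ n).eval p *
    ((ascPochhammer ℂ n).eval (2 * p))⁻¹

theorem two_mul_add_nat_ne_zero {p : ℂ} (hp : 0 < p.re) (n : ℕ) : 2 * p + n ≠ 0 := by
  intro h
  have := congrArg re h
  simp at this
  linarith [Nat.cast_nonneg (α := ℝ) n]

theorem diagCoeff_succ {p : ℂ} (hp : 0 < p.re) (n : ℕ) :
    diagCoeff p (n + 1) = (p + n) ^ 2 / (2 * p + n) * diagCoeff p n / (n + 1) := by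
  have h1 := two_mul_add_nat_ne_zero hp n
  have h2 : (n : ℂ) + 1 ≠ 0 := by exact_mod_cast n.succ_ne_zero
  have h3 : (n.factorial : ℂ) ≠ 0 := by exact_mod_cast n.factorial_ne_zero
  simp only [diagCoeff, ascPochhammer_succ_eval, Nat.factorial_succ, Nat.cast_mul, mul_inv]
  push_cast
  field_simp

theorem norm_add_nat_le_norm_two_mul_add {p : ℂ} (hp : 0 < p.re) (n : ℕ) :
    ‖p + n‖ ≤ ‖2 * p + n‖ := by
  have hn : (0 : ℝ) ≤ n := Nat.cast_nonneg n
  rw [← sq_le_sq₀ (norm_nonneg _) (norm_nonneg _), Complex.sq_norm, Complex.sq_norm, normSq_apply,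
    normSq_apply]
  simp
  nlinarith [sq_nonneg p.im]

theorem two_mul_norm_le_norm_two_mul_add {p : ℂ} (hp : 0 < p.re) (n : ℕ) :
    2 * ‖p‖ ≤ ‖2 * p + n‖ := by
  have hn : (0 : ℝ) ≤ n := Nat.cast_nonneg n
  rw [← sq_le_sq₀ (by positivity) (norm_nonneg _), mul_pow, Complex.sq_norm, Complex.sq_norm,
    normSq_apply, normSq_apply]
  simp
  nlinarith [sq_nonneg p.im]

theorem nat_le_norm_two_mul_add {p : ℂ} (hp : 0 < p.re) (n : ℕ) : (n : ℝ) ≤ ‖2 * p + n‖ := by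
  have := re_le_norm (2 * p + n)
  simp at this
  linarith

/-- The ratio of consecutive terms is at most `(|p| + n) |x| / (n + 1) ≤ 1/4`. -/
theorem norm_diagCoeff_mul_pow_le {p x : ℂ} (hp : 0 < p.re) (hpx : ‖p‖ * ‖x‖ ≤ 1 / 4)
    (hx : ‖x‖ ≤ 1 / 4) (n : ℕ) : ‖diagCoeff p n * x ^ n‖ ≤ (1 / 4) ^ n := by
  induction n with
  | zero => simp [diagCoeff]
  | succ n ih =>
    have hn : (0 : ℝ) ≤ n := Nat.cast_nonneg n
    have h0 := two_mul_add_nat_ne_zero hp n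
    have h1 : ‖(p + n) ^ 2 / (2 * p + n)‖ ≤ ‖p‖ + n := by
      rw [norm_div, div_le_iff₀ (norm_pos_iff.2 h0), norm_pow, sq]
      have := norm_add_nat_le_norm_two_mul_add hp n
      have h2 : ‖p + n‖ ≤ ‖p‖ + n := (norm_add_le _ _).trans (by simp)
      gcongr
    have h3 : ‖(n : ℂ) + 1‖ = n + 1 := by
      rw [← Nat.cast_succ, norm_natCast]; push_cast; ring
    rw [diagCoeff_succ hp, show (p + n) ^ 2 / (2 * p + n) * diagCoeff p n / (n + 1) * x ^ (n + 1) =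
      (p + n) ^ 2 / (2 * p + n) * x * (diagCoeff p n * x ^ n) / (n + 1) by ring, norm_div, h3,
      div_le_iff₀ (by positivity), norm_mul, norm_mul, pow_succ]
    calc ‖(p + n) ^ 2 / (2 * p + n)‖ * ‖x‖ * ‖diagCoeff p n * x ^ n‖
        ≤ (‖p‖ + n) * ‖x‖ * (1 / 4) ^ n := by gcongr
      _ = (‖p‖ * ‖x‖ + n * ‖x‖) * (1 / 4) ^ n := by ring
      _ ≤ (1 / 4 + n * (1 / 4)) * (1 / 4) ^ n := by gcongr
      _ = _ := by ring

/-- In the recursion for the coefficients, `(p + n)² / (2p + n) = p/2 + O(n)` uniformly in `p`. -/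
theorem norm_diagCoeff_sub_exp_coeff_le {p x : ℂ} (hp : 0 < p.re) (hpx : ‖p‖ * ‖x‖ ≤ 1 / 4)
    (hx : ‖x‖ ≤ 1 / 4) (n : ℕ) :
    ‖diagCoeff p n * x ^ n - (p * x / 2) ^ n / n.factorial‖ ≤ 16 * ‖x‖ * (1 / 4) ^ n := by
  induction n with
  | zero => simp [diagCoeff]
  | succ n ih =>
    have hn : (0 : ℝ) ≤ n := Nat.cast_nonneg n
    have h0 := two_mul_add_nat_ne_zero hp n
    have h0' : (n : ℂ) + 1 ≠ 0 := by exact_mod_cast n.succ_ne_zero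
    have h3 : ‖(n : ℂ) + 1‖ = n + 1 := by
      rw [← Nat.cast_succ, norm_natCast]; push_cast; ring
    set e : ℂ := (3 * p * n + 2 * n ^ 2) / (2 * (2 * p + n)) with he
    have hee : (p + n) ^ 2 / (2 * p + n) = p / 2 + e := by
      have h5 : 2 * (2 * p + (n : ℂ)) ≠ 0 := mul_ne_zero two_ne_zero h0
      rw [he, div_add_div _ _ two_ne_zero h5, div_eq_div_iff h0 (mul_ne_zero two_ne_zero h5)]
      ring
    have hen : ‖e‖ ≤ 2 * n := by
      rw [he, norm_div, div_le_iff₀ (norm_pos_iff.2 (mul_ne_zero two_ne_zero h0)), norm_mul]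
      have a1 := two_mul_norm_le_norm_two_mul_add hp n
      have a2 := nat_le_norm_two_mul_add hp n
      refine (norm_add_le _ _).trans ?_
      simp only [norm_mul, norm_pow, Complex.norm_natCast, RCLike.norm_ofNat]
      nlinarith
    have key : diagCoeff p (n + 1) * x ^ (n + 1) - (p * x / 2) ^ (n + 1) / (n + 1).factorial =
        (p * x / 2 * (diagCoeff p n * x ^ n - (p * x / 2) ^ n / n.factorial) +
          e * x * (diagCoeff p n * x ^ n)) / (n + 1) := by
      have h4 : (n.factorial : ℂ) ≠ 0 := by exact_mod_cast n.factorial_ne_zero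
      rw [diagCoeff_succ hp, hee, Nat.factorial_succ]
      push_cast
      field_simp
      ring
    rw [key, norm_div, h3, div_le_iff₀ (by positivity)]
    have hu := norm_diagCoeff_mul_pow_le hp hpx hx n
    refine (norm_add_le _ _).trans ?_
    rw [norm_mul, norm_mul (e * x), norm_mul e, norm_div, norm_mul p, RCLike.norm_ofNat]
    calc ‖p‖ * ‖x‖ / 2 * ‖diagCoeff p n * x ^ n - (p * x / 2) ^ n / n.factorial‖ +
          ‖e‖ * ‖x‖ * ‖diagCoeff p n * x ^ n‖
        ≤ 1 / 4 / 2 * (16 * ‖x‖ * (1 / 4) ^ n) + 2 * n * ‖x‖ * (1 / 4) ^ n := by gcongr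
      _ = 16 * ‖x‖ * (1 / 4) ^ (n + 1) * (1 / 2 + n / 2) := by ring
      _ ≤ 16 * ‖x‖ * (1 / 4) ^ (n + 1) * (n + 1) :=
          mul_le_mul_of_nonneg_left (by linarith) (by positivity)

theorem hyp2F1_diag_eq_tsum {p x : ℂ} (hp : 0 < p.re) (hx : ‖x‖ ≤ 1 / 4) :
    hyp2F1 p p (2 * p) x = ∑' n : ℕ, diagCoeff p n * x ^ n := by
  have h := (isHypBranch_hyp2F1 (a := p) (b := p) (c := 2 * p) hp (by simp; linarith)).2 x
    (by linarith)
  rw [h, ordinaryHypergeometric_eq_tsum]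
  simp only [smul_eq_mul, diagCoeff]

theorem norm_hyp2F1_diag_le {p x : ℂ} (hp : 0 < p.re) (hpx : ‖p‖ * ‖x‖ ≤ 1 / 4)
    (hx : ‖x‖ ≤ 1 / 4) : ‖hyp2F1 p p (2 * p) x‖ ≤ 2 := by
  rw [hyp2F1_diag_eq_tsum hp hx]
  have hs := hasSum_geometric_of_lt_one (r := (1 / 4 : ℝ)) (by norm_num) (by norm_num)
  refine (tsum_of_norm_bounded hs (norm_diagCoeff_mul_pow_le hp hpx hx)).trans (by norm_num)

/-- For large `p` the function `₂F₁(p, p; 2p; x)` is close to `exp (p x / 2)`. -/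
theorem norm_hyp2F1_diag_sub_exp_le {p x : ℂ} (hp : 0 < p.re) (hpx : ‖p‖ * ‖x‖ ≤ 1 / 4)
    (hx : ‖x‖ ≤ 1 / 4) : ‖hyp2F1 p p (2 * p) x - cexp (p * x / 2)‖ ≤ 22 * ‖x‖ := by
  have hg := hasSum_geometric_of_lt_one (r := (1 / 4 : ℝ)) (by norm_num) (by norm_num)
  have h1 : Summable fun n : ℕ => diagCoeff p n * x ^ n :=
    Summable.of_norm_bounded hg.summable (norm_diagCoeff_mul_pow_le hp hpx hx)
  have h2 : HasSum (fun n : ℕ => (p * x / 2) ^ n / n.factorial) (cexp (p * x / 2)) := by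
    rw [Complex.exp_eq_exp_ℂ]
    exact NormedSpace.expSeries_div_hasSum_exp (p * x / 2)
  rw [hyp2F1_diag_eq_tsum hp hx, ← h2.tsum_eq, ← h1.tsum_sub h2.summable]
  refine (tsum_of_norm_bounded (hg.mul_left (16 * ‖x‖))
    (norm_diagCoeff_sub_exp_coeff_le hp hpx hx)).trans ?_
  norm_num
  nlinarith [norm_nonneg x]

/-! ### The Laplace integral of a power -/

theorem integrableOn_rpow_mul_exp_neg {e b : ℝ} (he : -1 < e) (hb : 0 < b) :
    IntegrableOn (fun u : ℝ => u ^ e * Real.exp (-b * u)) (Ioi 0) := by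
  simpa using integrableOn_rpow_mul_exp_neg_mul_rpow (p := 1) he zero_lt_one hb

theorem norm_cpow_mul_exp_neg_mul {q r : ℂ} {u : ℝ} (hu : 0 < u) :
    ‖(u : ℂ) ^ q * cexp (-(r * u))‖ = u ^ q.re * Real.exp (-r.re * u) := by
  rw [norm_mul, norm_cpow_eq_rpow_re_of_pos hu, norm_exp]
  simp

/-- The Gamma integral `∫ u^(q-1) exp (-r u) du = r^(-q) Γ(q)` for complex `r`. -/
theorem integral_cpow_mul_exp_neg_mul_complex {q r : ℂ} (hq : 0 < q.re) (hr : 0 < r.re) :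
    ∫ u : ℝ in Ioi 0, (u : ℂ) ^ (q - 1) * cexp (-(r * u)) = r ^ (-q) * Gamma q := by
  set U : Set ℂ := {r | 0 < r.re} with hU
  have hUo : IsOpen U := isOpen_lt continuous_const continuous_re
  have hUc : IsPreconnected U := (convex_halfSpace_re_gt 0).isPreconnected
  have meas : ∀ (e r : ℂ), AEStronglyMeasurable (fun u : ℝ => (u : ℂ) ^ e * cexp (-(r * u)))
      (volume.restrict (Ioi 0)) := fun e r => (by fun_prop : Measurable fun u : ℝ =>
        (u : ℂ) ^ e * cexp (-(r * u))).aestronglyMeasurable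
  have hL : DifferentiableOn ℂ
      (fun r => ∫ u : ℝ in Ioi 0, (u : ℂ) ^ (q - 1) * cexp (-(r * u))) U := by
    intro r hr
    have hr' : 0 < r.re := hr
    refine DifferentiableAt.differentiableWithinAt ?_
    refine (hasDerivAt_integral_of_dominated_loc_of_deriv_le (μ := volume.restrict (Ioi 0))
      (F := fun (r : ℂ) (u : ℝ) => (u : ℂ) ^ (q - 1) * cexp (-(r * u)))
      (F' := fun (r : ℂ) (u : ℝ) => -(u : ℂ) * ((u : ℂ) ^ (q - 1) * cexp (-(r * u))))
      (bound := fun u => u ^ q.re * Real.exp (-(r.re / 2) * u))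
      (Metric.ball_mem_nhds r (half_pos hr')) ?_ ?_ ?_ ?_ ?_ ?_).2.differentiableAt
    · exact Eventually.of_forall fun r => meas _ r
    · refine (integrableOn_rpow_mul_exp_neg (e := (q - 1).re) (by simpa using hq) hr').mono'
        (meas _ r) ?_
      refine (ae_restrict_mem measurableSet_Ioi).mono fun u hu => ?_
      exact (norm_cpow_mul_exp_neg_mul hu).le
    · exact (by fun_prop : Measurable fun u : ℝ =>
        -(u : ℂ) * ((u : ℂ) ^ (q - 1) * cexp (-(r * u)))).aestronglyMeasurable
    · refine (ae_restrict_mem measurableSet_Ioi).mono fun u hu r' hr'' => ?_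
      have hu : 0 < u := hu
      rw [norm_mul, norm_neg, norm_real, Real.norm_of_nonneg hu.le, norm_cpow_mul_exp_neg_mul hu,
        ← mul_assoc]
      have h1 : u * u ^ (q - 1).re = u ^ q.re := by
        rw [sub_re, one_re, Real.rpow_sub hu, Real.rpow_one]; field_simp
      rw [h1]
      gcongr
      have h2 := abs_re_le_norm (r' - r)
      rw [Metric.mem_ball, dist_eq_norm] at hr''
      rw [sub_re] at h2
      linarith [neg_abs_le (r'.re - r.re)]
    · exact integrableOn_rpow_mul_exp_neg (by linarith) (half_pos hr')
    · refine Eventually.of_forall fun u r' _ => ?_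
      have h1 : HasDerivAt (fun r : ℂ => -(r * u)) (-(u : ℂ)) r' := by
        exact (((hasDerivAt_id' r').mul_const (u : ℂ)).fun_neg).congr_deriv (by simp)
      exact (h1.cexp.const_mul _).congr_deriv (by ring)
  have hR : DifferentiableOn ℂ (fun r : ℂ => r ^ (-q) * Gamma q) U := fun r hr =>
    ((differentiableAt_id.cpow_const (Or.inl hr)).mul_const _).differentiableWithinAt
  -- both sides are holomorphic in `r`, and the formula is known for `r > 0`
  refine (hL.analyticOnNhd hUo).eqOn_of_preconnected_of_frequently_eq (hR.analyticOnNhd hUo) hUc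
    (z₀ := ((1 : ℝ) : ℂ)) (by simp [hU]) ?_ hr
  have ht : Tendsto (fun x : ℝ => (x : ℂ)) (𝓝[≠] 1) (𝓝[≠] ((1 : ℝ) : ℂ)) := by
    refine tendsto_nhdsWithin_of_tendsto_nhds_of_eventually_within _
      ((continuous_ofReal.tendsto _).mono_left nhdsWithin_le_nhds) ?_
    filter_upwards [self_mem_nhdsWithin] with x hx
    exact fun h => hx (ofReal_injective h)
  refine ht.frequently (Eventually.frequently ?_)
  filter_upwards [mem_nhdsWithin_of_mem_nhds (Ioi_mem_nhds (zero_lt_one' ℝ))] with x hx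
  have hx : 0 < x := hx
  rw [integral_cpow_mul_exp_neg_mul_Ioi hq hx, one_div, ← ofReal_inv,
    ofReal_cpow_eq_exp (inv_pos.2 hx), ofReal_cpow_eq_exp hx, Real.log_inv]
  push_cast
  ring_nf

theorem le_norm_add_mul_I {a : ℝ} (ha : 0 < a) (y : ℝ) :
    min a 1 / 2 * (1 + |y|) ≤ ‖(a : ℂ) + y * I‖ := by
  have h1 := abs_re_le_norm ((a : ℂ) + y * I)
  have h2 := abs_im_le_norm ((a : ℂ) + y * I)
  simp at h1 h2
  rw [abs_of_pos ha] at h1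
  have h3 := min_le_left a 1
  have h4 := min_le_right a 1
  have h5 : 0 < min a 1 := lt_min ha one_pos
  nlinarith [abs_nonneg y]

theorem norm_cpow_neg_line_le {a : ℝ} (ha : 0 < a) {q : ℂ} (hq : 0 < q.re) (y : ℝ) :
    ‖((a : ℂ) + y * I) ^ (-q)‖ ≤
      (min a 1 / 2) ^ (-q.re) * Real.exp (Real.pi * |q.im|) * (1 + |y|) ^ (-q.re) := by
  have h5 : 0 < min a 1 := lt_min ha one_pos
  refine (norm_cpow_le_mul_exp _ _).trans ?_
  rw [neg_re, neg_im, abs_neg]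
  calc _ ≤ (min a 1 / 2 * (1 + |y|)) ^ (-q.re) * Real.exp (Real.pi * |q.im|) := by
        refine mul_le_mul_of_nonneg_right ?_ (Real.exp_pos _).le
        exact Real.rpow_le_rpow_of_nonpos (by positivity) (le_norm_add_mul_I ha y) (by linarith)
    _ = _ := by rw [Real.mul_rpow (by positivity) (by positivity)]; ring

theorem continuous_cpow_line {a : ℝ} (ha : 0 < a) (q : ℂ) :
    Continuous fun y : ℝ => ((a : ℂ) + y * I) ^ q := by
  refine continuous_iff_continuousAt.2 fun y => ?_
  exact (continuousAt_cpow_const (Or.inl (by simpa using ha))).comp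
    (f := fun y : ℝ => (a : ℂ) + y * I) (by fun_prop)

theorem integrable_cpow_neg_line {a : ℝ} (ha : 0 < a) {q : ℂ} (hq : 1 < q.re) :
    Integrable fun y : ℝ => ((a : ℂ) + y * I) ^ (-q) := by
  have h := (integrable_one_add_norm (E := ℝ) (μ := volume) (r := q.re) (by simpa using hq)).const_mul
    ((min a 1 / 2) ^ (-q.re) * Real.exp (Real.pi * |q.im|))
  exact h.mono' (continuous_cpow_line ha _).aestronglyMeasurable
    (Eventually.of_forall fun y => norm_cpow_neg_line_le ha (by linarith) y)

/-- Laplace's integral for the reciprocal Gamma function. -/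
theorem integral_exp_mul_cpow_neg {a x : ℝ} (ha : 0 < a) (hx : 0 < x) {q : ℂ} (hq : 1 < q.re) :
    ∫ y : ℝ, cexp (x * (a + y * I)) * ((a : ℂ) + y * I) ^ (-q) =
      2 * Real.pi * (x : ℂ) ^ (q - 1) / Gamma q := by
  set f : ℝ → ℂ := (Ioi (0 : ℝ)).indicator fun u => (u : ℂ) ^ (q - 1) * cexp (-(a * u)) with hf
  have hG : Gamma q ≠ 0 := Gamma_ne_zero_of_re_pos (by linarith)
  have hint : Integrable f := by
    rw [hf, integrable_indicator_iff measurableSet_Ioi]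
    refine (integrableOn_rpow_mul_exp_neg (e := (q - 1).re) (b := a) (by simp; linarith) ha).mono'
      (by fun_prop : Measurable fun u : ℝ =>
        (u : ℂ) ^ (q - 1) * cexp (-(a * u))).aestronglyMeasurable ?_
    refine (ae_restrict_mem measurableSet_Ioi).mono fun u hu => ?_
    simpa using (norm_cpow_mul_exp_neg_mul (q := q - 1) (r := a) hu).le
  -- the integrand is a Fourier transform, so that Fourier inversion evaluates the integral
  have hF : ∀ ξ : ℝ, FourierTransform.fourier f ξ =
      ((a : ℂ) + (2 * Real.pi * ξ : ℝ) * I) ^ (-q) * Gamma q := by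
    intro ξ
    rw [Real.fourier_real_eq_integral_exp_smul,
      ← integral_cpow_mul_exp_neg_mul_complex (by linarith) (by simpa using ha),
      ← integral_indicator measurableSet_Ioi]
    refine integral_congr_ae (Eventually.of_forall fun u => ?_)
    simp only [hf, indicator]
    split_ifs
    · rw [smul_eq_mul, mul_left_comm, ← Complex.exp_add]
      congr 2
      push_cast
      ring
    · simp
  have hFi : Integrable (FourierTransform.fourier f) := by
    have h1 := ((integrable_cpow_neg_line ha hq).comp_mul_left' (R := 2 * Real.pi)
      (by positivity)).mul_const (Gamma q)
    refine h1.congr (Eventually.of_forall fun ξ => ?_)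
    simp only [hF]
  have hc : ContinuousAt f x := by
    have h1 : ContinuousAt (fun u : ℝ => (u : ℂ) ^ (q - 1) * cexp (-(a * u))) x := by
      refine ContinuousAt.mul ?_ (by fun_prop)
      exact (continuousAt_cpow_const (Or.inl (by simpa using hx))).comp (f := fun u : ℝ => (u : ℂ))
        (by fun_prop)
    refine h1.congr ?_
    filter_upwards [Ioi_mem_nhds hx] with u hu
    rw [hf, indicator_of_mem hu]
  have key := hint.fourierInv_fourier_eq hFi hc
  rw [Real.fourierInv_eq', hf, indicator_of_mem (by exact hx)] at key
  have h2 : ∫ y : ℝ, cexp (x * (a + y * I)) * ((a : ℂ) + y * I) ^ (-q) =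
      (2 * Real.pi : ℝ) • ∫ ξ : ℝ, cexp (x * (a + (2 * Real.pi * ξ : ℝ) * I)) *
        ((a : ℂ) + (2 * Real.pi * ξ : ℝ) * I) ^ (-q) := by
    have := Measure.integral_comp_mul_left
      (fun y : ℝ => cexp (x * (a + y * I)) * ((a : ℂ) + y * I) ^ (-q)) (2 * Real.pi)
    rw [this, smul_smul, abs_of_pos (by positivity), mul_inv_cancel₀ (by positivity), one_smul]
  have h3 : ∫ ξ : ℝ, cexp (x * (a + (2 * Real.pi * ξ : ℝ) * I)) *
        ((a : ℂ) + (2 * Real.pi * ξ : ℝ) * I) ^ (-q) =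
      cexp (x * a) / Gamma q * ∫ ξ : ℝ, cexp (↑(2 * Real.pi * inner ℝ ξ x) * I) •
        FourierTransform.fourier f ξ := by
    rw [← integral_const_mul]
    refine integral_congr_ae (Eventually.of_forall fun ξ => ?_)
    simp only [hF, smul_eq_mul, mul_add, Complex.exp_add]
    have : inner ℝ ξ x = x * ξ := by simp
    rw [this]
    push_cast
    field_simp
  rw [h2, h3, key, real_smul, mul_comm (x : ℂ) (a : ℂ), Complex.exp_neg]
  have := Complex.exp_ne_zero ((a : ℂ) * x)
  push_cast
  field_simp

/-! ### The saddle point by integration by parts -/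

/-- The point `a + iy` of the vertical line through `a`. -/
noncomputable def vline (a y : ℝ) : ℂ := (a : ℂ) + y * I

/-- The function `e^{xz} z^{1-q}`, whose derivative is the Laplace integrand `e^{xz} z^{-q}` times
a linear function vanishing at the saddle point `(q - 1)/x`. -/
noncomputable def saddlePrimitive (x : ℝ) (q z : ℂ) : ℂ := cexp (x * z) * z ^ (1 - q)

@[simp] theorem vline_re (a y : ℝ) : (vline a y).re = a := by simp [vline]

@[simp] theorem vline_im (a y : ℝ) : (vline a y).im = y := by simp [vline]

theorem hasDerivAt_vline (a y : ℝ) : HasDerivAt (vline a) I y := by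
  have := ((hasDerivAt_id' y).ofReal_comp.mul_const I).const_add (a : ℂ)
  rw [ofReal_one, one_mul] at this
  exact this

theorem continuous_vline (a : ℝ) : Continuous (vline a) := by unfold vline; fun_prop

theorem vline_ne_zero {a : ℝ} (ha : 0 < a) (y : ℝ) : vline a y ≠ 0 := by
  intro h
  have := congrArg re h
  simp at this
  exact ha.ne' this

theorem hasDerivAt_saddlePrimitive_vline {a : ℝ} (ha : 0 < a) (x : ℝ) {q z₀ : ℂ}
    (hz₀ : x * z₀ = q - 1) (y : ℝ) :
    HasDerivAt (fun y : ℝ => saddlePrimitive x q (vline a y))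
      (I * (x * (vline a y - z₀) * (cexp (x * vline a y) * vline a y ^ (-q)))) y := by
  set z := vline a y with hz
  have hz0 : z ≠ 0 := vline_ne_zero ha y
  have h1 : HasDerivAt (fun z : ℂ => cexp (x * z)) (cexp (x * z) * x) z := by
    simpa using ((hasDerivAt_id z).const_mul (x : ℂ)).cexp
  have h2 : HasDerivAt (fun z : ℂ => z ^ (1 - q)) ((1 - q) * z ^ (1 - q - 1) * 1) z :=
    (hasDerivAt_id z).cpow_const (Or.inl (by simpa [hz] using ha))
  have h3 := (h1.mul h2).comp_of_eq y (hasDerivAt_vline a y) rfl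
  refine h3.congr_deriv ?_
  rw [show 1 - q - 1 = -q by ring, sub_eq_add_neg 1 q, cpow_add _ _ hz0, cpow_one]
  linear_combination (I * cexp (x * z) * z ^ (-q)) * hz₀

theorem continuous_saddlePrimitive_vline {a : ℝ} (ha : 0 < a) (x : ℝ) (q : ℂ) :
    Continuous fun y : ℝ => saddlePrimitive x q (vline a y) := by
  unfold saddlePrimitive
  have := continuous_vline a
  exact (by fun_prop : Continuous fun y : ℝ => cexp (x * vline a y)).mul (continuous_cpow_line ha _)

theorem continuous_laplace_vline {a : ℝ} (ha : 0 < a) (x : ℝ) (q : ℂ) :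
    Continuous fun y : ℝ => cexp (x * vline a y) * vline a y ^ (-q) := by
  have := continuous_vline a
  exact (by fun_prop : Continuous fun y : ℝ => cexp (x * vline a y)).mul (continuous_cpow_line ha _)

/-- Integration by parts against the derivative of `saddlePrimitive`. -/
theorem norm_integral_mul_sub_saddle_le {a x : ℝ} (ha : 0 < a) (hx : 0 < x) {q z₀ : ℂ}
    (hz₀ : x * z₀ = q - 1) {u v : ℝ} (D D' : ℝ → ℂ)
    (hD : ∀ y ∈ uIcc u v, HasDerivAt D (D' y) y) (hD' : ContinuousOn D' (uIcc u v)) :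
    ‖∫ y in u..v, D y * ((vline a y - z₀) * (cexp (x * vline a y) * vline a y ^ (-q)))‖ ≤
      x⁻¹ * (‖D u‖ * ‖saddlePrimitive x q (vline a u)‖ +
        ‖D v‖ * ‖saddlePrimitive x q (vline a v)‖ +
        ‖∫ y in u..v, D' y * saddlePrimitive x q (vline a y)‖) := by
  have hcont : Continuous fun y : ℝ =>
      I * (x * (vline a y - z₀) * (cexp (x * vline a y) * vline a y ^ (-q))) := by
    have := continuous_vline a
    exact continuous_const.mul ((by fun_prop : Continuous fun y : ℝ => x * (vline a y - z₀)).mul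
      (continuous_laplace_vline ha x q))
  have h := intervalIntegral.integral_mul_deriv_eq_deriv_mul (u := D) (u' := D')
    (v := fun y => saddlePrimitive x q (vline a y)) hD
    (fun y _ => hasDerivAt_saddlePrimitive_vline ha x hz₀ y) hD'.intervalIntegrable
    (hcont.intervalIntegrable _ _)
  have hx' : (x : ℂ) ≠ 0 := by exact_mod_cast hx.ne'
  have e : ∫ y in u..v, D y * ((vline a y - z₀) * (cexp (x * vline a y) * vline a y ^ (-q))) =
      (I * x)⁻¹ * ∫ y in u..v, D y *
        (I * (x * (vline a y - z₀) * (cexp (x * vline a y) * vline a y ^ (-q)))) := by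
    rw [← intervalIntegral.integral_const_mul]
    refine intervalIntegral.integral_congr fun y _ => ?_
    field_simp
  rw [e, h, norm_mul, norm_inv, norm_mul, norm_I, one_mul, norm_real, Real.norm_of_nonneg hx.le]
  gcongr
  refine (norm_sub_le _ _).trans (add_le_add ((norm_sub_le _ _).trans ?_) le_rfl)
  rw [norm_mul, norm_mul, add_comm]

/-- The derivative of the difference quotient `(b z - b z₀) / (z - z₀)` is bounded by a Lipschitz
constant of `b'`. -/
theorem norm_deriv_quotient_le {b b' : ℂ → ℂ} {K : Set ℂ} (hK : Convex ℝ K) {M : ℝ}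
    (hb : ∀ z ∈ K, HasDerivAt b (b' z) z)
    (hb' : ∀ z ∈ K, ∀ w ∈ K, ‖b' z - b' w‖ ≤ M * ‖z - w‖) {z z₀ : ℂ} (hz : z ∈ K) (hz₀ : z₀ ∈ K)
    (hM : 0 ≤ M) (hne : z ≠ z₀) :
    ‖(b' z * (z - z₀) - (b z - b z₀)) / (z - z₀) ^ 2‖ ≤ M := by
  have hd : 0 < ‖z - z₀‖ := norm_pos_iff.2 (sub_ne_zero.2 hne)
  have hseg : segment ℝ z z₀ ⊆ K := hK.segment_subset hz hz₀
  have key := (convex_segment z z₀).norm_image_sub_le_of_norm_hasDerivWithin_le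
    (f := fun ζ => b ζ - b' z * ζ) (f' := fun ζ => b' ζ - b' z) (C := M * ‖z - z₀‖)
    (fun ζ hζ => ((hb ζ (hseg hζ)).sub
      (by simpa using (hasDerivAt_id ζ).const_mul (b' z))).hasDerivWithinAt)
    (fun ζ hζ => by
      refine (hb' ζ (hseg hζ) z hz).trans ?_
      gcongr
      have := norm_sub_le_of_mem_segment hζ
      rwa [norm_sub_rev z z₀])
    (left_mem_segment ℝ z z₀) (right_mem_segment ℝ z z₀)
  rw [norm_div, norm_pow, div_le_iff₀ (by positivity)]
  calc ‖b' z * (z - z₀) - (b z - b z₀)‖ = ‖b z₀ - b' z * z₀ - (b z - b' z * z)‖ := by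
        congr 1; ring
    _ ≤ M * ‖z - z₀‖ * ‖z₀ - z‖ := key
    _ = M * ‖z - z₀‖ ^ 2 := by rw [norm_sub_rev z₀ z]; ring

theorem norm_vline_sub_ge {a y Y : ℝ} {z₀ : ℂ} (hy : Y ≤ |y|) (hz₀ : |z₀.im| ≤ Y / 2) :
    |y| / 2 ≤ ‖vline a y - z₀‖ := by
  have h1 := abs_im_le_norm (vline a y - z₀)
  rw [sub_im, vline_im] at h1
  have h2 := abs_sub_abs_le_abs_sub y z₀.im
  linarith

/-- The part of the Laplace integral far from the saddle point. -/
theorem norm_integral_laplace_far_le {a x Y N : ℝ} (ha : 0 < a) (hx : 0 < x) (hY : 0 < Y)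
    {q z₀ : ℂ} (hz₀ : x * z₀ = q - 1) (hz₀Y : |z₀.im| ≤ Y / 2)
    (hN : ∀ y, Y ≤ |y| → ‖saddlePrimitive x q (vline a y)‖ ≤ N) {u v : ℝ} (huv : u ≤ v)
    (h : ∀ y ∈ Icc u v, Y ≤ |y|) (hint : ∫ y in u..v, (y ^ 2)⁻¹ ≤ Y⁻¹) :
    ‖∫ y in u..v, cexp (x * vline a y) * vline a y ^ (-q)‖ ≤ x⁻¹ * (8 * N / Y) := by
  have hN0 : 0 ≤ N := (norm_nonneg _).trans (hN Y (le_abs_self Y))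
  have hd : ∀ y ∈ uIcc u v, |y| / 2 ≤ ‖vline a y - z₀‖ := fun y hy =>
    norm_vline_sub_ge (h y (by rwa [uIcc_of_le huv] at hy)) hz₀Y
  have hypos : ∀ y ∈ uIcc u v, 0 < |y| := fun y hy =>
    hY.trans_le (h y (by rwa [uIcc_of_le huv] at hy))
  have hne : ∀ y ∈ uIcc u v, vline a y - z₀ ≠ 0 := fun y hy =>
    norm_pos_iff.1 ((half_pos (hypos y hy)).trans_le (hd y hy))
  have hcv := continuous_vline a
  -- integrate by parts with `D = 1/(z - z₀)`, which is at most `2/|y|` since `|im z₀| ≤ Y/2`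
  have key := norm_integral_mul_sub_saddle_le ha hx hz₀ (u := u) (v := v)
    (fun y => (vline a y - z₀)⁻¹) (fun y => -I / (vline a y - z₀) ^ 2)
    (fun y hy => ((hasDerivAt_vline a y).sub_const z₀).fun_inv (hne y hy))
    (ContinuousOn.div (by fun_prop) (by fun_prop) fun y hy => pow_ne_zero 2 (hne y hy))
  have e : ∫ y in u..v, (vline a y - z₀)⁻¹ *
      ((vline a y - z₀) * (cexp (x * vline a y) * vline a y ^ (-q))) =
      ∫ y in u..v, cexp (x * vline a y) * vline a y ^ (-q) :=
    intervalIntegral.integral_congr fun y hy => inv_mul_cancel_left₀ (hne y hy) _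
  rw [e] at key
  refine key.trans ?_
  gcongr
  have hbd : ∀ y ∈ uIcc u v,
      ‖(vline a y - z₀)⁻¹‖ * ‖saddlePrimitive x q (vline a y)‖ ≤ 2 * N / Y := by
    intro y hy
    have hYy := h y (by rwa [uIcc_of_le huv] at hy)
    have h1 : ‖(vline a y - z₀)⁻¹‖ ≤ 2 / Y := by
      rw [norm_inv, inv_le_comm₀ (norm_pos_iff.2 (hne y hy)) (by positivity), inv_div]
      linarith [hd y hy]
    calc _ ≤ 2 / Y * N := by gcongr; exact hN y hYy
      _ = _ := by ring
  have h0 : ∀ y ∈ uIcc u v, y ≠ 0 := fun y hy => abs_pos.1 (hypos y hy)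
  have hI : ‖∫ y in u..v, -I / (vline a y - z₀) ^ 2 * saddlePrimitive x q (vline a y)‖ ≤
      4 * N * Y⁻¹ := by
    refine (intervalIntegral.norm_integral_le_of_norm_le (g := fun y => 4 * N * (y ^ 2)⁻¹) huv
      (Eventually.of_forall fun y hy => ?_) ?_).trans ?_
    · have hy' : y ∈ uIcc u v := by rw [uIcc_of_le huv]; exact Ioc_subset_Icc_self hy
      have hYy := h y (Ioc_subset_Icc_self hy)
      rw [norm_mul, norm_div, norm_neg, norm_I, norm_pow]
      have h1 : 1 / ‖vline a y - z₀‖ ^ 2 ≤ 4 * (y ^ 2)⁻¹ := by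
        have := hypos y hy'
        calc 1 / ‖vline a y - z₀‖ ^ 2 ≤ 1 / (|y| / 2) ^ 2 := by gcongr; exact hd y hy'
          _ = 4 * (y ^ 2)⁻¹ := by rw [div_pow, sq_abs]; field_simp; norm_num
      calc _ ≤ 4 * (y ^ 2)⁻¹ * N := by gcongr; exact hN y hYy
        _ = _ := by ring
    · exact (continuousOn_const.mul (ContinuousOn.inv₀ (by fun_prop)
        fun y hy => pow_ne_zero 2 (h0 y hy))).intervalIntegrable
    · rw [intervalIntegral.integral_const_mul]
      gcongr
  have := hbd u left_mem_uIcc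
  have := hbd v right_mem_uIcc
  have e2 : 8 * N / Y = 2 * N / Y + 2 * N / Y + 4 * N * Y⁻¹ := by ring
  linarith

theorem integral_inv_sq {u v : ℝ} (h0 : (0 : ℝ) ∉ uIcc u v) :
    ∫ y in u..v, (y ^ 2)⁻¹ = u⁻¹ - v⁻¹ := by
  have hne : ∀ y ∈ uIcc u v, y ≠ 0 := fun y hy h => h0 (h ▸ hy)
  have := intervalIntegral.integral_eq_sub_of_hasDerivAt (f := fun y : ℝ => -y⁻¹)
    (f' := fun y => (y ^ 2)⁻¹) (a := u) (b := v)
    (fun y hy => by simpa using (hasDerivAt_inv (hne y hy)).fun_neg)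
    ((ContinuousOn.inv₀ (by fun_prop) fun y hy => pow_ne_zero 2 (hne y hy)).intervalIntegrable)
  rw [this]; ring

/-- Truncating Laplace's integral to `|y| ≤ Y` beyond the height of the saddle point. -/
theorem norm_integral_laplace_sub_le {a x Y N : ℝ} (ha : 0 < a) (hx : 0 < x) (hY : 0 < Y)
    {q z₀ : ℂ} (hq : 1 < q.re) (hz₀ : x * z₀ = q - 1) (hz₀Y : |z₀.im| ≤ Y / 2)
    (hN : ∀ y, Y ≤ |y| → ‖saddlePrimitive x q (vline a y)‖ ≤ N) :
    ‖(∫ y in (-Y)..Y, cexp (x * vline a y) * vline a y ^ (-q)) -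
      2 * Real.pi * (x : ℂ) ^ (q - 1) / Gamma q‖ ≤ x⁻¹ * (16 * N / Y) := by
  set f : ℝ → ℂ := fun y => cexp (x * vline a y) * vline a y ^ (-q) with hf
  have hcont : Continuous f := continuous_laplace_vline ha x q
  have hfi : Integrable f := by
    refine ((integrable_cpow_neg_line ha hq).norm.const_mul (Real.exp (x * a))).mono'
      hcont.aestronglyMeasurable (Eventually.of_forall fun y => ?_)
    rw [hf]
    simp only [norm_mul, norm_exp]
    simp [vline]
  have htot : ∫ y, f y = 2 * Real.pi * (x : ℂ) ^ (q - 1) / Gamma q :=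
    integral_exp_mul_cpow_neg ha hx hq
  have hlim : Tendsto (fun R : ℝ => (∫ y in (-Y)..Y, f y) - ∫ y in (-R)..R, f y) atTop
      (𝓝 ((∫ y in (-Y)..Y, f y) - 2 * Real.pi * (x : ℂ) ^ (q - 1) / Gamma q)) := by
    rw [← htot]
    exact tendsto_const_nhds.sub
      (intervalIntegral_tendsto_integral hfi tendsto_neg_atTop_atBot tendsto_id)
  refine le_of_tendsto hlim.norm ?_
  filter_upwards [eventually_ge_atTop Y] with R hR
  have hi : ∀ u v : ℝ, IntervalIntegrable f volume u v := fun u v => hcont.intervalIntegrable u v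
  have e : (∫ y in (-Y)..Y, f y) - ∫ y in (-R)..R, f y =
      -((∫ y in (-R)..(-Y), f y) + ∫ y in Y..R, f y) := by
    rw [← intervalIntegral.integral_add_adjacent_intervals (hi (-R) (-Y)) (hi (-Y) R),
      ← intervalIntegral.integral_add_adjacent_intervals (hi (-Y) Y) (hi Y R)]
    ring
  have hR0 : 0 < R := hY.trans_le hR
  have hRi : 0 < R⁻¹ := inv_pos.2 hR0
  have h1 := norm_integral_laplace_far_le ha hx hY hz₀ hz₀Y hN (u := -R) (v := -Y) (by linarith)
    (fun y hy => by rw [abs_of_neg (by linarith [hy.2])]; linarith [hy.2])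
    (by
      rw [integral_inv_sq, inv_neg, inv_neg]
      · linarith
      · rw [uIcc_of_le (by linarith)]; rintro ⟨_, h⟩; linarith)
  have h2 := norm_integral_laplace_far_le ha hx hY hz₀ hz₀Y hN (u := Y) (v := R) hR
    (fun y hy => by rw [abs_of_pos (by linarith [hy.1])]; exact hy.1)
    (by
      rw [integral_inv_sq]
      · linarith
      · rw [uIcc_of_le hR]; rintro ⟨h, _⟩; linarith)
  rw [e, norm_neg]
  refine (norm_add_le _ _).trans ((add_le_add h1 h2).trans (le_of_eq ?_))
  ring

/-- Saddle point evaluation of a truncated Laplace integral with an analytic amplitude `b`: up to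
one integration by parts, `b` may be replaced by its value at the saddle point. -/
theorem norm_integral_amplitude_sub_le {a x Y N B M : ℝ} (ha : 0 < a) (hx : 0 < x) (hY : 0 < Y)
    (hM : 0 ≤ M) {q z₀ : ℂ} (hq : 1 < q.re) (hz₀ : x * z₀ = q - 1) (hz₀Y : |z₀.im| ≤ Y / 2)
    (hz₀a : z₀.re ≠ a) (hN : ∀ y, Y ≤ |y| → ‖saddlePrimitive x q (vline a y)‖ ≤ N)
    {b b' : ℂ → ℂ} {K : Set ℂ} (hK : Convex ℝ K) (hz₀K : z₀ ∈ K)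
    (hline : ∀ y, |y| ≤ Y → vline a y ∈ K) (hb : ∀ z ∈ K, HasDerivAt b (b' z) z)
    (hb' : ∀ z ∈ K, ∀ w ∈ K, ‖b' z - b' w‖ ≤ M * ‖z - w‖) (hB : ∀ z ∈ K, ‖b z‖ ≤ B) :
    ‖(∫ y in (-Y)..Y, b (vline a y) * (cexp (x * vline a y) * vline a y ^ (-q))) -
      b z₀ * (2 * Real.pi * (x : ℂ) ^ (q - 1) / Gamma q)‖ ≤
      x⁻¹ * (M * (∫ y in (-Y)..Y, ‖saddlePrimitive x q (vline a y)‖) + 24 * (B * N / Y)) := by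
  have hN0 : 0 ≤ N := (norm_nonneg _).trans (hN Y (le_abs_self Y))
  have hB0 : 0 ≤ B := (norm_nonneg _).trans (hB z₀ hz₀K)
  have hS : uIcc (-Y) Y = Icc (-Y) Y := uIcc_of_le (by linarith)
  have hin : ∀ y ∈ uIcc (-Y) Y, vline a y ∈ K := fun y hy => by
    rw [hS] at hy; exact hline y (abs_le.2 hy)
  have hne : ∀ y : ℝ, vline a y ≠ z₀ := fun y h => hz₀a (by rw [← h, vline_re])
  have hne' : ∀ y : ℝ, vline a y - z₀ ≠ 0 := fun y => sub_ne_zero.2 (hne y)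
  have hcv := continuous_vline a
  have hcb : ContinuousOn (fun y => b (vline a y)) (uIcc (-Y) Y) := fun y hy =>
    ((hb _ (hin y hy)).continuousAt.comp hcv.continuousAt).continuousWithinAt
  have hcb' : ContinuousOn (fun y => b' (vline a y)) (uIcc (-Y) Y) := by
    have : LipschitzOnWith (Real.toNNReal M) b' K := LipschitzOnWith.of_dist_le_mul
      fun z hz w hw => by
        rw [dist_eq_norm, dist_eq_norm, Real.coe_toNNReal _ hM]; exact hb' z hz w hw
    exact this.continuousOn.comp hcv.continuousOn hin
  -- write `b z = b z₀ + (z - z₀) D`; only the part with `D` is integrated by parts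
  set D : ℝ → ℂ := fun y => (b (vline a y) - b z₀) / (vline a y - z₀) with hD
  set D' : ℝ → ℂ := fun y =>
    I * ((b' (vline a y) * (vline a y - z₀) - (b (vline a y) - b z₀)) / (vline a y - z₀) ^ 2)
    with hD'
  have hDd : ∀ y ∈ uIcc (-Y) Y, HasDerivAt D (D' y) y := by
    intro y hy
    have h1 := ((hb _ (hin y hy)).sub_const (b z₀)).fun_div
      ((hasDerivAt_id' (vline a y)).sub_const z₀) (hne' y)
    refine (h1.comp_of_eq y (hasDerivAt_vline a y) rfl).congr_deriv ?_
    rw [hD']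
    ring
  have hD'c : ContinuousOn D' (uIcc (-Y) Y) := by
    refine continuousOn_const.mul (ContinuousOn.div ?_ (by fun_prop)
      fun y _ => pow_ne_zero 2 (hne' y))
    exact (hcb'.mul (by fun_prop)).sub (hcb.sub continuousOn_const)
  have key := norm_integral_mul_sub_saddle_le ha hx hz₀ (u := -Y) (v := Y) D D' hDd hD'c
  have hlap := continuous_laplace_vline ha x q
  have hi1 : IntervalIntegrable (fun y => D y *
      ((vline a y - z₀) * (cexp (x * vline a y) * vline a y ^ (-q)))) volume (-Y) Y := by
    refine ContinuousOn.intervalIntegrable ?_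
    refine ContinuousOn.mul (fun y hy => (hDd y hy).continuousAt.continuousWithinAt) ?_
    exact ((hcv.sub continuous_const).mul hlap).continuousOn
  have hi2 : IntervalIntegrable (fun y => b z₀ * (cexp (x * vline a y) * vline a y ^ (-q)))
      volume (-Y) Y := (continuous_const.mul hlap).intervalIntegrable _ _
  have e : ∫ y in (-Y)..Y, b (vline a y) * (cexp (x * vline a y) * vline a y ^ (-q)) =
      (∫ y in (-Y)..Y, D y * ((vline a y - z₀) * (cexp (x * vline a y) * vline a y ^ (-q)))) +
      b z₀ * ∫ y in (-Y)..Y, cexp (x * vline a y) * vline a y ^ (-q) := by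
    rw [← intervalIntegral.integral_const_mul, ← intervalIntegral.integral_add hi1 hi2]
    refine intervalIntegral.integral_congr fun y _ => ?_
    have := hne' y
    simp only [hD]
    field_simp
    ring
  have htail := norm_integral_laplace_sub_le ha hx hY hq hz₀ hz₀Y hN
  have hDend : ∀ y ∈ uIcc (-Y) Y, Y ≤ |y| →
      ‖D y‖ * ‖saddlePrimitive x q (vline a y)‖ ≤ 4 * (B * N / Y) := by
    intro y hy hYy
    have h1 : ‖D y‖ ≤ 4 * B / Y := by
      rw [hD]
      simp only [norm_div]
      rw [div_le_div_iff₀ (norm_pos_iff.2 (hne' y)) hY]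
      have h2 := norm_vline_sub_ge (a := a) hYy hz₀Y
      have h3 : ‖b (vline a y) - b z₀‖ ≤ 2 * B :=
        (norm_sub_le _ _).trans (by linarith [hB _ (hin y hy), hB _ hz₀K])
      nlinarith
    calc _ ≤ 4 * B / Y * N := by gcongr; exact hN y hYy
      _ = _ := by ring
  have hl := hDend (-Y) left_mem_uIcc (by rw [abs_neg]; exact le_abs_self Y)
  have hr := hDend Y right_mem_uIcc (le_abs_self Y)
  have hsc := (continuous_saddlePrimitive_vline ha x q).norm
  have hI : ‖∫ y in (-Y)..Y, D' y * saddlePrimitive x q (vline a y)‖ ≤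
      M * ∫ y in (-Y)..Y, ‖saddlePrimitive x q (vline a y)‖ := by
    rw [← intervalIntegral.integral_const_mul]
    refine intervalIntegral.norm_integral_le_of_norm_le (by linarith)
      (Eventually.of_forall fun y hy => ?_) ((continuous_const.mul hsc).intervalIntegrable _ _)
    have hyK := hin y (by rw [hS]; exact Ioc_subset_Icc_self hy)
    rw [norm_mul]
    gcongr
    rw [hD', norm_mul, norm_I, one_mul]
    exact norm_deriv_quotient_le hK hb hb' hyK hz₀K hM (hne y)
  have e3 : (∫ y in (-Y)..Y, b (vline a y) * (cexp (x * vline a y) * vline a y ^ (-q))) -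
      b z₀ * (2 * Real.pi * (x : ℂ) ^ (q - 1) / Gamma q) =
      (∫ y in (-Y)..Y, D y * ((vline a y - z₀) * (cexp (x * vline a y) * vline a y ^ (-q)))) +
      b z₀ * ((∫ y in (-Y)..Y, cexp (x * vline a y) * vline a y ^ (-q)) -
        2 * Real.pi * (x : ℂ) ^ (q - 1) / Gamma q) := by rw [e]; ring
  rw [e3]
  have h4 : ‖b z₀ * ((∫ y in (-Y)..Y, cexp (x * vline a y) * vline a y ^ (-q)) -
        2 * Real.pi * (x : ℂ) ^ (q - 1) / Gamma q)‖ ≤ B * (x⁻¹ * (16 * N / Y)) := by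
    rw [norm_mul]
    exact mul_le_mul (hB _ hz₀K) htail (norm_nonneg _) hB0
  have h5 := key.trans (mul_le_mul_of_nonneg_left (add_le_add (add_le_add hl hr) hI)
    (inv_nonneg.2 hx.le))
  refine (norm_add_le _ _).trans ((add_le_add h5 h4).trans (le_of_eq ?_))
  ring

/-! ### Exponential decay of the block and of the Laplace integrand -/

/-- Since `re z / |z| = cos (arg z) = sin (π/2 - |arg z|)`. -/
theorem re_div_norm_le_pi_div_two_sub_abs_arg {z : ℂ} (hz : 0 < z.re) :
    z.re / ‖z‖ ≤ Real.pi / 2 - |arg z| := by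
  have hz0 : z ≠ 0 := by rintro rfl; simp at hz
  have h := abs_arg_lt_pi_div_two_iff.2 (Or.inl hz)
  rw [← cos_arg hz0, ← Real.cos_abs, ← Real.sin_pi_div_two_sub]
  exact Real.sin_le (by linarith)

theorem abs_arg_le_of_re_pos {w : ℂ} (hw : 0 < w.re) : |arg w| ≤ Real.pi / 2 * (|w.im| / ‖w‖) := by
  have hw0 : w ≠ 0 := by rintro rfl; simp at hw
  have h := abs_arg_lt_pi_div_two_iff.2 (Or.inl hw)
  have h1 : |w.im| / ‖w‖ = Real.sin |arg w| := by
    have h2 : |Real.sin (arg w)| = Real.sin |arg w| := by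
      rcases abs_cases (arg w) with ⟨e, h0⟩ | ⟨e, h0⟩
      · rw [e, abs_of_nonneg (Real.sin_nonneg_of_nonneg_of_le_pi h0 (by
          rw [e] at h; linarith [Real.pi_pos]))]
      · rw [e] at h ⊢
        rw [Real.sin_neg, abs_of_nonpos]
        rw [← neg_nonneg, ← Real.sin_neg]
        exact Real.sin_nonneg_of_nonneg_of_le_pi (by linarith) (by linarith [Real.pi_pos])
    rw [← h2, sin_arg, abs_div, abs_of_nonneg (norm_nonneg w)]
  rw [h1]
  have := Real.mul_le_sin (abs_nonneg (arg w)) h.le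
  have hpi := Real.pi_pos
  calc |arg w| = Real.pi / 2 * (2 / Real.pi * |arg w|) := by field_simp
    _ ≤ _ := by gcongr

theorem sin_pi_div_cos_pi (t : ℝ) :
    sin (Real.pi * (1 / 2 + I * t)) / (2 * Real.pi * cos (Real.pi * (1 / 2 + I * t))) =
      I * ((Real.cosh (Real.pi * t) / Real.sinh (Real.pi * t) : ℝ) : ℂ) / (2 * Real.pi) := by
  have e : (Real.pi : ℂ) * (1 / 2 + I * t) = ((Real.pi * t : ℝ) : ℂ) * I + Real.pi / 2 := by
    push_cast; ring
  rw [e, Complex.sin_add_pi_div_two, Complex.cos_add_pi_div_two, Complex.cos_mul_I,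
    Complex.sin_mul_I, ofReal_div, ofReal_cosh, ofReal_sinh]
  rw [div_eq_mul_inv, mul_inv, inv_neg, mul_inv, mul_inv, inv_I]
  ring

theorem cos_pi_ne_zero {t : ℝ} (ht : 0 < t) : cos (Real.pi * (1 / 2 + I * t)) ≠ 0 := by
  have e : (Real.pi : ℂ) * (1 / 2 + I * t) = ((Real.pi * t : ℝ) : ℂ) * I + Real.pi / 2 := by
    push_cast; ring
  rw [e, Complex.cos_add_pi_div_two, Complex.sin_mul_I, ← ofReal_sinh]
  have : 0 < Real.sinh (Real.pi * t) := Real.sinh_pos_iff.2 (by positivity)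
  simp [this.ne', -ofReal_sinh]

theorem coth_pi_sub_one_bounds {t : ℝ} (ht : 1 < t) :
    0 ≤ Real.cosh (Real.pi * t) / Real.sinh (Real.pi * t) - 1 ∧
      Real.cosh (Real.pi * t) / Real.sinh (Real.pi * t) - 1 ≤ 1 / t := by
  have hx : 3 < Real.pi * t := by nlinarith [Real.pi_gt_three]
  set x := Real.pi * t
  have hs : 0 < Real.sinh x := Real.sinh_pos_iff.2 (by linarith)
  have hs1 : x ≤ Real.sinh x := (Real.self_le_sinh_iff).2 (by linarith)
  have e : Real.cosh x / Real.sinh x - 1 = Real.exp (-x) / Real.sinh x := by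
    rw [← Real.cosh_sub_sinh]; field_simp
  have he : Real.exp (-x) ≤ 1 := Real.exp_le_one_iff.2 (by linarith)
  rw [e]
  refine ⟨by positivity, ?_⟩
  rw [div_le_div_iff₀ hs (by linarith)]
  have h1 : t ≤ x := by
    simp only [x]; nlinarith [Real.pi_gt_three]
  nlinarith [Real.exp_pos (-x)]

/-- The integral `∫₀¹ (y (1 - y))^(-1/2) dy` that bounds `eulerJ` on the critical line. -/
noncomputable def eulerMass : ℝ :=
  ∫ y : ℝ in 0..1, ‖(y : ℂ) ^ ((1 / 2 : ℂ) - 1) * (1 - (y : ℂ)) ^ ((1 / 2 : ℂ) - 1)‖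

theorem eulerMass_nonneg : 0 ≤ eulerMass :=
  intervalIntegral.integral_nonneg zero_le_one fun _ _ => norm_nonneg _

/-- The factor `(1 - z² y)⁻ˢ` grows at most like `exp (5 |im s| re z |z|)` because `1 - z² y` has
argument `O(re z |z|)`. -/
theorem norm_eulerJ_le {s z : ℂ} (hs : s.re = 1 / 2) (hz : 0 < z.re) (hz1 : ‖z‖ ≤ 2 / 5) :
    ‖eulerJ s (z ^ 2)‖ ≤ 2 * Real.exp (5 * |s.im| * (z.re * ‖z‖)) * eulerMass := by
  have hg := (betaIntegral_convergent (u := 1 / 2) (v := 1 / 2) (by norm_num) (by norm_num)).norm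
  rw [eulerJ, eulerMass, ← intervalIntegral.integral_const_mul]
  refine intervalIntegral.norm_integral_le_of_norm_le zero_le_one ?_ (hg.const_mul _)
  have h1 : ∀ᵐ y : ℝ, y ≠ 1 := by simp [ae_iff, measure_singleton]
  filter_upwards [h1] with y hy1 hy
  have hy0 : 0 < y := hy.1
  have hy1' : 0 < 1 - y := by
    rcases hy.2.lt_or_eq with h | h
    · linarith
    · exact absurd h hy1
  rw [norm_mul, norm_mul, norm_mul]
  have e1 : ‖(y : ℂ) ^ (s - 1)‖ = ‖(y : ℂ) ^ ((1 / 2 : ℂ) - 1)‖ := by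
    rw [norm_cpow_eq_rpow_re_of_pos hy0, norm_cpow_eq_rpow_re_of_pos hy0]
    congr 1; simp [hs]
  have e2 : ‖(1 - (y : ℂ)) ^ (s - 1)‖ = ‖(1 - (y : ℂ)) ^ ((1 / 2 : ℂ) - 1)‖ := by
    rw [show (1 : ℂ) - (y : ℂ) = ((1 - y : ℝ) : ℂ) by push_cast; ring,
      norm_cpow_eq_rpow_re_of_pos hy1', norm_cpow_eq_rpow_re_of_pos hy1']
    congr 1; simp [hs]
  rw [e1, e2, mul_comm]
  refine mul_le_mul_of_nonneg_right ?_ (by positivity)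
  set w : ℂ := 1 - z ^ 2 * (y : ℂ) with hw
  have hn : ‖z ^ 2 * (y : ℂ)‖ ≤ 4 / 25 := by
    rw [norm_mul, norm_pow, norm_real, Real.norm_of_nonneg hy0.le]
    have : ‖z‖ ^ 2 ≤ 4 / 25 := by nlinarith [norm_nonneg z]
    nlinarith [sq_nonneg ‖z‖, hy.2]
  have hwre : 21 / 25 ≤ w.re := by
    have := re_le_norm (z ^ 2 * (y : ℂ))
    rw [hw, sub_re, one_re]; linarith
  have hwn : 21 / 25 ≤ ‖w‖ := hwre.trans (re_le_norm w)
  have hw0 : w ≠ 0 := by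
    intro h; rw [h, norm_zero] at hwn; norm_num at hwn
  have him : |w.im| ≤ 2 * (z.re * ‖z‖) := by
    have h2 : w.im = -(2 * z.re * z.im * y) := by
      rw [hw, sub_im, one_im, im_mul_ofReal, sq, mul_im]; ring
    rw [h2, abs_neg, abs_mul, abs_mul, abs_mul, abs_of_pos hz, abs_of_pos hy0, abs_two]
    have := abs_im_le_norm z
    have h3 : z.re * |z.im| ≤ z.re * ‖z‖ := by gcongr
    nlinarith [hy.2, mul_nonneg hz.le (abs_nonneg z.im)]
  have harg : |arg w| ≤ 5 * (z.re * ‖z‖) := by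
    refine (abs_arg_le_of_re_pos (by linarith)).trans ?_
    have hpi := Real.pi_lt_d2
    have h3 : |w.im| / ‖w‖ ≤ 2 * (z.re * ‖z‖) / (21 / 25) := by gcongr
    have h4 : 0 ≤ z.re * ‖z‖ := by positivity
    calc Real.pi / 2 * (|w.im| / ‖w‖) ≤ 3.15 / 2 * (2 * (z.re * ‖z‖) / (21 / 25)) := by gcongr
      _ ≤ _ := by nlinarith
  rw [norm_cpow_of_ne_zero hw0, div_eq_mul_inv, ← Real.exp_neg]
  gcongr
  · rw [neg_re, hs]
    calc ‖w‖ ^ (-(1 / 2) : ℝ) ≤ (1 / 4 : ℝ) ^ (-(1 / 2) : ℝ) :=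
          Real.rpow_le_rpow_of_nonpos (by norm_num) (by linarith) (by norm_num)
      _ = 2 := by
          rw [show (1 / 4 : ℝ) = (2 ^ (2 : ℝ))⁻¹ by norm_num, Real.inv_rpow (by positivity),
            ← Real.rpow_mul (by norm_num), ← Real.rpow_neg (by norm_num)]
          norm_num
  · rw [neg_im, mul_neg, neg_neg]
    calc arg w * s.im ≤ |arg w| * |s.im| := by rw [← abs_mul]; exact le_abs_self _
      _ ≤ 5 * (z.re * ‖z‖) * |s.im| := by gcongr
      _ = _ := by ring

/-- The normalized block decays like `exp (-t re z / |z|)` near `z = 0`: in the connection formula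
`exp (2t |arg z|)` falls short of `exp (π t)`. -/
theorem exp_mul_norm_blockH_le {t : ℝ} (ht : 1 < t) {z : ℂ} (hz : 0 < z.re) (hz1 : ‖z‖ ≤ 2 / 5) :
    Real.exp (-Real.pi * t) * ‖blockH (1 / 2 + I * t) (1 - (z ^ 2)⁻¹)‖ ≤
      8 * eulerMass * (‖z‖ * Real.exp (-(t * (z.re / ‖z‖)))) := by
  have hz0 : z ≠ 0 := by rintro rfl; simp at hz
  have hzn : 0 < ‖z‖ := norm_pos_iff.2 hz0
  set s : ℂ := 1 / 2 + I * t with hs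
  have hsre : s.re = 1 / 2 := by simp [hs]
  have hsim : s.im = t := by simp [hs]
  have ht0 : 0 < t := by linarith
  have hc := coth_pi_sub_one_bounds ht
  set c := Real.cosh (Real.pi * t) / Real.sinh (Real.pi * t) with hcdef
  have ht1 : 1 / t ≤ 1 := by rw [div_le_one ht0]; exact ht.le
  have hpow : ∀ e : ℂ, e.re = 1 → |e.im| = 2 * t → ‖z ^ e‖ ≤ ‖z‖ * Real.exp (2 * t * |arg z|) := by
    intro e he1 he2
    rw [norm_cpow_of_ne_zero hz0, he1, Real.rpow_one, div_eq_mul_inv, ← Real.exp_neg]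
    gcongr
    calc -(arg z * e.im) ≤ |arg z * e.im| := neg_le_abs _
      _ = 2 * t * |arg z| := by rw [abs_mul, he2]; ring
  have p1 := hpow (2 * s) (by simp [hsre]) (by simp [hsim, abs_of_pos ht0])
  have p2 := hpow (2 - 2 * s) (by simp [hsre]; norm_num) (by simp [hsim, abs_of_pos ht0])
  have j1 := norm_eulerJ_le hsre hz hz1
  have j2 := norm_eulerJ_le (s := 1 - s) (by simp [hsre]; norm_num) hz hz1
  rw [hsim, abs_of_pos ht0] at j1
  rw [sub_im, one_im, zero_sub, abs_neg, hsim, abs_of_pos ht0] at j2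
  have hm := eulerMass_nonneg
  have hcoef : ‖I * (c : ℂ) / (2 * Real.pi)‖ ≤ 2 := by
    rw [norm_div, norm_mul, norm_I, one_mul, norm_real, Real.norm_of_nonneg (by linarith),
      norm_mul, norm_real, Real.norm_of_nonneg Real.pi_pos.le, RCLike.norm_ofNat,
      div_le_iff₀ (by positivity)]
    nlinarith [Real.pi_gt_three]
  have hconn := blockH_connection hsre (cos_pi_ne_zero ht0) hz (by linarith)
  rw [sin_pi_div_cos_pi] at hconn
  have hexp : Real.exp (-Real.pi * t) * (Real.exp (2 * t * |arg z|) *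
      Real.exp (5 * t * (z.re * ‖z‖))) ≤ Real.exp (-(t * (z.re / ‖z‖))) := by
    rw [← Real.exp_add, ← Real.exp_add]
    gcongr
    have h1 := re_div_norm_le_pi_div_two_sub_abs_arg hz
    have h2 : 5 * (z.re * ‖z‖) ≤ z.re / ‖z‖ := by
      rw [le_div_iff₀ hzn]
      have : ‖z‖ ^ 2 ≤ 4 / 25 := by nlinarith
      nlinarith
    nlinarith
  rw [hconn]
  calc Real.exp (-Real.pi * t) * ‖I * (c : ℂ) / (2 * Real.pi) *
        (z ^ (2 * s) * eulerJ s (z ^ 2) - z ^ (2 - 2 * s) * eulerJ (1 - s) (z ^ 2))‖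
      ≤ Real.exp (-Real.pi * t) * (2 *
        (‖z‖ * Real.exp (2 * t * |arg z|) * (2 * Real.exp (5 * t * (z.re * ‖z‖)) * eulerMass) +
        ‖z‖ * Real.exp (2 * t * |arg z|) * (2 * Real.exp (5 * t * (z.re * ‖z‖)) * eulerMass))) := by
        rw [norm_mul]
        gcongr
        refine (norm_sub_le _ _).trans ?_
        rw [norm_mul, norm_mul]
        gcongr
    _ = 8 * eulerMass * ‖z‖ * (Real.exp (-Real.pi * t) * (Real.exp (2 * t * |arg z|) *
        Real.exp (5 * t * (z.re * ‖z‖)))) := by ring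
    _ ≤ 8 * eulerMass * ‖z‖ * Real.exp (-(t * (z.re / ‖z‖))) := by gcongr
    _ = _ := by ring

/-- The exponential growth `exp (2t arg z)` of `z^(1-q)` falls short of `exp (π t)` by at least
`exp (2t re z / |z|)`. -/
theorem exp_mul_norm_saddlePrimitive_le {a x t : ℝ} (ha : 0 < a) (ht : 0 < t) {q : ℂ}
    (hq : q.im = 2 * t) (y : ℝ) :
    Real.exp (-Real.pi * t) * ‖saddlePrimitive x q (vline a y)‖ ≤ Real.exp (x * a) *
      (‖vline a y‖ ^ (1 - q.re) * Real.exp (-(2 * t * a / ‖vline a y‖))) := by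
  set z := vline a y with hz
  have hz0 : z ≠ 0 := vline_ne_zero ha y
  have hre : z.re = a := vline_re a y
  rw [saddlePrimitive, norm_mul, norm_exp, norm_cpow_of_ne_zero hz0]
  have e1 : ((x : ℂ) * z).re = x * a := by simp [hre]
  rw [e1, sub_re, one_re, sub_im, one_im, zero_sub, hq, div_eq_mul_inv, ← Real.exp_neg]
  have h1 := re_div_norm_le_pi_div_two_sub_abs_arg (z := z) (by rw [hre]; exact ha)
  rw [hre] at h1
  have h2 : Real.exp (-Real.pi * t) * Real.exp (-(arg z * -(2 * t))) ≤
      Real.exp (-(2 * t * a / ‖z‖)) := by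
    rw [← Real.exp_add]
    gcongr
    have h3 := le_abs_self (arg z)
    have h4 : 2 * t * a / ‖z‖ = 2 * t * (a / ‖z‖) := by ring
    rw [h4]
    nlinarith
  calc _ = Real.exp (x * a) * (‖z‖ ^ (1 - q.re) *
        (Real.exp (-Real.pi * t) * Real.exp (-(arg z * -(2 * t))))) := by ring
    _ ≤ _ := by gcongr

theorem one_add_pow_mul_exp_neg_le {v : ℝ} (hv : 0 ≤ v) (n : ℕ) :
    (1 + v) ^ n * Real.exp (-v) ≤ Real.exp 1 * n.factorial := by
  have h := Real.pow_div_factorial_le_exp (1 + v) (by linarith) n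
  rw [div_le_iff₀ (by positivity), Real.exp_add] at h
  rw [Real.exp_neg, ← div_eq_mul_inv, div_le_iff₀ (Real.exp_pos v)]
  linarith

/-- A scale-invariant integrable majorant for `r^(-m) exp (-β/r)`, for every `r ≥ |y|`. -/
theorem rpow_neg_mul_exp_neg_div_le {m r y β : ℝ} {n : ℕ} (hm : 0 ≤ m) (hmn : m ≤ n) (hr : 0 < r)
    (hβ : 0 < β) (hy : |y| ≤ r) :
    r ^ (-m) * Real.exp (-(β / r)) ≤
      Real.exp 1 * n.factorial * (β ^ (-m) * (1 + ‖y / β‖) ^ (-m)) := by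
  have hv : 0 < β / r := by positivity
  have h1 := one_add_pow_mul_exp_neg_le hv.le n
  have h2 : (1 + β / r) ^ m ≤ (1 + β / r) ^ n := by
    rw [← Real.rpow_natCast]
    exact Real.rpow_le_rpow_of_exponent_le (by linarith) hmn
  have h3 : r ^ (-m) = (1 + β / r) ^ m * (β ^ (-m) * (1 + r / β) ^ (-m)) := by
    have e : 1 + r / β = r / β * (1 + β / r) := by field_simp; ring
    rw [e, Real.mul_rpow (by positivity) (by positivity), Real.div_rpow hr.le hβ.le]
    simp only [Real.rpow_neg hr.le, Real.rpow_neg hβ.le,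
      Real.rpow_neg (by positivity : 0 ≤ 1 + β / r)]
    have := Real.rpow_pos_of_pos hr m
    have := Real.rpow_pos_of_pos hβ m
    have : 0 < (1 + β / r) ^ m := by positivity
    field_simp
  have h4 : (1 + r / β) ^ (-m) ≤ (1 + ‖y / β‖) ^ (-m) := by
    refine Real.rpow_le_rpow_of_nonpos (by positivity) ?_ (by linarith)
    rw [norm_div, Real.norm_eq_abs, Real.norm_of_nonneg hβ.le]
    gcongr
  calc r ^ (-m) * Real.exp (-(β / r))
      = (1 + β / r) ^ m * Real.exp (-(β / r)) * (β ^ (-m) * (1 + r / β) ^ (-m)) := by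
        rw [h3]; ring
    _ ≤ (1 + β / r) ^ n * Real.exp (-(β / r)) * (β ^ (-m) * (1 + ‖y / β‖) ^ (-m)) := by gcongr
    _ ≤ _ := by gcongr

/-- The integral of the majorant of `saddlePrimitive` along the line scales like `β^(1-m)`, uniformly
in the abscissa `a`. -/
theorem exists_integral_vline_weight_le {m : ℝ} (hm : 1 < m) :
    ∃ C : ℝ, 0 ≤ C ∧ ∀ a β Y : ℝ, 0 < a → 0 < β → 0 ≤ Y →
      ∫ y in (-Y)..Y, ‖vline a y‖ ^ (-m) * Real.exp (-(β / ‖vline a y‖)) ≤ C * β ^ (1 - m) := by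
  obtain ⟨n, hn⟩ := exists_nat_ge m
  set J := ∫ y : ℝ, (1 + ‖y‖) ^ (-m) with hJ
  have hJ0 : 0 ≤ J := integral_nonneg fun y => by positivity
  have hJi : Integrable (fun y : ℝ => (1 + ‖y‖) ^ (-m)) :=
    integrable_one_add_norm (by simpa using hm)
  refine ⟨Real.exp 1 * n.factorial * J, by positivity, fun a β Y ha hβ hY => ?_⟩
  have hint : Integrable fun y : ℝ =>
      Real.exp 1 * n.factorial * (β ^ (-m) * (1 + ‖y / β‖) ^ (-m)) :=
    ((hJi.comp_div hβ.ne').const_mul _).const_mul _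
  have hbd : ∀ y : ℝ, ‖vline a y‖ ^ (-m) * Real.exp (-(β / ‖vline a y‖)) ≤
      Real.exp 1 * n.factorial * (β ^ (-m) * (1 + ‖y / β‖) ^ (-m)) := fun y =>
    rpow_neg_mul_exp_neg_div_le (by linarith) hn (norm_pos_iff.2 (vline_ne_zero ha y)) hβ
      (by simpa using abs_im_le_norm (vline a y))
  have hcont : Continuous fun y => ‖vline a y‖ ^ (-m) * Real.exp (-(β / ‖vline a y‖)) := by
    have h0 : ∀ y, ‖vline a y‖ ≠ 0 := fun y => norm_ne_zero_iff.2 (vline_ne_zero ha y)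
    have h1 := (continuous_vline a).norm
    exact (h1.rpow_const fun y => Or.inl (h0 y)).mul (continuous_const.div h1 h0).neg.rexp
  calc ∫ y in (-Y)..Y, ‖vline a y‖ ^ (-m) * Real.exp (-(β / ‖vline a y‖))
      ≤ ∫ y in (-Y)..Y, Real.exp 1 * n.factorial * (β ^ (-m) * (1 + ‖y / β‖) ^ (-m)) :=
        intervalIntegral.integral_mono_on (by linarith) (hcont.intervalIntegrable _ _)
          hint.intervalIntegrable fun y _ => hbd y
    _ ≤ ∫ y, Real.exp 1 * n.factorial * (β ^ (-m) * (1 + ‖y / β‖) ^ (-m)) := by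
        rw [intervalIntegral.integral_of_le (by linarith)]
        exact setIntegral_le_integral hint (Eventually.of_forall fun y => by positivity)
    _ = _ := by
        rw [integral_const_mul, integral_const_mul,
          Measure.integral_comp_div (fun y : ℝ => (1 + ‖y‖) ^ (-m)) β, abs_of_pos hβ, smul_eq_mul,
          ← hJ, Real.rpow_sub hβ, Real.rpow_one, Real.rpow_neg hβ.le]
        field_simp

/-! ### The amplitude -/

/-- Cauchy's estimate applied twice: a holomorphic function bounded by `B` on the
`2r`-neighbourhood of a convex set has a derivative which is Lipschitz on the set with constant
`B / r²`. -/
theorem norm_deriv_sub_deriv_le_of_bounded {g : ℂ → ℂ} {K : Set ℂ} (hK : Convex ℝ K) {r B : ℝ}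
    (hr : 0 < r) (hd : ∀ z ∈ K, ∀ w, ‖w - z‖ ≤ 2 * r → DifferentiableAt ℂ g w)
    (hB : ∀ z ∈ K, ∀ w, ‖w - z‖ ≤ 2 * r → ‖g w‖ ≤ B) {z w : ℂ} (hz : z ∈ K) (hw : w ∈ K) :
    ‖deriv g z - deriv g w‖ ≤ B / r / r * ‖z - w‖ := by
  have h1 : ∀ z ∈ K, ∀ w, ‖w - z‖ ≤ r → ‖deriv g w‖ ≤ B / r := by
    intro z hz w hw
    have hsub : ∀ v, ‖v - w‖ ≤ r → ‖v - z‖ ≤ 2 * r := by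
      intro v hv
      calc ‖v - z‖ = ‖(v - w) + (w - z)‖ := by ring_nf
        _ ≤ r + r := (norm_add_le _ _).trans (add_le_add hv hw)
        _ = 2 * r := by ring
    refine norm_deriv_le_of_forall_mem_sphere_norm_le hr (DifferentiableOn.diffContOnCl ?_) ?_
    · intro v hv
      rw [closure_ball _ hr.ne', mem_closedBall_iff_norm] at hv
      exact (hd z hz v (hsub v hv)).differentiableWithinAt
    · intro v hv
      exact hB z hz v (hsub v (mem_sphere_iff_norm.1 hv).le)
  have hdd : ∀ z ∈ K, ∀ w, ‖w - z‖ ≤ r → DifferentiableAt ℂ (deriv g) w := by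
    intro z hz w hw
    have hD : DifferentiableOn ℂ g (Metric.ball z (2 * r)) := fun v hv =>
      (hd z hz v (mem_ball_iff_norm.1 hv).le).differentiableWithinAt
    refine (hD.deriv Metric.isOpen_ball).differentiableAt (Metric.isOpen_ball.mem_nhds ?_)
    rw [mem_ball_iff_norm]
    linarith
  have h2 : ∀ z ∈ K, ‖deriv (deriv g) z‖ ≤ B / r / r := by
    intro z hz
    refine norm_deriv_le_of_forall_mem_sphere_norm_le hr (DifferentiableOn.diffContOnCl ?_) ?_
    · intro v hv
      rw [closure_ball _ hr.ne', mem_closedBall_iff_norm] at hv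
      exact (hdd z hz v hv).differentiableWithinAt
    · intro v hv
      exact h1 z hz v (mem_sphere_iff_norm.1 hv).le
  exact hK.norm_image_sub_le_of_norm_deriv_le
    (fun v hv => hdd v hv v (by simpa using hr.le)) h2 hw hz

/-- The slowly varying factor of the integrand of the averaged block: the analytic continuation of
the Gaussian weight `exp (-(H y)²)` from the line `Re z = a`, times the hypergeometric factor. -/
noncomputable def blockAmplitude (H a : ℝ) (p z : ℂ) : ℂ :=
  cexp ((H : ℂ) ^ 2 * (z - a) ^ 2) * hyp2F1 p p (2 * p) (z ^ 2)

/-- The box `0 ≤ Re z ≤ 1/H`, `|Im z| ≤ Y`. -/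
def saddleBox (H Y : ℝ) : Set ℂ := {z | 0 ≤ z.re ∧ z.re ≤ H⁻¹ ∧ |z.im| ≤ Y}

theorem convex_saddleBox (H Y : ℝ) : Convex ℝ (saddleBox H Y) := by
  rintro z ⟨h1, h2, h3⟩ w ⟨h4, h5, h6⟩ u v hu hv huv
  rw [abs_le] at h3 h6
  refine ⟨?_, ?_, ?_⟩
  · simp only [add_re, real_smul, re_ofReal_mul]
    positivity
  · simp only [add_re, real_smul, re_ofReal_mul]
    calc u * z.re + v * w.re ≤ u * H⁻¹ + v * H⁻¹ := by gcongr
      _ = H⁻¹ := by rw [← add_mul, huv, one_mul]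
  · simp only [add_im, real_smul, im_ofReal_mul]
    rw [abs_le]
    constructor
    · calc -Y = u * -Y + v * -Y := by rw [← add_mul, huv, one_mul]
        _ ≤ _ := by gcongr; exacts [h3.1, h6.1]
    · calc u * z.im + v * w.im ≤ u * Y + v * Y := by gcongr; exacts [h3.2, h6.2]
        _ = Y := by rw [← add_mul, huv, one_mul]

section

variable {H a Y : ℝ} {p : ℂ}

theorem norm_le_of_near_saddleBox (hHY : H⁻¹ ≤ Y) {z w : ℂ}
    (hz : z ∈ saddleBox H Y) (hw : ‖w - z‖ ≤ H⁻¹) : ‖w‖ ≤ 3 * Y := by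
  obtain ⟨h1, h2, h3⟩ := hz
  calc ‖w‖ = ‖(w - z) + z‖ := by ring_nf
    _ ≤ ‖w - z‖ + (|z.re| + |z.im|) :=
      (norm_add_le _ _).trans (add_le_add le_rfl (norm_le_abs_re_add_abs_im z))
    _ ≤ Y + (Y + Y) := by
      rw [abs_of_nonneg h1]
      gcongr <;> linarith
    _ = 3 * Y := by ring

theorem differentiableAt_blockAmplitude (hp : 0 < p.re) {z : ℂ} (hz : ‖z‖ < 1) :
    DifferentiableAt ℂ (blockAmplitude H a p) z := by
  have hz2 : z ^ 2 ∈ hypDomain := by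
    refine mem_hypDomain_of_norm_lt_one ?_
    rw [norm_pow]
    exact pow_lt_one₀ (norm_nonneg _) hz two_ne_zero
  have h := (isHypBranch_hyp2F1 (a := p) (b := p) (c := 2 * p) hp
    (by simp; linarith)).1.differentiableAt (isOpen_hypDomain.mem_nhds hz2)
  unfold blockAmplitude
  refine DifferentiableAt.mul (by fun_prop) ?_
  exact DifferentiableAt.comp z h (by fun_prop)

/-- On the `1/H`-neighbourhood of the box the Gaussian is at most `exp 4`, since there
`|re w - a| ≤ 2/H`, and the hypergeometric factor is at most `2`. -/
theorem norm_blockAmplitude_le (hp : 0 < p.re) (hH : 0 < H) (hHY : H⁻¹ ≤ Y) (ha : 0 ≤ a)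
    (haH : a ≤ H⁻¹) (hY : 36 * Y ^ 2 ≤ 1) (hpY : ‖p‖ * (36 * Y ^ 2) ≤ 1) {z w : ℂ}
    (hz : z ∈ saddleBox H Y) (hw : ‖w - z‖ ≤ H⁻¹) :
    ‖blockAmplitude H a p w‖ ≤ Real.exp 4 * 2 := by
  have hn := norm_le_of_near_saddleBox hHY hz hw
  have hY0 : 0 < Y := (inv_pos.2 hH).trans_le hHY
  have hsq : ‖w ^ 2‖ ≤ 9 * Y ^ 2 := by
    rw [norm_pow]
    calc ‖w‖ ^ 2 ≤ (3 * Y) ^ 2 := by gcongr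
      _ = 9 * Y ^ 2 := by ring
  rw [blockAmplitude, norm_mul]
  refine mul_le_mul ?_ (norm_hyp2F1_diag_le hp ?_ (by linarith)) (norm_nonneg _) (by positivity)
  · rw [norm_exp, Real.exp_le_exp]
    have hre : |(w.re - a)| ≤ 2 * H⁻¹ := by
      have h1 := abs_re_le_norm (w - z)
      rw [sub_re] at h1
      obtain ⟨h2, h3, -⟩ := hz
      have h4 := abs_le.1 (h1.trans hw)
      rw [abs_le]
      constructor <;> linarith [h4.1, h4.2]
    have : ((H : ℂ) ^ 2 * (w - a) ^ 2).re = H ^ 2 * ((w.re - a) ^ 2 - w.im ^ 2) := by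
      rw [← ofReal_pow, re_ofReal_mul]
      simp [sq]
    rw [this]
    have h5 : (w.re - a) ^ 2 ≤ (2 * H⁻¹) ^ 2 := sq_le_sq' (abs_le.1 hre).1 (abs_le.1 hre).2
    calc H ^ 2 * ((w.re - a) ^ 2 - w.im ^ 2) ≤ H ^ 2 * (2 * H⁻¹) ^ 2 := by
          gcongr
          nlinarith [sq_nonneg w.im]
      _ = 4 := by field_simp; norm_num
  · calc ‖p‖ * ‖w ^ 2‖ ≤ ‖p‖ * (9 * Y ^ 2) := by gcongr
      _ ≤ 1 / 4 := by linarith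

theorem norm_deriv_blockAmplitude_sub_le (hp : 0 < p.re) (hH : 0 < H) (hHY : H⁻¹ ≤ Y) (ha : 0 ≤ a)
    (haH : a ≤ H⁻¹) (hY : 36 * Y ^ 2 ≤ 1) (hpY : ‖p‖ * (36 * Y ^ 2) ≤ 1) {z w : ℂ}
    (hz : z ∈ saddleBox H Y) (hw : w ∈ saddleBox H Y) :
    ‖deriv (blockAmplitude H a p) z - deriv (blockAmplitude H a p) w‖ ≤
      8 * Real.exp 4 * H ^ 2 * ‖z - w‖ := by
  have hY0 : 0 < Y := (inv_pos.2 hH).trans_le hHY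
  have hr : 2 * (H⁻¹ / 2) = H⁻¹ := by ring
  have := norm_deriv_sub_deriv_le_of_bounded (g := blockAmplitude H a p) (convex_saddleBox H Y)
    (r := H⁻¹ / 2) (B := Real.exp 4 * 2) (by positivity) ?_ ?_ hz hw
  · refine this.trans_eq ?_
    field_simp
    ring
  · intro z hz w hw
    rw [hr] at hw
    have h1 := norm_le_of_near_saddleBox hHY hz hw
    refine differentiableAt_blockAmplitude hp (h1.trans_lt ?_)
    nlinarith
  · intro z hz w hw
    rw [hr] at hw
    exact norm_blockAmplitude_le hp hH hHY ha haH hY hpY hz hw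

end

theorem norm_exp_sub_exp_le {A B : ℂ} (h : ‖A - B‖ ≤ 1) :
    ‖cexp A - cexp B‖ ≤ ‖cexp B‖ * (2 * ‖A - B‖) := by
  have : cexp A - cexp B = cexp B * (cexp (A - B) - 1) := by
    rw [mul_sub, ← Complex.exp_add]
    ring_nf
  rw [this, norm_mul]
  gcongr
  exact norm_exp_sub_one_le h

/-- The amplitude at the saddle point `(κ + i t)/T`, for the parameter `p = 1/2 - i t`: the Gaussian
gives `exp (-(t H / T)²)` and the hypergeometric function contributes the correction
`t³ / (2 T²)` to the phase. -/
theorem norm_blockAmplitude_saddle_sub_le {κ H T t : ℝ} (hκ : 0 ≤ κ) (hT : 0 < T) (ht : 1 ≤ t)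
    (h1 : 4 * (κ + 1) ^ 2 * (t * H ^ 2) ≤ T ^ 2) (h2 : 8 * (κ + 1) ^ 2 * t ^ 3 ≤ T ^ 2) :
    ‖blockAmplitude H T⁻¹ (1 / 2 - t * I) ((κ + t * I) / T) -
        cexp ((-(t * H / T) ^ 2 : ℝ)) * cexp ((t ^ 3 / (2 * T ^ 2) : ℝ) * I)‖ ≤
      24 * (κ + 1) ^ 2 * (t * H ^ 2 / T ^ 2 + t⁻¹) := by
  set p : ℂ := 1 / 2 - t * I with hp
  set z : ℂ := (κ + t * I) / T with hz
  set A : ℂ := (H : ℂ) ^ 2 * (z - (T⁻¹ : ℝ)) ^ 2 with hA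
  set A₀ : ℂ := ((-(t * H / T) ^ 2 : ℝ) : ℂ) with hA₀
  set B₀ : ℂ := ((t ^ 3 / (2 * T ^ 2) : ℝ) : ℂ) * I with hB₀
  have ht0 : 0 < t := by linarith
  have hT' : (T : ℂ) ≠ 0 := by exact_mod_cast hT.ne'
  have hpre : 0 < p.re := by rw [hp]; simp
  have hpn : ‖p‖ ≤ 2 * t := by
    calc ‖p‖ ≤ ‖(1 / 2 : ℂ)‖ + ‖(t : ℂ) * I‖ := norm_sub_le _ _
      _ = 1 / 2 + t := by simp [abs_of_pos ht0]
      _ ≤ 2 * t := by linarith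
  have htt : t ^ 2 / T ^ 2 * (8 * (κ + 1) ^ 2 * t) ≤ 1 := by
    rw [div_mul_eq_mul_div, div_le_one (by positivity)]
    linarith
  have hK1 : 1 ≤ (κ + 1) ^ 2 := by nlinarith
  have hzn : ‖z ^ 2‖ ≤ (κ + 1) ^ 2 * (t ^ 2 / T ^ 2) := by
    have : ‖z‖ ≤ (κ + 1) * t / T := by
      rw [hz, norm_div, norm_real, Real.norm_of_nonneg hT.le]
      gcongr
      calc ‖(κ : ℂ) + t * I‖ ≤ ‖(κ : ℂ)‖ + ‖(t : ℂ) * I‖ := norm_add_le _ _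
        _ = κ + t := by simp [abs_of_pos ht0, abs_of_nonneg hκ]
        _ ≤ (κ + 1) * t := by nlinarith
    rw [norm_pow]
    calc ‖z‖ ^ 2 ≤ ((κ + 1) * t / T) ^ 2 := by gcongr
      _ = _ := by ring
  have hu : t ^ 2 / T ^ 2 ≤ t⁻¹ := by
    rw [← one_div, div_le_div_iff₀ (by positivity) ht0]
    nlinarith [pow_pos ht0 3]
  have hu0 : 0 ≤ t ^ 2 / T ^ 2 := by positivity
  have hpz : ‖p‖ * ‖z ^ 2‖ ≤ 1 / 4 := by
    calc ‖p‖ * ‖z ^ 2‖ ≤ 2 * t * ((κ + 1) ^ 2 * (t ^ 2 / T ^ 2)) := by gcongr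
      _ ≤ 1 / 4 := by linarith
  have hz4 : ‖z ^ 2‖ ≤ 1 / 4 := by
    refine hzn.trans ?_
    nlinarith [mul_nonneg (sq_nonneg (κ + 1)) hu0]
  have hsq : ∀ x y : ℝ, ‖(x : ℂ) + y * I‖ ≤ |x| + |y| := fun x y => by
    refine (norm_add_le _ _).trans_eq ?_
    simp
  have hAA : ‖A - A₀‖ ≤ 3 * (κ + 1) ^ 2 * (t * H ^ 2 / T ^ 2) := by
    have : A - A₀ = (H ^ 2 / T ^ 2 : ℝ) * (((κ - 1) ^ 2 : ℝ) + (2 * (κ - 1) * t : ℝ) * I) := by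
      rw [hA, hA₀, hz]
      push_cast
      field_simp
      ring_nf
      rw [I_sq]
      ring
    rw [this, norm_mul, norm_real, Real.norm_of_nonneg (by positivity)]
    calc H ^ 2 / T ^ 2 * ‖(((κ - 1) ^ 2 : ℝ) + (2 * (κ - 1) * t : ℝ) * I : ℂ)‖
        ≤ H ^ 2 / T ^ 2 * (3 * (κ + 1) ^ 2 * t) := by
          gcongr
          refine (hsq _ _).trans ?_
          have h3 : |κ - 1| ≤ κ + 1 := by rw [abs_le]; constructor <;> linarith
          rw [abs_mul, abs_mul, abs_of_pos ht0, abs_of_nonneg (sq_nonneg _), abs_two]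
          have h4 : (κ - 1) ^ 2 ≤ (κ + 1) ^ 2 := by nlinarith
          have h5 : (κ + 1) ≤ (κ + 1) ^ 2 := by nlinarith
          calc (κ - 1) ^ 2 + 2 * |κ - 1| * t ≤ (κ + 1) ^ 2 * t + 2 * (κ + 1) ^ 2 * t := by
                gcongr
                · nlinarith
                · exact h3.trans h5
            _ = _ := by ring
      _ = _ := by ring
  have hAA1 : ‖A - A₀‖ ≤ 1 := by
    refine hAA.trans ?_
    have : t * H ^ 2 / T ^ 2 * (4 * (κ + 1) ^ 2) ≤ 1 := by
      rw [div_mul_eq_mul_div, div_le_one (by positivity)]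
      linarith
    have h0 : 0 ≤ t * H ^ 2 / T ^ 2 * (κ + 1) ^ 2 := by positivity
    linarith
  have hBB : ‖p * z ^ 2 / 2 - B₀‖ ≤ (κ + 1) ^ 2 * (t ^ 2 / T ^ 2) := by
    have : p * z ^ 2 / 2 - B₀ = (1 / (2 * T ^ 2) : ℝ) *
        ((κ ^ 2 / 2 - t ^ 2 / 2 + 2 * κ * t ^ 2 : ℝ) + (κ * t - κ ^ 2 * t : ℝ) * I) := by
      rw [hp, hB₀, hz]
      push_cast
      field_simp
      ring_nf
      simp only [I_sq, show I ^ 3 = -I by rw [pow_succ, I_sq]; ring]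
      ring
    rw [this, norm_mul, norm_real, Real.norm_of_nonneg (by positivity)]
    calc 1 / (2 * T ^ 2) * ‖((κ ^ 2 / 2 - t ^ 2 / 2 + 2 * κ * t ^ 2 : ℝ) +
          (κ * t - κ ^ 2 * t : ℝ) * I : ℂ)‖
        ≤ 1 / (2 * T ^ 2) * (2 * (κ + 1) ^ 2 * t ^ 2) := by
          gcongr
          refine (hsq _ _).trans ?_
          have e1 : t ≤ t ^ 2 := by nlinarith
          have e2 : κ * t ≤ κ * t ^ 2 := by gcongr
          have e3 : κ ^ 2 * t ≤ κ ^ 2 * t ^ 2 := by gcongr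
          have e4 : κ ^ 2 ≤ κ ^ 2 * t ^ 2 := by nlinarith [sq_nonneg κ]
          have e5 : 0 ≤ κ * t := by positivity
          have e6 : 0 ≤ κ ^ 2 * t := by positivity
          have e7 : 0 ≤ κ * t ^ 2 := by positivity
          have e8 : |κ ^ 2 / 2 - t ^ 2 / 2 + 2 * κ * t ^ 2| ≤
              κ ^ 2 * t ^ 2 / 2 + t ^ 2 / 2 + 2 * κ * t ^ 2 := by
            rw [abs_le]
            constructor <;> linarith [sq_nonneg κ, sq_nonneg t]
          have e9 : |κ * t - κ ^ 2 * t| ≤ κ * t ^ 2 + κ ^ 2 * t ^ 2 := by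
            rw [abs_le]
            constructor <;> linarith [sq_nonneg κ]
          have e10 : 2 * (κ + 1) ^ 2 * t ^ 2 = 2 * (κ ^ 2 * t ^ 2) + 4 * (κ * t ^ 2) + 2 * t ^ 2 := by
            ring
          have e11 : 0 ≤ κ ^ 2 * t ^ 2 := by positivity
          linarith [sq_nonneg t]
      _ = _ := by field_simp
  have hBB1 : ‖p * z ^ 2 / 2 - B₀‖ ≤ 1 := by
    refine hBB.trans ?_
    nlinarith [mul_nonneg (sq_nonneg (κ + 1)) hu0]
  have hA₀1 : ‖cexp A₀‖ ≤ 1 := by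
    rw [norm_exp, hA₀, ofReal_re, Real.exp_le_one_iff]
    nlinarith [sq_nonneg (t * H / T)]
  have hB₀1 : ‖cexp B₀‖ = 1 := norm_exp_ofReal_mul_I _
  have hdec : blockAmplitude H T⁻¹ p z - cexp A₀ * cexp B₀ =
      (cexp A - cexp A₀) * hyp2F1 p p (2 * p) (z ^ 2) +
        cexp A₀ * (hyp2F1 p p (2 * p) (z ^ 2) - cexp (p * z ^ 2 / 2)) +
        cexp A₀ * (cexp (p * z ^ 2 / 2) - cexp B₀) := by
    rw [blockAmplitude]
    ring
  rw [hdec]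
  have n1 := norm_exp_sub_exp_le hAA1
  have n2 := norm_hyp2F1_diag_le hpre hpz hz4
  have n3 := norm_hyp2F1_diag_sub_exp_le hpre hpz hz4
  have n4 := norm_exp_sub_exp_le hBB1
  rw [hB₀1, one_mul] at n4
  calc _ ≤ ‖cexp A - cexp A₀‖ * ‖hyp2F1 p p (2 * p) (z ^ 2)‖ +
        ‖cexp A₀‖ * ‖hyp2F1 p p (2 * p) (z ^ 2) - cexp (p * z ^ 2 / 2)‖ +
        ‖cexp A₀‖ * ‖cexp (p * z ^ 2 / 2) - cexp B₀‖ := by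
        simp only [← norm_mul]
        exact norm_add₃_le
    _ ≤ 1 * (2 * (3 * (κ + 1) ^ 2 * (t * H ^ 2 / T ^ 2))) * 2 +
        1 * (22 * ((κ + 1) ^ 2 * (t ^ 2 / T ^ 2))) + 1 * (2 * ((κ + 1) ^ 2 * (t ^ 2 / T ^ 2))) := by
        gcongr
        · exact n1.trans (by gcongr)
        · exact n3.trans (by gcongr)
        · exact n4.trans (by gcongr)
    _ = 12 * (κ + 1) ^ 2 * (t * H ^ 2 / T ^ 2) + 24 * (κ + 1) ^ 2 * (t ^ 2 / T ^ 2) := by ring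
    _ ≤ 24 * (κ + 1) ^ 2 * (t * H ^ 2 / T ^ 2) + 24 * (κ + 1) ^ 2 * t⁻¹ := by
        gcongr
        norm_num
    _ = _ := by ring

/-! ### The constant in the main term -/

/-- Shifting `Γ(1/2 + 2it)` by `n` multiplies it by `(2it)ⁿ`, up to a factor `1 + O(1/t)`. -/
theorem exists_Gamma_add_nat_eq (n : ℕ) : ∃ C : ℝ, 0 ≤ C ∧ ∀ t : ℝ, 1 ≤ t → ∃ P : ℂ,
    Gamma (1 / 2 + 2 * t * I + n) = (2 * t * I) ^ n * P * Gamma (1 / 2 + 2 * t * I) ∧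
      1 ≤ ‖P‖ ∧ ‖P - 1‖ ≤ C * t⁻¹ := by
  induction n with
  | zero => exact ⟨0, le_rfl, fun t _ => ⟨1, by simp, by simp, by simp⟩⟩
  | succ n ih =>
    obtain ⟨C, hC0, hC⟩ := ih
    have hn : (0 : ℝ) ≤ n := Nat.cast_nonneg n
    refine ⟨C * (n + 2) + (n + 1), by positivity, fun t ht => ?_⟩
    obtain ⟨P, h1, h2, h3⟩ := hC t ht
    have ht0 : 0 < t := by linarith
    have ht' : (t : ℂ) ≠ 0 := by exact_mod_cast ht0.ne'
    have hti : t⁻¹ ≤ 1 := inv_le_one_of_one_le₀ ht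
    set u : ℂ := ((-((n + 1 / 2) / (2 * t)) : ℝ) : ℂ) * I with hu
    have hun : ‖u‖ ≤ (n + 1) * t⁻¹ := by
      rw [hu, norm_mul, norm_I, mul_one, norm_real, norm_neg, Real.norm_of_nonneg (by positivity),
        ← div_eq_mul_inv, div_le_div_iff₀ (by positivity) ht0]
      nlinarith
    have hu1 : 1 ≤ ‖1 + u‖ := by
      have := re_le_norm (1 + u)
      rwa [add_re, hu, re_ofReal_mul, I_re, mul_zero, add_zero, one_re, ← hu] at this
    have hw : 1 / 2 + 2 * t * I + n ≠ 0 := by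
      intro h
      have := congrArg re h
      simp at this
      linarith
    refine ⟨P * (1 + u), ?_, ?_, ?_⟩
    · rw [Nat.cast_succ, ← add_assoc, Gamma_add_one _ hw, h1, hu]
      have : 1 / 2 + 2 * t * I + n = 2 * t * I * (1 + ((-((n + 1 / 2) / (2 * t)) : ℝ) : ℂ) * I) := by
        push_cast
        field_simp
        ring_nf
        rw [I_sq]
        ring
      rw [this]
      ring
    · rw [norm_mul]
      exact one_le_mul_of_one_le_of_one_le h2 hu1
    · have : P * (1 + u) - 1 = (P - 1) * (1 + u) + u := by ring
      rw [this]
      have hu2 : ‖1 + u‖ ≤ n + 2 := by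
        refine (norm_add_le _ _).trans ?_
        rw [norm_one]
        nlinarith
      calc ‖(P - 1) * (1 + u) + u‖ ≤ ‖P - 1‖ * ‖1 + u‖ + ‖u‖ := by
            rw [← norm_mul]; exact norm_add_le _ _
        _ ≤ C * t⁻¹ * (n + 2) + (n + 1) * t⁻¹ := by gcongr
        _ = _ := by ring

theorem log_ofReal_mul_I {t : ℝ} (ht : 0 < t) :
    log ((t : ℂ) * I) = Real.log t + Real.pi / 2 * I := by
  rw [log_ofReal_mul ht I_ne_zero, log_I]

theorem log_neg_ofReal_mul_I {t : ℝ} (ht : 0 < t) :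
    log (((-t : ℝ) : ℂ) * I) = Real.log t - Real.pi / 2 * I := by
  rw [show ((-t : ℝ) : ℂ) * I = t * (-I) by push_cast; ring,
    log_ofReal_mul ht (neg_ne_zero.2 I_ne_zero), log_neg_I]
  ring

/-- Stirling's formula for the Gamma factor `Γ(p)² / Γ(2p)` with `p = 1/2 - i t`. -/
theorem exists_Gamma_sq_div_Gamma_two_mul_eq {t : ℝ} (ht : 1 ≤ t) : ∃ l : ℂ,
    Gamma (1 / 2 - t * I) ^ 2 / Gamma (2 * (1 / 2 - t * I)) =
      (√(2 * Real.pi) : ℝ) * ((2 * t) ^ (-(1 / 2) : ℝ) : ℝ) *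
        cexp (Real.pi / 4 * I + 2 * t * Real.log 2 * I + l) ∧ ‖l‖ ≤ 65 * t⁻¹ := by
  have ht0 : 0 < t := by linarith
  obtain ⟨l₁, h1, h1'⟩ := exists_Gamma_eq_stirling (c := 1 / 2) (τ := -t) le_rfl (by norm_num)
    (by rw [abs_neg, abs_of_pos ht0]; linarith)
  obtain ⟨l₂, h2, h2'⟩ := exists_Gamma_eq_stirling (c := 1) (τ := -(2 * t)) (by norm_num) le_rfl
    (by rw [abs_neg, abs_of_pos (by positivity)]; linarith)
  rw [abs_neg, abs_of_pos ht0] at h1'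
  rw [abs_neg, abs_of_pos (by positivity)] at h2'
  refine ⟨2 * l₁ - l₂, ?_, ?_⟩
  · rw [log_neg_ofReal_mul_I ht0] at h1
    rw [log_neg_ofReal_mul_I (by positivity), Real.log_mul two_ne_zero ht0.ne'] at h2
    rw [show (1 / 2 - t * I : ℂ) = ((1 / 2 : ℝ) : ℂ) + (-t : ℝ) * I by push_cast; ring, h1,
      show 2 * (((1 / 2 : ℝ) : ℂ) + (-t : ℝ) * I) = ((1 : ℝ) : ℂ) + (-(2 * t) : ℝ) * I by
        push_cast; ring, h2, Real.rpow_def_of_pos (by positivity),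
      Real.log_mul two_ne_zero ht0.ne', ofReal_exp]
    have hs : ((√(2 * Real.pi) : ℝ) : ℂ) ≠ 0 := by
      exact_mod_cast (Real.sqrt_pos.2 (by positivity)).ne'
    rw [mul_pow, ← Complex.exp_nat_mul, div_eq_iff (mul_ne_zero hs (Complex.exp_ne_zero _))]
    rw [show ∀ a b c d : ℂ, a * b * c * (a * d) = a ^ 2 * (b * c * d) by intros; ring]
    rw [← Complex.exp_add, ← Complex.exp_add]
    congr 2
    push_cast
    ring_nf
  · calc ‖2 * l₁ - l₂‖ ≤ 2 * ‖l₁‖ + ‖l₂‖ := by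
          refine (norm_sub_le _ _).trans_eq ?_
          simp
      _ ≤ 2 * (26 / t) + 26 / (2 * t) := by gcongr
      _ = _ := by field_simp; norm_num

theorem exists_norm_Gamma_sq_div_Gamma_two_mul_le : ∃ C : ℝ, 0 ≤ C ∧ ∀ t : ℝ, 1 ≤ t →
    ‖Gamma (1 / 2 - t * I) ^ 2 / Gamma (2 * (1 / 2 - t * I))‖ ≤ C * t ^ (-(1 / 2) : ℝ) := by
  refine ⟨√(2 * Real.pi) * Real.exp 65, by positivity, fun t ht => ?_⟩
  have ht0 : 0 < t := by linarith
  obtain ⟨l, h, hl⟩ := exists_Gamma_sq_div_Gamma_two_mul_eq ht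
  rw [h, norm_mul, norm_mul, norm_real, norm_real, Real.norm_of_nonneg (by positivity),
    Real.norm_of_nonneg (by positivity), norm_exp]
  have h1 : (2 * t) ^ (-(1 / 2) : ℝ) ≤ t ^ (-(1 / 2) : ℝ) :=
    Real.rpow_le_rpow_of_nonpos ht0 (by linarith) (by norm_num)
  have h2 : (Real.pi / 4 * I + 2 * t * Real.log 2 * I + l).re ≤ 65 := by
    have : (Real.pi / 4 * I + 2 * t * Real.log 2 * I + l).re = l.re := by
      rw [show (Real.pi / 4 * I + 2 * t * Real.log 2 * I + l : ℂ) =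
        ((Real.pi / 4 + 2 * t * Real.log 2 : ℝ) : ℂ) * I + l by push_cast; ring, add_re,
        re_ofReal_mul, I_re, mul_zero, zero_add]
    rw [this]
    refine (re_le_norm l).trans (hl.trans ?_)
    nlinarith [inv_le_one_of_one_le₀ ht]
  calc _ ≤ √(2 * Real.pi) * t ^ (-(1 / 2) : ℝ) * Real.exp 65 := by gcongr
    _ = _ := by ring

theorem norm_exp_sub_one_le_mul_exp (x : ℂ) : ‖cexp x - 1‖ ≤ ‖x‖ * Real.exp ‖x‖ := by
  have := norm_exp_sub_sum_le_norm_mul_exp x 1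
  simpa using this

/-- The constant by which the `x`-Laplace integral with exponent `q = 4k - 3/2 + 2it` enters the
averaged block: the `coth` of the connection formula, the Gamma factor of Euler's integral, the
normalization of the block and the value `2π (2T)^(q-1) / Γ(q)` of the Laplace integral. -/
noncomputable def blockConst (k : ℕ) (T t : ℝ) : ℂ :=
  -(I * ((Real.cosh (Real.pi * t) / Real.sinh (Real.pi * t) : ℝ) : ℂ) / (2 * Real.pi)) *
    (Gamma (1 / 2 - t * I) ^ 2 / Gamma (2 * (1 / 2 - t * I))) *
    ((T ^ (-4 * (k : ℝ) + 5 / 2) * (t ^ (4 * (k : ℤ) - 2) * Real.exp (-Real.pi * t)) : ℝ) : ℂ) *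
    (2 * Real.pi * ((2 * T : ℝ) : ℂ) ^ (4 * (k : ℂ) - 3 / 2 + 2 * t * I - 1) /
      Gamma (4 * (k : ℂ) - 3 / 2 + 2 * t * I))

/-- Stirling's formula for `blockConst`: the powers of `T` and `t` and the exponentials cancel, up
to `t ^ (-1/2)` and a phase. -/
theorem exists_norm_blockConst_sub_le {k : ℕ} (hk : 1 ≤ k) : ∃ C : ℝ, 0 ≤ C ∧ ∀ T t : ℝ, 0 < T →
    1 < t → ‖blockConst k T t - ((1 / 2 * t ^ (-(1 / 2) : ℝ) : ℝ) : ℂ) *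
      cexp ((3 * Real.pi / 4 + 2 * t * (1 + Real.log 2 - Real.log (t / T)) : ℝ) * I)‖ ≤
        C * (t ^ (-(1 / 2) : ℝ) * t⁻¹) := by
  obtain ⟨C, hC0, hC⟩ := exists_Gamma_add_nat_eq (4 * k - 2)
  refine ⟨(78 * Real.exp 78 * 2 + (1 + C)), by positivity, fun T t hT ht => ?_⟩
  have ht0 : 0 < t := by linarith
  have hti : t⁻¹ ≤ 1 := inv_le_one_of_one_le₀ ht.le
  obtain ⟨P, hP, hP1, hPC⟩ := hC t ht.le
  obtain ⟨l₁, h1, h1'⟩ := exists_Gamma_sq_div_Gamma_two_mul_eq ht.le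
  obtain ⟨l₂, h2, h2'⟩ := exists_Gamma_eq_stirling (c := 1 / 2) (τ := 2 * t) le_rfl (by norm_num)
    (by rw [abs_of_pos (by positivity)]; linarith)
  rw [abs_of_pos (by positivity)] at h2'
  rw [log_ofReal_mul_I (by positivity)] at h2
  set c : ℝ := Real.cosh (Real.pi * t) / Real.sinh (Real.pi * t) with hc
  obtain ⟨hc0, hc1⟩ := coth_pi_sub_one_bounds ht
  rw [← hc] at hc0 hc1
  -- Stirling's formula makes every factor an exponential; the exponents add up exactly
  have hkey : blockConst k T t = ((1 / 2 * t ^ (-(1 / 2) : ℝ) : ℝ) : ℂ) *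
      cexp ((3 * Real.pi / 4 + 2 * t * (1 + Real.log 2 - Real.log (t / T)) : ℝ) * I) *
        (c * cexp (l₁ - l₂) / P) := by
    obtain ⟨m, rfl⟩ : ∃ m, k = m + 1 := ⟨k - 1, by omega⟩
    rw [show 4 * (m + 1) - 2 = 4 * m + 2 by omega] at hP
    -- the sign `i^(4k-2) = -1` turns `-i` into `i`, hence the phase `3π/4` instead of `-π/4`
    have hI : I ^ (4 * m + 2) = -1 := by rw [pow_add, pow_mul, I_pow_four, one_pow, I_sq, one_mul]
    have hq : 4 * ((m + 1 : ℕ) : ℂ) - 3 / 2 + 2 * t * I = 1 / 2 + 2 * t * I + (4 * m + 2 : ℕ) := by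
      push_cast; ring
    have hz : t ^ (4 * ((m + 1 : ℕ) : ℤ) - 2) = Real.exp ((4 * m + 2) * Real.log t) := by
      rw [show 4 * ((m + 1 : ℕ) : ℤ) - 2 = ((4 * m + 2 : ℕ) : ℤ) by push_cast; ring, zpow_natCast,
        ← Real.exp_log (pow_pos ht0 (4 * m + 2)), Real.log_pow]
      push_cast
      rfl
    have hz2 : (2 * t * I : ℂ) ^ (4 * m + 2) =
        -cexp ((4 * m + 2) * (Real.log 2 + Real.log t)) := by
      have h3 : (2 * t : ℝ) ^ (4 * m + 2) =
          Real.exp ((4 * m + 2) * (Real.log 2 + Real.log t)) := by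
        rw [← Real.log_mul two_ne_zero ht0.ne', ← Real.exp_log (pow_pos (by positivity) (4 * m + 2)),
          Real.log_pow]
        push_cast
        rfl
      rw [mul_pow, hI, mul_neg_one, ← ofReal_ofNat, ← ofReal_mul, ← ofReal_pow, h3, ofReal_exp]
      push_cast
      rfl
    have hs : ((√(2 * Real.pi) : ℝ) : ℂ) ≠ 0 := by
      exact_mod_cast (Real.sqrt_pos.2 (by positivity)).ne'
    have hP0 : P ≠ 0 := norm_pos_iff.1 (by linarith)
    have hpi : (Real.pi : ℂ) ≠ 0 := by exact_mod_cast Real.pi_ne_zero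
    have h2' : Gamma (1 / 2 + 2 * t * I) = (√(2 * Real.pi) : ℝ) *
        cexp (2 * t * I * (Real.log 2 + Real.log t + Real.pi / 2 * I) - 2 * t * I + l₂) := by
      rw [Real.log_mul two_ne_zero ht0.ne'] at h2
      rw [show (1 / 2 + 2 * t * I : ℂ) = ((1 / 2 : ℝ) : ℂ) + (2 * t : ℝ) * I by push_cast; ring, h2]
      congr 2
      push_cast
      ring
    have hlog : Real.log (t / T) = Real.log t - Real.log T := Real.log_div ht0.ne' hT.ne'
    have hhalf : 1 / 2 * t ^ (-(1 / 2) : ℝ) =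
        Real.exp (-Real.log 2 + Real.log t * (-(1 / 2))) := by
      rw [Real.exp_add, Real.exp_neg, Real.exp_log two_pos, one_div, Real.rpow_def_of_pos ht0]
    have hthree : cexp ((3 * Real.pi / 4 + 2 * t * (1 + Real.log 2 - Real.log (t / T)) : ℝ) * I) =
        I * cexp ((Real.pi / 4 + 2 * t * (1 + Real.log 2 - Real.log (t / T)) : ℝ) * I) := by
      nth_rewrite 2 [← exp_pi_div_two_mul_I]
      rw [← Complex.exp_add]
      congr 1
      push_cast
      ring
    rw [hhalf, blockConst, h1, hq, hP, hz2, h2', hthree, hz, hlog, ← hc,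
      ofReal_cpow_eq_exp (x := 2 * T) (by positivity), Real.log_mul two_ne_zero hT.ne',
      Real.rpow_def_of_pos hT, Real.rpow_def_of_pos (by positivity : 0 < 2 * t),
      Real.log_mul two_ne_zero ht0.ne', ← Real.exp_add, ← Real.exp_add,
      ofReal_exp, ofReal_exp, ofReal_exp]
    have halg : ∀ s c P E₁ E₂ E₃ E₄ F₁ F₂ : ℂ, s ≠ 0 → P ≠ 0 → F₁ ≠ 0 → F₂ ≠ 0 →
        -(I * c / (2 * Real.pi)) * (s * E₁ * E₂) * E₃ *
          (2 * Real.pi * E₄ / (-F₁ * P * (s * F₂))) =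
        I * (c / P) * (E₁ * E₂ * E₃ * E₄ * F₁⁻¹ * F₂⁻¹) := by
      intro s c P E₁ E₂ E₃ E₄ F₁ F₂ hs hP hF₁ hF₂
      field_simp
    rw [halg _ _ _ _ _ _ _ _ _ hs hP0 (Complex.exp_ne_zero _) (Complex.exp_ne_zero _)]
    have halg2 : ∀ a b d e : ℂ, a * (I * b) * (c * d / e) = I * (c / e) * (a * b * d) := by
      intros; ring
    rw [halg2]
    simp only [← Complex.exp_neg, ← Complex.exp_add]
    congr 2
    push_cast
    ring_nf
    simp only [I_sq]
    ring_nf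
  rw [hkey, ← mul_sub_one, norm_mul, norm_mul, norm_exp_ofReal_mul_I, mul_one, norm_real,
    Real.norm_of_nonneg (by positivity)]
  have hl : ‖l₁ - l₂‖ ≤ 78 * t⁻¹ := by
    calc ‖l₁ - l₂‖ ≤ 65 * t⁻¹ + 26 / (2 * t) := (norm_sub_le _ _).trans (add_le_add h1' h2')
      _ = _ := by field_simp; norm_num
  have hE : ‖cexp (l₁ - l₂) - 1‖ ≤ 78 * Real.exp 78 * t⁻¹ := by
    refine (norm_exp_sub_one_le_mul_exp _).trans ?_
    have : Real.exp ‖l₁ - l₂‖ ≤ Real.exp 78 := Real.exp_le_exp.2 (hl.trans (by linarith))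
    calc _ ≤ 78 * t⁻¹ * Real.exp 78 := by gcongr
      _ = _ := by ring
  have hP0 : P ≠ 0 := norm_pos_iff.1 (by linarith)
  have hcP : (c * cexp (l₁ - l₂) / P - 1) =
      ((cexp (l₁ - l₂) - 1) * c + (((c - 1 : ℝ) : ℂ) - (P - 1))) / P := by
    push_cast
    field_simp
    ring
  have hcn : ‖(c : ℂ)‖ ≤ 2 := by
    rw [norm_real, Real.norm_of_nonneg (by linarith)]
    rw [one_div] at hc1
    linarith
  have hfin : ‖c * cexp (l₁ - l₂) / P - 1‖ ≤ (78 * Real.exp 78 * 2 + (1 + C)) * t⁻¹ := by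
    rw [hcP, norm_div]
    refine (div_le_self (norm_nonneg _) hP1).trans ?_
    calc _ ≤ ‖cexp (l₁ - l₂) - 1‖ * ‖(c : ℂ)‖ + (‖((c - 1 : ℝ) : ℂ)‖ + ‖P - 1‖) := by
          rw [← norm_mul]
          exact (norm_add_le _ _).trans (add_le_add le_rfl (norm_sub_le _ _))
      _ ≤ 78 * Real.exp 78 * t⁻¹ * 2 + (t⁻¹ + C * t⁻¹) := by
          gcongr
          rw [norm_real, Real.norm_of_nonneg hc0, ← one_div]
          exact hc1
      _ = _ := by ring
  calc 1 / 2 * t ^ (-(1 / 2) : ℝ) * ‖c * cexp (l₁ - l₂) / P - 1‖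
      ≤ 1 * t ^ (-(1 / 2) : ℝ) * ((78 * Real.exp 78 * 2 + (1 + C)) * t⁻¹) := by
        gcongr
        norm_num
    _ = _ := by ring

/-! ### The averaged block as twice the real part of a Laplace integral -/

theorem intervalIntegral_conj_eq (f : ℝ → ℂ) (a b : ℝ) :
    ∫ y in a..b, (starRingEnd ℂ) (f y) = (starRingEnd ℂ) (∫ y in a..b, f y) := by
  simp only [intervalIntegral, integral_conj, map_sub]

theorem conj_cpow_conj {z : ℂ} (hz : z ∈ slitPlane) (w : ℂ) :
    (starRingEnd ℂ) ((starRingEnd ℂ) z ^ (starRingEnd ℂ) w) = z ^ w := by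
  rw [← cpow_conj _ _ (mem_slitPlane_iff_arg.1 hz).1, conj_conj]

theorem conj_eulerJ_conj {s w : ℂ} (hw : w ∈ hypDomain) :
    (starRingEnd ℂ) (eulerJ ((starRingEnd ℂ) s) ((starRingEnd ℂ) w)) = eulerJ s w := by
  rw [eulerJ, eulerJ, ← intervalIntegral_conj_eq]
  refine intervalIntegral.integral_congr fun y hy => ?_
  rw [uIcc_of_le zero_le_one] at hy
  have h1 := conj_ofReal_cpow hy.1 (s - 1)
  have h2 := conj_ofReal_cpow (x := 1 - y) (by linarith [hy.2]) (s - 1)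
  have h3 := conj_cpow_conj (one_sub_mem_slitPlane_of_mem_hypDomain hw hy.1 hy.2) (-s)
  simp only [map_sub, map_one, map_mul, map_neg, conj_ofReal, ofReal_sub, ofReal_one] at h1 h2 h3 ⊢
  rw [h3]
  congr 2
  · rw [← h1, conj_conj]
  · rw [← h2, conj_conj]

/-- The half of the connection formula whose integral has a saddle point near the line of
integration, for the block at `s = 1/2 + i t`. -/
noncomputable def blockHalf (t : ℝ) (z : ℂ) : ℂ :=
  -(I * ((Real.cosh (Real.pi * t) / Real.sinh (Real.pi * t) : ℝ) : ℂ) / (2 * Real.pi)) *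
    (z ^ (1 - 2 * t * I) * eulerJ (1 / 2 - t * I) (z ^ 2))

/-- On the critical line the two halves of the connection formula are conjugate to each other. -/
theorem blockH_eq_blockHalf_add_conj {t : ℝ} (ht : 0 < t) {z : ℂ} (hz : 0 < z.re) (hz1 : ‖z‖ < 1) :
    blockH (1 / 2 + I * t) (1 - (z ^ 2)⁻¹) =
      blockHalf t z + (starRingEnd ℂ) (blockHalf t ((starRingEnd ℂ) z)) := by
  have hz2 : z ^ 2 ∈ hypDomain := by
    refine mem_hypDomain_of_norm_lt_one ?_
    rw [norm_pow]
    exact pow_lt_one₀ (norm_nonneg _) hz1 two_ne_zero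
  have hzs : z ∈ slitPlane := Or.inl hz
  rw [blockH_connection (by simp) (cos_pi_ne_zero ht) hz hz1, sin_pi_div_cos_pi]
  simp only [blockHalf]
  have h1 := conj_cpow_conj hzs (1 + 2 * t * I)
  have h2 := conj_eulerJ_conj (s := 1 / 2 + t * I) hz2
  simp only [map_add, map_one, map_mul, map_neg, conj_ofReal, conj_I, map_ofNat, map_div₀,
    map_pow] at h1 h2 ⊢
  rw [show (1 : ℂ) - 2 * t * I = 1 + 2 * t * -I by ring,
    show (1 / 2 : ℂ) - t * I = 1 / 2 + t * -I by ring, h1, h2]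
  rw [show 2 * (1 / 2 + I * (t : ℂ)) = 1 + 2 * t * I by ring,
    show (1 / 2 : ℂ) + I * t = 1 / 2 + t * I by ring,
    show 2 - (1 + 2 * (t : ℂ) * I) = 1 + 2 * t * -I by ring,
    show 1 - (1 / 2 + (t : ℂ) * I) = 1 / 2 + t * -I by ring]
  ring

theorem conj_vline (a y : ℝ) : (starRingEnd ℂ) (vline a y) = vline a (-y) := by
  simp [vline]

/-- The Laplace integrand with the amplitude of the block. -/
noncomputable def blockIntegrand (k : ℕ) (H T t y : ℝ) : ℂ :=
  blockAmplitude H T⁻¹ (1 / 2 - t * I) (vline T⁻¹ y) *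
    (cexp ((2 * T : ℝ) * vline T⁻¹ y) * vline T⁻¹ y ^ (-(4 * (k : ℂ) - 3 / 2 + 2 * t * I)))

/-- The constant in front of `blockIntegrand`, except for the powers of `T` and `t`. -/
noncomputable def halfConst (t : ℝ) : ℂ :=
  -(I * ((Real.cosh (Real.pi * t) / Real.sinh (Real.pi * t) : ℝ) : ℂ) / (2 * Real.pi)) *
    (Gamma (1 / 2 - t * I) ^ 2 / Gamma (2 * (1 / 2 - t * I)))

/-- On the line `re z = 1/T` one has `-(H y)² = H² (z - 1/T)²` and `2iTy = 2Tz - 2`. -/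
theorem weight_mul_blockHalf {k : ℕ} {H T t y : ℝ} (hT : 0 < T) (hz1 : ‖vline T⁻¹ y‖ < 1) :
    (Real.exp (-(H * y) ^ 2) : ℂ) * cexp (2 * I * T * y) *
        vline T⁻¹ y ^ (-4 * (k : ℂ) + 1 / 2) * blockHalf t (vline T⁻¹ y) =
      (Real.exp (-2) : ℂ) * halfConst t * blockIntegrand k H T t y := by
  have hT' : (T : ℂ) ≠ 0 := by exact_mod_cast hT.ne'
  have hz0 := vline_ne_zero (inv_pos.2 hT) y
  have hz2 : vline T⁻¹ y ^ 2 ∈ hypDomain := by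
    refine mem_hypDomain_of_norm_lt_one ?_
    rw [norm_pow]
    exact pow_lt_one₀ (norm_nonneg _) hz1 two_ne_zero
  have hw : (Real.exp (-(H * y) ^ 2) : ℂ) =
      cexp ((H : ℂ) ^ 2 * (vline T⁻¹ y - (T⁻¹ : ℝ)) ^ 2) := by
    rw [ofReal_exp, vline]
    congr 1
    push_cast
    ring_nf
    rw [I_sq]
    ring
  have he : cexp (2 * I * T * y) = (Real.exp (-2) : ℂ) * cexp ((2 * T : ℝ) * vline T⁻¹ y) := by
    rw [ofReal_exp, ← Complex.exp_add, vline]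
    congr 1
    push_cast
    field_simp
    ring
  have hpow : vline T⁻¹ y ^ (-4 * (k : ℂ) + 1 / 2) * vline T⁻¹ y ^ (1 - 2 * t * I) =
      vline T⁻¹ y ^ (-(4 * (k : ℂ) - 3 / 2 + 2 * t * I)) := by
    rw [← cpow_add _ _ hz0]
    congr 1
    ring
  rw [blockHalf, eulerJ_eq_hyp2F1 (by simp) hz2, hw, he, blockIntegrand, ← hpow, halfConst,
    blockAmplitude]
  ring

theorem continuousOn_blockIntegrand {k : ℕ} {H T t : ℝ} (hT : 0 < T) {S : Set ℝ}
    (hS : ∀ y ∈ S, ‖vline T⁻¹ y‖ < 1) : ContinuousOn (blockIntegrand k H T t) S := by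
  intro y hy
  refine ContinuousAt.continuousWithinAt ?_
  refine ContinuousAt.mul ?_ (continuous_laplace_vline (inv_pos.2 hT) _ _).continuousAt
  exact ContinuousAt.comp
    (differentiableAt_blockAmplitude (by simp) (hS y hy)).continuousAt
    (continuous_vline _).continuousAt

theorem linePoint_eq_vline (T y : ℝ) : linePoint T y = vline T⁻¹ y := by
  rw [linePoint, vline, mul_comm]

/-- The averaged block on the critical line is twice the real part of a Laplace integral. -/
theorem WCheck_eq_two_mul_re {k : ℕ} {ε T t : ℝ} (hT : 0 < T) (ht : 1 < t)
    (hline : ∀ y, |y| ≤ T ^ ε / windowH ε T → ‖vline T⁻¹ y‖ < 1) :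
    WCheck k ε T (1 / 2 + I * t) =
      ((2 * (((Real.exp (-2) * windowH ε T : ℝ) : ℂ) * (halfConst t *
        ((T ^ (-4 * (k : ℝ) + 5 / 2) * (t ^ (4 * (k : ℤ) - 2) * Real.exp (-Real.pi * t)) : ℝ) : ℂ) *
        ∫ y in (-(T ^ ε / windowH ε T))..(T ^ ε / windowH ε T),
          blockIntegrand k (windowH ε T) T t y)).re : ℝ) : ℂ) := by
  set H := windowH ε T with hH
  set Y := T ^ ε / H with hYdef
  have hH0 : 0 < H := Real.rpow_pos_of_pos hT _
  have hY : 0 < Y := div_pos (Real.rpow_pos_of_pos hT _) hH0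
  set P : ℝ := t ^ (4 * (k : ℤ) - 2) * Real.exp (-Real.pi * t) with hP
  set U : ℝ → ℂ := fun y => (Real.exp (-2) : ℂ) * halfConst t * blockIntegrand k H T t y with hU
  have huIcc : ∀ y ∈ uIcc (-Y) Y, |y| ≤ Y := by
    intro y hy
    rw [uIcc_of_le (by linarith)] at hy
    exact abs_le.2 hy
  have hUc : ContinuousOn U (uIcc (-Y) Y) :=
    continuousOn_const.mul (continuousOn_blockIntegrand hT fun y hy => hline y (huIcc y hy))
  have hUc' : ContinuousOn (fun y => (starRingEnd ℂ) (U (-y))) (uIcc (-Y) Y) := by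
    refine continuous_conj.comp_continuousOn (hUc.comp continuous_neg.continuousOn ?_)
    intro y hy
    rw [uIcc_of_le (by linarith)] at hy ⊢
    exact ⟨by linarith [hy.2], by linarith [hy.1]⟩
  have hpt : ∀ y, |y| ≤ Y → (Real.exp (-(H * y) ^ 2) : ℂ) * cexp (2 * I * T * y) *
      linePoint T y ^ (-4 * (k : ℂ) + 1 / 2) *
        blockHTilde k (1 / 2 + I * t) (1 - (linePoint T y ^ 2)⁻¹) =
      P * (U y + (starRingEnd ℂ) (U (-y))) := by
    intro y hy
    have h1 := hline y hy
    have h2 := hline (-y) (by rwa [abs_neg])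
    have him : (1 / 2 + I * (t : ℂ)).im = t := by simp
    have e1 := weight_mul_blockHalf (k := k) (H := H) (t := t) hT h1
    have e2 := weight_mul_blockHalf (k := k) (H := H) (t := t) hT h2
    have e3 : (starRingEnd ℂ) ((Real.exp (-(H * -y) ^ 2) : ℂ) * cexp (2 * I * T * (-y : ℝ)) *
        vline T⁻¹ (-y) ^ (-4 * (k : ℂ) + 1 / 2)) = (Real.exp (-(H * y) ^ 2) : ℂ) *
          cexp (2 * I * T * y) * vline T⁻¹ y ^ (-4 * (k : ℂ) + 1 / 2) := by
      have h3 := conj_cpow_conj (z := vline T⁻¹ y) (Or.inl (by simpa using hT))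
        (-4 * (k : ℂ) + 1 / 2)
      rw [conj_vline] at h3
      rw [map_mul, map_mul, conj_ofReal, ← Complex.exp_conj]
      congr 1
      · congr 2
        · rw [mul_neg, neg_sq]
        · simp [Complex.conj_ofNat]
      · rw [← h3]
        simp [Complex.conj_ofNat]
    rw [linePoint_eq_vline, blockHTilde, him, if_neg (by linarith), ← hP,
      blockH_eq_blockHalf_add_conj (by linarith) (by simpa using hT) h1, hU]
    simp only
    rw [← e1, ← e2, map_mul, e3, conj_vline]
    ring
  have hint : ∫ y in (-Y)..Y, (Real.exp (-(H * y) ^ 2) : ℂ) * cexp (2 * I * T * y) *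
      linePoint T y ^ (-4 * (k : ℂ) + 1 / 2) *
        blockHTilde k (1 / 2 + I * t) (1 - (linePoint T y ^ 2)⁻¹) =
      P * ((∫ y in (-Y)..Y, U y) + (starRingEnd ℂ) (∫ y in (-Y)..Y, U y)) := by
    rw [intervalIntegral.integral_congr fun y hy => hpt y (huIcc y hy),
      intervalIntegral.integral_const_mul,
      intervalIntegral.integral_add hUc.intervalIntegrable hUc'.intervalIntegrable,
      intervalIntegral.integral_comp_neg (fun y => (starRingEnd ℂ) (U y)), neg_neg,
      intervalIntegral_conj_eq]
  rw [WCheck, ← hH, ← hYdef, hint, add_conj, hU, intervalIntegral.integral_const_mul]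
  set J := ∫ y in (-Y)..Y, blockIntegrand k H T t y
  rw [← ofReal_mul, ← ofReal_mul]
  congr 1
  have hre : ∀ a : ℝ, (((Real.exp (-2) * H : ℝ) : ℂ) * (halfConst t * ((a * P : ℝ) : ℂ) * J)).re =
      a * H * P * ((Real.exp (-2) : ℂ) * halfConst t * J).re := by
    intro a
    rw [← re_ofReal_mul]
    congr 1
    push_cast
    ring
  rw [hre]
  ring

/-! ### The error of the saddle point approximation -/

/-- The prefactor of the block times the mass `(2t/T)^(1-m)`, with `m = 4k - 5/2`, of the Laplace
integrand. -/
theorem saddle_weight_le {k : ℕ} (hk : 1 ≤ k) {T t : ℝ} (hT : 0 < T) (ht : 0 < t) :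
    t ^ (-(1 / 2) : ℝ) * (T ^ (-4 * (k : ℝ) + 5 / 2) * t ^ (4 * (k : ℤ) - 2)) *
      ((2 * T)⁻¹ * (2 * t / T) ^ (1 - (4 * (k : ℝ) - 5 / 2))) ≤ t / T ^ 2 := by
  have hk' : (1 : ℝ) ≤ k := by exact_mod_cast hk
  have hz : t ^ (4 * (k : ℤ) - 2) = t ^ (4 * (k : ℝ) - 2) := by
    rw [← Real.rpow_intCast]; push_cast; rfl
  have h1 : t / T ^ 2 = Real.exp (Real.log t - 2 * Real.log T) := by
    rw [Real.exp_sub, Real.exp_log ht, two_mul, Real.exp_add, Real.exp_log hT, sq]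
  have h2 : (2 * T)⁻¹ = Real.exp (-(Real.log 2 + Real.log T)) := by
    rw [Real.exp_neg, Real.exp_add, Real.exp_log hT, Real.exp_log two_pos]
  rw [hz, h1, h2, Real.rpow_def_of_pos ht, Real.rpow_def_of_pos ht, Real.rpow_def_of_pos hT,
    Real.rpow_def_of_pos (by positivity), Real.log_div (by positivity) hT.ne',
    Real.log_mul two_ne_zero ht.ne', ← Real.exp_add, ← Real.exp_add, ← Real.exp_add,
    ← Real.exp_add, Real.exp_le_exp]
  have := Real.log_pos one_lt_two
  nlinarith

/-- The prefactor of the block times the boundary term at height `Y` is `t⁻¹ (t/(TY))^(4k-3/2)`, up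
to a factor `1/2`. -/
theorem saddle_boundary_le {k : ℕ} (hk : 1 ≤ k) {T t Y : ℝ} (hT : 0 < T) (ht : 0 < t) (hY : 0 < Y)
    (htY : t / T ≤ Y) :
    t ^ (-(1 / 2) : ℝ) * (T ^ (-4 * (k : ℝ) + 5 / 2) * t ^ (4 * (k : ℤ) - 2)) *
      ((2 * T)⁻¹ * (Y ^ (-(4 * (k : ℝ) - 5 / 2)) / Y)) ≤ t⁻¹ := by
  have hk' : (1 : ℝ) ≤ k := by exact_mod_cast hk
  have hz : t ^ (4 * (k : ℤ) - 2) = t ^ (4 * (k : ℝ) - 2) := by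
    rw [← Real.rpow_intCast]; push_cast; rfl
  have h1 : t⁻¹ = Real.exp (-Real.log t) := by rw [Real.exp_neg, Real.exp_log ht]
  have h2 : (2 * T)⁻¹ = Real.exp (-(Real.log 2 + Real.log T)) := by
    rw [Real.exp_neg, Real.exp_add, Real.exp_log hT, Real.exp_log two_pos]
  have h3 : Y ^ (-(4 * (k : ℝ) - 5 / 2)) / Y =
      Real.exp (-(Real.log Y * (4 * (k : ℝ) - 5 / 2)) - Real.log Y) := by
    rw [Real.exp_sub, Real.exp_log hY, Real.rpow_def_of_pos hY, mul_neg]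
  have h4 := Real.log_le_log (by positivity) htY
  rw [Real.log_div ht.ne' hT.ne'] at h4
  rw [h3, hz, h1, h2, Real.rpow_def_of_pos ht, Real.rpow_def_of_pos ht, Real.rpow_def_of_pos hT,
    ← Real.exp_add, ← Real.exp_add, ← Real.exp_add, ← Real.exp_add, Real.exp_le_exp]
  have := Real.log_pos one_lt_two
  nlinarith

/-- The error in replacing the Laplace integral by its saddle point value, after normalization. -/
theorem exists_norm_blockIntegrand_sub_saddle_le {k : ℕ} (hk : 1 ≤ k) : ∃ C : ℝ, 0 ≤ C ∧
    ∀ H T t Y : ℝ, 0 < H → 0 < T → 1 < t → H⁻¹ ≤ Y → 2 * k * H ≤ T → 72 * (t * Y ^ 2) ≤ 1 →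
      t / T ≤ Y / 2 →
    ‖halfConst t *
        ((T ^ (-4 * (k : ℝ) + 5 / 2) * (t ^ (4 * (k : ℤ) - 2) * Real.exp (-Real.pi * t)) : ℝ) : ℂ) *
        (∫ y in (-Y)..Y, blockIntegrand k H T t y) -
      blockConst k T t * blockAmplitude H T⁻¹ (1 / 2 - t * I)
        (((2 * (k : ℝ) - 5 / 4 : ℝ) + t * I) / T)‖ ≤ C * (t⁻¹ + t * H ^ 2 / T ^ 2) ∧
    ‖blockAmplitude H T⁻¹ (1 / 2 - t * I) (((2 * (k : ℝ) - 5 / 4 : ℝ) + t * I) / T)‖ ≤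
      Real.exp 4 * 2 := by
  have hk' : (1 : ℝ) ≤ k := by exact_mod_cast hk
  obtain ⟨C₁, hC₁0, hC₁⟩ := exists_integral_vline_weight_le (m := 4 * (k : ℝ) - 5 / 2) (by linarith)
  obtain ⟨C₂, hC₂0, hC₂⟩ := exists_norm_Gamma_sq_div_Gamma_two_mul_le
  refine ⟨C₂ * (8 * Real.exp 4 * (Real.exp 2 * C₁) + 24 * (Real.exp 4 * 2 * Real.exp 2)),
    by positivity, fun H T t Y hH hT ht hHY hkH htY htTY => ?_⟩
  have ht0 : 0 < t := by linarith
  have hY : 0 < Y := (inv_pos.2 hH).trans_le hHY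
  set p : ℂ := 1 / 2 - t * I with hp
  set z₀ : ℂ := ((2 * (k : ℝ) - 5 / 4 : ℝ) + t * I) / T with hz₀
  set q : ℂ := 4 * (k : ℂ) - 3 / 2 + 2 * t * I with hq
  have hqre : q.re = 4 * (k : ℝ) - 3 / 2 := by
    rw [show q = ((4 * (k : ℝ) - 3 / 2 : ℝ) : ℂ) + (2 * t : ℝ) * I by rw [hq]; push_cast; ring]
    simp
  have hqim : q.im = 2 * t := by
    rw [show q = ((4 * (k : ℝ) - 3 / 2 : ℝ) : ℂ) + (2 * t : ℝ) * I by rw [hq]; push_cast; ring]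
    simp
  have hT' : (T : ℂ) ≠ 0 := by exact_mod_cast hT.ne'
  have hz₀' : z₀ = (((2 * (k : ℝ) - 5 / 4) / T : ℝ) : ℂ) + (t / T : ℝ) * I := by
    rw [hz₀]; push_cast; field_simp
  have hz₀re : z₀.re = (2 * (k : ℝ) - 5 / 4) / T := by rw [hz₀']; simp
  have hz₀im : z₀.im = t / T := by rw [hz₀']; simp
  have hpre : 0 < p.re := by rw [hp]; simp
  have hpn : ‖p‖ ≤ 2 * t := by
    calc ‖p‖ ≤ ‖(1 / 2 : ℂ)‖ + ‖(t : ℂ) * I‖ := norm_sub_le _ _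
      _ = 1 / 2 + t := by simp [abs_of_pos ht0]
      _ ≤ 2 * t := by linarith
  have hYY : 36 * Y ^ 2 ≤ 1 := by nlinarith [sq_nonneg Y]
  have hpY : ‖p‖ * (36 * Y ^ 2) ≤ 1 := by
    calc ‖p‖ * (36 * Y ^ 2) ≤ 2 * t * (36 * Y ^ 2) := by gcongr
      _ ≤ 1 := by linarith
  have hkT : 2 * k / T ≤ H⁻¹ := by
    rw [div_le_iff₀ hT, inv_mul_eq_div, le_div_iff₀ hH]
    exact hkH
  have haH : T⁻¹ ≤ H⁻¹ := by
    refine le_trans ?_ hkT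
    rw [← one_div]
    gcongr
    linarith
  have ha : 0 < T⁻¹ := inv_pos.2 hT
  have hz₀K : z₀ ∈ saddleBox H Y := by
    refine ⟨?_, ?_, ?_⟩
    · rw [hz₀re]
      exact div_nonneg (by linarith) hT.le
    · rw [hz₀re]
      refine le_trans ?_ hkT
      gcongr
      linarith
    · rw [hz₀im, abs_of_pos (by positivity)]
      linarith
  have hB : ∀ z ∈ saddleBox H Y, ‖blockAmplitude H T⁻¹ p z‖ ≤ Real.exp 4 * 2 := fun z hz =>
    norm_blockAmplitude_le hpre hH hHY ha.le haH hYY hpY hz (by simpa using hH.le)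
  refine ⟨?_, hB z₀ hz₀K⟩
  have hline : ∀ y, |y| ≤ Y → vline T⁻¹ y ∈ saddleBox H Y := fun y hy =>
    ⟨by simpa using hT.le, by simpa using haH, by simpa using hy⟩
  have hd : ∀ z ∈ saddleBox H Y,
      HasDerivAt (blockAmplitude H T⁻¹ p) (deriv (blockAmplitude H T⁻¹ p) z) z := by
    intro z hz
    have h1 := norm_le_of_near_saddleBox hHY hz (w := z) (by simpa using hH.le)
    exact (differentiableAt_blockAmplitude hpre (h1.trans_lt (by nlinarith))).hasDerivAt
  set D : ℂ := halfConst t *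
    ((T ^ (-4 * (k : ℝ) + 5 / 2) * (t ^ (4 * (k : ℤ) - 2) * Real.exp (-Real.pi * t)) : ℝ) : ℂ)
    with hD
  set X : ℂ := 2 * Real.pi * ((2 * T : ℝ) : ℂ) ^ (q - 1) / Gamma q with hX
  have hbc : blockConst k T t = D * X := by rw [blockConst, hD, halfConst, hX]
  have hee : Real.exp (Real.pi * t) * Real.exp (-Real.pi * t) = 1 := by
    rw [← Real.exp_add]
    simp
  have hΦ : ∀ y, ‖saddlePrimitive (2 * T) q (vline T⁻¹ y)‖ ≤ Real.exp (Real.pi * t) *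
      (Real.exp 2 * (‖vline T⁻¹ y‖ ^ (-(4 * (k : ℝ) - 5 / 2)) *
        Real.exp (-(2 * t / T / ‖vline T⁻¹ y‖)))) := by
    intro y
    have h1 := exp_mul_norm_saddlePrimitive_le ha (x := 2 * T) ht0 hqim y
    rw [show 2 * T * T⁻¹ = 2 by field_simp, hqre,
      show 1 - (4 * (k : ℝ) - 3 / 2) = -(4 * (k : ℝ) - 5 / 2) by ring,
      show 2 * t * T⁻¹ = 2 * t / T by rfl] at h1
    calc _ = Real.exp (Real.pi * t) * (Real.exp (-Real.pi * t) *
          ‖saddlePrimitive (2 * T) q (vline T⁻¹ y)‖) := by rw [← mul_assoc, hee, one_mul]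
      _ ≤ _ := by gcongr
  have hN : ∀ y, Y ≤ |y| → ‖saddlePrimitive (2 * T) q (vline T⁻¹ y)‖ ≤
      Real.exp (Real.pi * t) * (Real.exp 2 * Y ^ (-(4 * (k : ℝ) - 5 / 2))) := by
    intro y hy
    refine (hΦ y).trans ?_
    have h2 : Y ≤ ‖vline T⁻¹ y‖ := hy.trans (by simpa using abs_im_le_norm (vline T⁻¹ y))
    have h3 : ‖vline T⁻¹ y‖ ^ (-(4 * (k : ℝ) - 5 / 2)) ≤ Y ^ (-(4 * (k : ℝ) - 5 / 2)) :=
      Real.rpow_le_rpow_of_nonpos hY h2 (by linarith)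
    have h4 : Real.exp (-(2 * t / T / ‖vline T⁻¹ y‖)) ≤ 1 := by
      rw [Real.exp_le_one_iff]
      have : 0 ≤ 2 * t / T / ‖vline T⁻¹ y‖ := by positivity
      linarith
    gcongr
    calc _ ≤ Y ^ (-(4 * (k : ℝ) - 5 / 2)) * 1 := by gcongr
      _ = _ := mul_one _
  have hI : ∫ y in (-Y)..Y, ‖saddlePrimitive (2 * T) q (vline T⁻¹ y)‖ ≤
      Real.exp (Real.pi * t) * (Real.exp 2 * (C₁ * (2 * t / T) ^ (1 - (4 * (k : ℝ) - 5 / 2)))) := by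
    have hcv : Continuous fun y => ‖vline T⁻¹ y‖ := (continuous_vline _).norm
    have hne : ∀ y, ‖vline T⁻¹ y‖ ≠ 0 := fun y => norm_ne_zero_iff.2 (vline_ne_zero ha y)
    have hcont : Continuous fun y => ‖vline T⁻¹ y‖ ^ (-(4 * (k : ℝ) - 5 / 2)) *
        Real.exp (-(2 * t / T / ‖vline T⁻¹ y‖)) :=
      (hcv.rpow_const fun y => Or.inl (hne y)).mul
        (Real.continuous_exp.comp ((continuous_const.div hcv hne).neg))
    calc _ ≤ ∫ y in (-Y)..Y, Real.exp (Real.pi * t) *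
          (Real.exp 2 * (‖vline T⁻¹ y‖ ^ (-(4 * (k : ℝ) - 5 / 2)) *
            Real.exp (-(2 * t / T / ‖vline T⁻¹ y‖)))) := by
          refine intervalIntegral.integral_mono_on (by linarith)
            ((continuous_saddlePrimitive_vline ha _ _).norm.intervalIntegrable _ _) ?_
            fun y _ => hΦ y
          exact (continuous_const.mul (continuous_const.mul hcont)).intervalIntegrable _ _
      _ ≤ _ := by
          rw [intervalIntegral.integral_const_mul, intervalIntegral.integral_const_mul]
          gcongr
          exact hC₁ _ _ _ ha (by positivity) hY.le
  have hmain := norm_integral_amplitude_sub_le ha (x := 2 * T) (by positivity) hY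
    (M := 8 * Real.exp 4 * H ^ 2) (by positivity) (q := q) (z₀ := z₀) (by rw [hqre]; linarith)
    (by rw [hz₀, hq]; push_cast; field_simp; ring)
    (by rw [hz₀im, abs_of_pos (by positivity)]; exact htTY)
    (by
      rw [hz₀re, ← one_div]
      intro h
      rw [div_left_inj' hT.ne'] at h
      -- the saddle point is on the line of integration only if `8k = 9`
      have h8 : (8 * k : ℝ) = 9 := by linarith
      have h9 : 8 * k = 9 := by exact_mod_cast h8
      omega)
    hN (convex_saddleBox H Y) hz₀K hline hd
    (fun z hz w hw => norm_deriv_blockAmplitude_sub_le hpre hH hHY ha.le haH hYY hpY hz hw) hB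
  have hDn : ‖D‖ * Real.exp (Real.pi * t) ≤ C₂ * (t ^ (-(1 / 2) : ℝ) *
      (T ^ (-4 * (k : ℝ) + 5 / 2) * t ^ (4 * (k : ℤ) - 2))) := by
    have hc := coth_pi_sub_one_bounds ht
    set c : ℝ := Real.cosh (Real.pi * t) / Real.sinh (Real.pi * t) with hcdef
    have hc2 : c ≤ 2 := by
      have : 1 / t ≤ 1 := by rw [div_le_one ht0]; exact ht.le
      linarith [hc.2]
    have hhalf : ‖-(I * (c : ℂ) / (2 * Real.pi))‖ ≤ 1 := by
      rw [norm_neg, norm_div, norm_mul, norm_I, one_mul, norm_real, Real.norm_of_nonneg (by linarith),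
        norm_mul, norm_real, Real.norm_of_nonneg Real.pi_pos.le, Complex.norm_ofNat]
      rw [div_le_one (by positivity)]
      linarith [Real.pi_gt_three]
    rw [hD, norm_mul, norm_real, Real.norm_of_nonneg (by positivity), halfConst, norm_mul]
    calc _ ≤ 1 * (C₂ * t ^ (-(1 / 2) : ℝ)) * (T ^ (-4 * (k : ℝ) + 5 / 2) *
          (t ^ (4 * (k : ℤ) - 2) * Real.exp (-Real.pi * t))) * Real.exp (Real.pi * t) := by
          gcongr
          exact hC₂ t ht.le
      _ = C₂ * (t ^ (-(1 / 2) : ℝ) * (T ^ (-4 * (k : ℝ) + 5 / 2) * t ^ (4 * (k : ℤ) - 2))) *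
          (Real.exp (Real.pi * t) * Real.exp (-Real.pi * t)) := by ring
      _ = _ := by rw [hee, mul_one]
  set J := ∫ y in (-Y)..Y, blockIntegrand k H T t y with hJ
  have hw1 := saddle_weight_le hk hT ht0
  have hw2 := saddle_boundary_le hk hT ht0 hY (by linarith)
  set d : ℝ := t ^ (-(1 / 2) : ℝ) * (T ^ (-4 * (k : ℝ) + 5 / 2) * t ^ (4 * (k : ℤ) - 2)) with hd'
  have hd0 : 0 ≤ d := by positivity
  rw [hbc, show D * J - D * X * blockAmplitude H T⁻¹ p z₀ =
    D * (J - blockAmplitude H T⁻¹ p z₀ * X) by ring, norm_mul]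
  calc ‖D‖ * ‖J - blockAmplitude H T⁻¹ p z₀ * X‖
      ≤ ‖D‖ * ((2 * T)⁻¹ * (8 * Real.exp 4 * H ^ 2 * (Real.exp (Real.pi * t) *
          (Real.exp 2 * (C₁ * (2 * t / T) ^ (1 - (4 * (k : ℝ) - 5 / 2))))) +
          24 * (Real.exp 4 * 2 * (Real.exp (Real.pi * t) *
            (Real.exp 2 * Y ^ (-(4 * (k : ℝ) - 5 / 2)))) / Y))) := by
        refine mul_le_mul_of_nonneg_left (hmain.trans ?_) (norm_nonneg _)
        gcongr
    _ = ‖D‖ * Real.exp (Real.pi * t) * (8 * Real.exp 4 * (Real.exp 2 * C₁) * H ^ 2 *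
          ((2 * T)⁻¹ * (2 * t / T) ^ (1 - (4 * (k : ℝ) - 5 / 2))) +
          24 * (Real.exp 4 * 2 * Real.exp 2) *
            ((2 * T)⁻¹ * (Y ^ (-(4 * (k : ℝ) - 5 / 2)) / Y))) := by ring
    _ ≤ C₂ * d * (8 * Real.exp 4 * (Real.exp 2 * C₁) * H ^ 2 *
          ((2 * T)⁻¹ * (2 * t / T) ^ (1 - (4 * (k : ℝ) - 5 / 2))) +
          24 * (Real.exp 4 * 2 * Real.exp 2) *
            ((2 * T)⁻¹ * (Y ^ (-(4 * (k : ℝ) - 5 / 2)) / Y))) := by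
        gcongr
    _ = C₂ * (8 * Real.exp 4 * (Real.exp 2 * C₁) * H ^ 2 *
          (d * ((2 * T)⁻¹ * (2 * t / T) ^ (1 - (4 * (k : ℝ) - 5 / 2)))) +
          24 * (Real.exp 4 * 2 * Real.exp 2) *
            (d * ((2 * T)⁻¹ * (Y ^ (-(4 * (k : ℝ) - 5 / 2)) / Y)))) := by ring
    _ ≤ C₂ * (8 * Real.exp 4 * (Real.exp 2 * C₁) * H ^ 2 * (t / T ^ 2) +
          24 * (Real.exp 4 * 2 * Real.exp 2) * t⁻¹) := by gcongr
    _ ≤ C₂ * ((8 * Real.exp 4 * (Real.exp 2 * C₁) + 24 * (Real.exp 4 * 2 * Real.exp 2)) *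
          (t * H ^ 2 / T ^ 2) +
          (8 * Real.exp 4 * (Real.exp 2 * C₁) + 24 * (Real.exp 4 * 2 * Real.exp 2)) * t⁻¹) := by
        refine mul_le_mul_of_nonneg_left (add_le_add ?_ ?_) hC₂0
        · rw [show 8 * Real.exp 4 * (Real.exp 2 * C₁) * H ^ 2 * (t / T ^ 2) =
            8 * Real.exp 4 * (Real.exp 2 * C₁) * (t * H ^ 2 / T ^ 2) by ring]
          gcongr
          linarith [show 0 ≤ 24 * (Real.exp 4 * 2 * Real.exp 2) by positivity]
        · gcongr
          linarith [show 0 ≤ 8 * Real.exp 4 * (Real.exp 2 * C₁) by positivity]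
    _ = _ := by ring

/-! ### The asymptotic formula near the saddle point -/

theorem norm_two_mul_re_sub_le (u v : ℂ) :
    ‖((2 * u.re : ℝ) : ℂ) - ((2 * v.re : ℝ) : ℂ)‖ ≤ 2 * ‖u - v‖ := by
  rw [← ofReal_sub, norm_real, ← mul_sub, ← sub_re, norm_mul, Real.norm_ofNat, Real.norm_eq_abs]
  gcongr
  exact abs_re_le_norm _

theorem main_term_eq_two_mul_re (H T t : ℝ) :
    Real.exp (-2) * H * t ^ (-(1 / 2) : ℝ) * Real.exp (-(t / (T / H)) ^ 2) *
        Real.cos (phaseAlpha T t) =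
      2 * (((Real.exp (-2) * H : ℝ) : ℂ) * (((1 / 2 * t ^ (-(1 / 2) : ℝ) : ℝ) : ℂ) *
        cexp ((3 * Real.pi / 4 + 2 * t * (1 + Real.log 2 - Real.log (t / T)) : ℝ) * I) *
          (cexp ((-(t * H / T) ^ 2 : ℝ)) * cexp ((t ^ 3 / (2 * T ^ 2) : ℝ) * I)))).re := by
  have h1 : (phaseAlpha T t : ℝ) = (3 * Real.pi / 4 + 2 * t * (1 + Real.log 2 - Real.log (t / T))) +
      t ^ 3 / (2 * T ^ 2) := by
    rw [phaseAlpha]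
    ring
  have h2 : t / (T / H) = t * H / T := div_div_eq_mul_div _ _ _
  rw [h2, h1, ← exp_ofReal_mul_I_re, ofReal_add, add_mul, Complex.exp_add, ← ofReal_exp]
  have h3 : ∀ (a b c : ℝ) (x y : ℂ), a * b * c * (x * y).re =
      2 * ((a : ℂ) * (((1 / 2 * b : ℝ) : ℂ) * x * ((c : ℂ) * y))).re := by
    intro a b c x y
    rw [show (a : ℂ) * (((1 / 2 * b : ℝ) : ℂ) * x * ((c : ℂ) * y)) =
      ((a * (1 / 2 * b) * c : ℝ) : ℂ) * (x * y) by push_cast; ring, re_ofReal_mul]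
    ring
  exact h3 _ _ _ _ _

/-- The asymptotic formula in the range of `t` where the saddle point `(2k - 5/4 + i t)/T` lies well
inside the interval of integration. -/
theorem exists_norm_WCheck_sub_main_le {k : ℕ} (hk : 1 ≤ k) : ∃ C : ℝ, 0 ≤ C ∧
    ∀ ε T t : ℝ, 0 < T → 1 < t → (windowH ε T)⁻¹ ≤ T ^ ε / windowH ε T →
      2 * k * windowH ε T ≤ T → 72 * (t * (T ^ ε / windowH ε T) ^ 2) ≤ 1 →
      t / T ≤ T ^ ε / windowH ε T / 2 → 4 * (2 * (k : ℝ)) ^ 2 * (t * windowH ε T ^ 2) ≤ T ^ 2 →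
      8 * (2 * (k : ℝ)) ^ 2 * t ^ 3 ≤ T ^ 2 →
    ‖WCheck k ε T (1 / 2 + I * (t : ℂ)) -
        ((Real.exp (-2) * windowH ε T * t ^ (-(1 / 2) : ℝ) *
          Real.exp (-(t / (T / windowH ε T)) ^ 2) * Real.cos (phaseAlpha T t) : ℝ) : ℂ)‖ ≤
      C * (windowH ε T * (t⁻¹ + t * windowH ε T ^ 2 / T ^ 2)) := by
  have hk' : (1 : ℝ) ≤ k := by exact_mod_cast hk
  obtain ⟨C₁, hC₁0, hC₁⟩ := exists_norm_blockIntegrand_sub_saddle_le hk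
  obtain ⟨C₂, hC₂0, hC₂⟩ := exists_norm_blockConst_sub_le hk
  refine ⟨2 * (C₁ + C₂ * (Real.exp 4 * 2) + 24 * (2 * (k : ℝ)) ^ 2), by positivity,
    fun ε T t hT ht hHY hkH htY htTY htH htT => ?_⟩
  set H := windowH ε T with hHdef
  set Y := T ^ ε / H with hYdef
  have ht0 : 0 < t := by linarith
  have hH : 0 < H := Real.rpow_pos_of_pos hT _
  have hY : 0 < Y := (inv_pos.2 hH).trans_le hHY
  have hti : 0 < t⁻¹ := inv_pos.2 ht0
  set δ : ℝ := t * H ^ 2 / T ^ 2 with hδ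
  have hδ0 : 0 ≤ δ := by positivity
  have hline : ∀ y, |y| ≤ Y → ‖vline T⁻¹ y‖ < 1 := by
    intro y hy
    have h1 : T⁻¹ ≤ H⁻¹ := by
      refine inv_anti₀ hH ?_
      nlinarith
    calc ‖vline T⁻¹ y‖ ≤ |T⁻¹| + |y| := by
          simpa using norm_le_abs_re_add_abs_im (vline T⁻¹ y)
      _ ≤ Y + Y := by
          rw [abs_of_pos (inv_pos.2 hT)]
          exact add_le_add (h1.trans hHY) hy
      _ < 1 := by nlinarith [sq_nonneg Y]
  obtain ⟨h1, hb⟩ := hC₁ H T t Y hH hT ht hHY hkH htY htTY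
  have h2 := hC₂ T t hT ht
  have hκ : (0 : ℝ) ≤ 2 * (k : ℝ) - 5 / 4 := by linarith
  have hκ1 : (2 * (k : ℝ) - 5 / 4 + 1) ^ 2 ≤ (2 * (k : ℝ)) ^ 2 := by nlinarith
  have h3 := norm_blockAmplitude_saddle_sub_le (κ := 2 * (k : ℝ) - 5 / 4) (H := H) (T := T) (t := t)
    hκ hT ht.le (le_trans (by gcongr) htH) (le_trans (by gcongr) htT)
  rw [WCheck_eq_two_mul_re hT ht hline, main_term_eq_two_mul_re]
  refine (norm_two_mul_re_sub_le _ _).trans ?_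
  rw [← mul_sub, norm_mul, norm_real, Real.norm_of_nonneg (by positivity)]
  rw [← hHdef, ← hYdef]
  set W := halfConst t *
    ((T ^ (-4 * (k : ℝ) + 5 / 2) * (t ^ (4 * (k : ℤ) - 2) * Real.exp (-Real.pi * t)) : ℝ) : ℂ) *
      ∫ y in (-Y)..Y, blockIntegrand k H T t y
  set b := blockAmplitude H T⁻¹ (1 / 2 - t * I) (((2 * (k : ℝ) - 5 / 4 : ℝ) + t * I) / T)
  set u := ((1 / 2 * t ^ (-(1 / 2) : ℝ) : ℝ) : ℂ) *
      cexp ((3 * Real.pi / 4 + 2 * t * (1 + Real.log 2 - Real.log (t / T)) : ℝ) * I)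
  set v := cexp ((-(t * H / T) ^ 2 : ℝ)) * cexp ((t ^ 3 / (2 * T ^ 2) : ℝ) * I)
  have ht12 : t ^ (-(1 / 2) : ℝ) ≤ 1 := Real.rpow_le_one_of_one_le_of_nonpos ht.le (by norm_num)
  have hu : ‖u‖ ≤ 1 := by
    rw [norm_mul, norm_exp_ofReal_mul_I, mul_one, norm_real, Real.norm_of_nonneg (by positivity)]
    linarith [Real.rpow_nonneg ht0.le (-(1 / 2) : ℝ)]
  have he2 : Real.exp (-2) ≤ 1 := by rw [Real.exp_le_one_iff]; norm_num
  have hdec : W - u * v = (W - blockConst k T t * b) + (blockConst k T t - u) * b + u * (b - v) := by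
    ring
  have hWuv : ‖W - u * v‖ ≤
      (C₁ + C₂ * (Real.exp 4 * 2) + 24 * (2 * (k : ℝ)) ^ 2) * (t⁻¹ + δ) := by
    rw [hdec]
    calc _ ≤ ‖W - blockConst k T t * b‖ + ‖blockConst k T t - u‖ * ‖b‖ + ‖u‖ * ‖b - v‖ := by
          simp only [← norm_mul]
          exact norm_add₃_le
      _ ≤ C₁ * (t⁻¹ + δ) + C₂ * (1 * (t⁻¹ + δ)) * (Real.exp 4 * 2) +
          1 * (24 * (2 * (k : ℝ)) ^ 2 * (t⁻¹ + δ)) := by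
          gcongr
          · refine h2.trans ?_
            gcongr
            linarith
          · refine h3.trans ?_
            rw [add_comm δ]
            gcongr
      _ = _ := by ring
  calc 2 * (Real.exp (-2) * H * ‖W - u * v‖) ≤ 2 * (1 * H *
        ((C₁ + C₂ * (Real.exp 4 * 2) + 24 * (2 * (k : ℝ)) ^ 2) * (t⁻¹ + δ))) := by gcongr
    _ = _ := by ring

/-! ### Rapid decay for large `t` -/

/-- Both `exp (-(log T)²/4)` for `t ≤ T²` and `exp (-√t)` for `t > T²` are smaller than every power of
`t`, also after multiplication by powers of `T` and `t`. -/
theorem exists_rapid_decay {r n : ℝ} (hr : 0 ≤ r) (hn : 0 ≤ n) : ∃ C : ℝ, 0 ≤ C ∧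
    ∀ T t S : ℝ, 1 ≤ T → 1 ≤ t → (t ≤ T ^ 2 → S ≤ Real.exp (-(Real.log T ^ 2 / 4))) →
      (T ^ 2 < t → S ≤ Real.exp (-√t)) → T ^ 2 * t ^ r * S ≤ C * t ^ (-n) := by
  refine ⟨Real.exp (4 * (1 + r + n) ^ 2), by positivity, fun T t S hT ht h1 h2 => ?_⟩
  have hT0 : 0 < T := by linarith
  have ht0 : 0 < t := by linarith
  have hlt : 0 ≤ Real.log t := Real.log_nonneg ht
  have hTe : T ^ 2 = Real.exp (2 * Real.log T) := by
    rw [two_mul, Real.exp_add, Real.exp_log hT0, sq]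
  rw [Real.rpow_def_of_pos ht0, Real.rpow_def_of_pos ht0, ← Real.exp_add]
  rcases le_or_gt t (T ^ 2) with h | h
  · have hl : Real.log t ≤ 2 * Real.log T := by
      have := Real.log_le_log ht0 h
      rwa [Real.log_pow, Nat.cast_ofNat] at this
    rw [hTe, ← Real.exp_add]
    refine (mul_le_mul_of_nonneg_left (h1 h) (Real.exp_pos _).le).trans ?_
    rw [← Real.exp_add, Real.exp_le_exp]
    nlinarith [sq_nonneg (Real.log T / 2 - 2 * (1 + r + n)),
      mul_le_mul_of_nonneg_right hl (add_nonneg hr hn)]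
  · have hsq : Real.log t ^ 2 / 16 ≤ √t := by
      have h3 := Real.log_le_rpow_div ht0.le (show (0 : ℝ) < 1 / 4 by norm_num)
      have h4 : (t ^ (1 / 4 : ℝ)) ^ 2 = √t := by
        rw [← Real.rpow_natCast, ← Real.rpow_mul ht0.le, Real.sqrt_eq_rpow]
        norm_num
      have h5 : Real.log t ≤ 4 * t ^ (1 / 4 : ℝ) := by linarith
      have h6 : Real.log t ^ 2 ≤ (4 * t ^ (1 / 4 : ℝ)) ^ 2 := by gcongr
      rw [mul_pow, h4] at h6
      linarith
    calc T ^ 2 * Real.exp (Real.log t * r) * S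
        ≤ t * Real.exp (Real.log t * r) * Real.exp (-(Real.log t ^ 2 / 16)) := by
          have h3 := (h2 h).trans (Real.exp_le_exp.2 (neg_le_neg hsq))
          rcases le_total S 0 with hS | hS
          · exact (mul_nonpos_of_nonneg_of_nonpos (by positivity) hS).trans (by positivity)
          · have := h.le
            gcongr
      _ = Real.exp (Real.log t + Real.log t * r - Real.log t ^ 2 / 16) := by
          rw [sub_eq_add_neg, Real.exp_add, Real.exp_add, Real.exp_log ht0]
      _ ≤ _ := by
          rw [Real.exp_le_exp]
          nlinarith [sq_nonneg (Real.log t / 4 - 2 * (1 + r + n))]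

section

variable {H T t : ℝ}

/-- Decay of the Gaussian factor of the main term beyond the cutoff. -/
theorem gaussian_saddle_le (hT : 1 ≤ T) (hH1 : 1 ≤ H) (hL : 2 ≤ Real.log T)
    (ht : Real.log T ^ 4 * (T / H) < t) :
    (t ≤ T ^ 2 → Real.exp (-(t / (T / H)) ^ 2) ≤ Real.exp (-(Real.log T ^ 2 / 4))) ∧
      (T ^ 2 ≤ t → Real.exp (-(t / (T / H)) ^ 2) ≤ Real.exp (-√t)) := by
  have hT0 : 0 < T := by linarith
  have hH0 : 0 < H := by linarith
  simp only [Real.exp_le_exp, neg_le_neg_iff]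
  constructor
  · intro _
    have h1 : Real.log T ^ 4 ≤ t / (T / H) := by
      rw [le_div_iff₀ (by positivity)]
      exact ht.le
    have h2 : Real.log T ≤ Real.log T ^ 4 := le_self_pow₀ (by linarith) (by norm_num)
    have h3 : Real.log T ^ 2 ≤ (t / (T / H)) ^ 2 := by
      refine pow_le_pow_left₀ (by linarith) (h2.trans h1) 2
    linarith [sq_nonneg (Real.log T)]
  · intro h
    have ht1 : 1 ≤ t := le_trans (by nlinarith) h
    have h1 : √t ≤ t / (T / H) := by
      rw [le_div_iff₀ (by positivity)]
      have h2 : T ≤ √t := Real.le_sqrt_of_sq_le h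
      calc √t * (T / H) ≤ √t * (√t / 1) := by gcongr
        _ = t := by rw [div_one, Real.mul_self_sqrt (by linarith)]
    have h2 : 1 ≤ √t := Real.one_le_sqrt.2 ht1
    calc √t ≤ √t ^ 2 := le_self_pow₀ h2 two_ne_zero
      _ ≤ _ := by gcongr

/-- For `t` beyond the cutoff, either the Gaussian weight or the exponential decay of the
normalized block is small at each point of the line of integration. -/
theorem weight_mul_block_decay_le (hT : 1 ≤ T) (hH1 : 1 ≤ H) (hHT : H ≤ T) (hL : 2 ≤ Real.log T)
    (ht : Real.log T ^ 4 * (T / H) < t) {y : ℝ} (hy : ‖vline T⁻¹ y‖ ≤ 2 / 5) :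
    (t ≤ T ^ 2 → Real.exp (-(H * y) ^ 2) * Real.exp (-(t * (T⁻¹ / ‖vline T⁻¹ y‖))) ≤
      Real.exp (-(Real.log T ^ 2 / 4))) ∧
    (T ^ 2 ≤ t → Real.exp (-(H * y) ^ 2) * Real.exp (-(t * (T⁻¹ / ‖vline T⁻¹ y‖))) ≤
      Real.exp (-√t)) := by
  have hT0 : 0 < T := by linarith
  have hH0 : 0 < H := by linarith
  have hn : 0 < ‖vline T⁻¹ y‖ := norm_pos_iff.2 (vline_ne_zero (inv_pos.2 hT0) y)
  have hL4 : 0 < Real.log T ^ 4 := by positivity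
  have ht0 : 0 < t := lt_trans (by positivity) ht
  simp only [← Real.exp_add, Real.exp_le_exp]
  constructor
  · intro _
    set L := Real.log T with hLdef
    have hLsq : 4 ≤ L ^ 2 := by nlinarith
    have hnorm : T * ‖vline T⁻¹ y‖ ≤ 1 + T * |y| := by
      have h1 : ‖vline T⁻¹ y‖ ≤ T⁻¹ + |y| := by
        have := norm_le_abs_re_add_abs_im (vline T⁻¹ y)
        rwa [vline_re, vline_im, abs_of_pos (inv_pos.2 hT0)] at this
      calc T * ‖vline T⁻¹ y‖ ≤ T * (T⁻¹ + |y|) := by gcongr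
        _ = _ := by field_simp
    -- since `re z / |z| ≥ 1/(1 + T|y|)`, the block decays if `|y|` is small; otherwise the Gaussian
    -- is small because `H|y| ≥ L²/2`
    rcases le_or_gt ((1 + T * |y|) * L ^ 2) t with h | h
    · have h1 : L ^ 2 ≤ t * (T⁻¹ / ‖vline T⁻¹ y‖) := by
        rw [show t * (T⁻¹ / ‖vline T⁻¹ y‖) = t / (T * ‖vline T⁻¹ y‖) by field_simp,
          le_div_iff₀ (by positivity)]
        calc L ^ 2 * (T * ‖vline T⁻¹ y‖) ≤ L ^ 2 * (1 + T * |y|) := by gcongr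
          _ ≤ t := by linarith
      linarith [sq_nonneg (H * y)]
    · have hTH : 1 ≤ T / H := (one_le_div hH0).2 hHT
      have hLt : L ^ 4 ≤ t := by nlinarith
      have h1 : L ^ 4 * T ≤ t * H := by
        rw [← mul_div_assoc, div_lt_iff₀ hH0] at ht
        exact ht.le
      have h2 : t / 2 ≤ T * |y| * L ^ 2 := by nlinarith
      have h3 : L ^ 2 / 2 ≤ H * |y| := by
        have h4 : L ^ 2 * T * (L ^ 2 / 2) ≤ L ^ 2 * T * (H * |y|) := by
          calc L ^ 2 * T * (L ^ 2 / 2) = L ^ 4 * T / 2 := by ring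
            _ ≤ t / 2 * H := by linarith
            _ ≤ T * |y| * L ^ 2 * H := by gcongr
            _ = _ := by ring
        exact le_of_mul_le_mul_left h4 (by positivity)
      have h4 : (H * y) ^ 2 = (H * |y|) ^ 2 := by rw [mul_pow, mul_pow, sq_abs]
      have h5 : (L ^ 2 / 2) ^ 2 ≤ (H * |y|) ^ 2 := by gcongr
      have h6 : 0 ≤ t * (T⁻¹ / ‖vline T⁻¹ y‖) := by positivity
      rw [h4]
      nlinarith
  · intro h
    have h2 : T ≤ √t := Real.le_sqrt_of_sq_le h
    have h1 : √t ≤ t * (T⁻¹ / ‖vline T⁻¹ y‖) := by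
      rw [show t * (T⁻¹ / ‖vline T⁻¹ y‖) = t / (T * ‖vline T⁻¹ y‖) by field_simp,
        le_div_iff₀ (by positivity)]
      calc √t * (T * ‖vline T⁻¹ y‖) ≤ √t * (√t * 1) := by
            gcongr
            linarith
        _ = t := by rw [mul_one, Real.mul_self_sqrt ht0.le]
    linarith [sq_nonneg (H * y)]

end

/-- Bound of the averaged block by the supremum of the weight on the line of integration. -/
theorem norm_WCheck_le {k : ℕ} (hk : 1 ≤ k) {ε T t S : ℝ} (hε : ε ≤ 1) (hT : 1 ≤ T) (ht : 1 < t)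
    (hline : ∀ y, |y| ≤ T ^ ε / windowH ε T → ‖vline T⁻¹ y‖ ≤ 2 / 5)
    (hS : ∀ y, |y| ≤ T ^ ε / windowH ε T → Real.exp (-(windowH ε T * y) ^ 2) *
      Real.exp (-(t * (T⁻¹ / ‖vline T⁻¹ y‖))) ≤ S) :
    ‖WCheck k ε T (1 / 2 + I * (t : ℂ))‖ ≤
      16 * eulerMass * (T ^ 2 * t ^ (4 * (k : ℝ) - 2) * S) := by
  have hk' : (1 : ℝ) ≤ k := by exact_mod_cast hk
  have hT0 : 0 < T := by linarith
  have ht0 : 0 < t := by linarith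
  set H := windowH ε T with hH
  have hH0 : 0 < H := Real.rpow_pos_of_pos hT0 _
  set Y := T ^ ε / H with hYdef
  have hY : 0 < Y := div_pos (Real.rpow_pos_of_pos hT0 _) hH0
  have hm := eulerMass_nonneg
  have hS0 : 0 ≤ S := le_trans (by positivity) (hS 0 (by simpa using hY.le))
  have hz : t ^ (4 * (k : ℤ) - 2) = t ^ (4 * (k : ℝ) - 2) := by
    rw [← Real.rpow_intCast]; push_cast; rfl
  have hpt : ∀ y ∈ uIoc (-Y) Y, ‖(Real.exp (-(H * y) ^ 2) : ℂ) * cexp (2 * I * T * y) *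
      linePoint T y ^ (-4 * (k : ℂ) + 1 / 2) *
        blockHTilde k (1 / 2 + I * t) (1 - (linePoint T y ^ 2)⁻¹)‖ ≤
      T ^ (4 * (k : ℝ) - 3 / 2) * t ^ (4 * (k : ℝ) - 2) * (8 * eulerMass) * S := by
    intro y hy
    rw [uIoc_of_le (by linarith)] at hy
    have hy' : |y| ≤ Y := abs_le.2 ⟨hy.1.le, hy.2⟩
    have him : (1 / 2 + I * (t : ℂ)).im = t := by simp
    have hz0 := vline_ne_zero (inv_pos.2 hT0) y
    have hn : 0 < ‖vline T⁻¹ y‖ := norm_pos_iff.2 hz0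
    have h1 := exp_mul_norm_blockH_le ht (z := vline T⁻¹ y) (by simpa using hT0) (hline y hy')
    rw [vline_re] at h1
    have h2 : ‖cexp (2 * I * T * y)‖ = 1 := by
      rw [show 2 * I * (T : ℂ) * y = ((2 * T * y : ℝ) : ℂ) * I by push_cast; ring,
        norm_exp_ofReal_mul_I]
    have h3 : ‖vline T⁻¹ y ^ (-4 * (k : ℂ) + 1 / 2)‖ * ‖vline T⁻¹ y‖ ≤
        T ^ (4 * (k : ℝ) - 3 / 2) := by
      rw [show -4 * (k : ℂ) + 1 / 2 = ((-4 * (k : ℝ) + 1 / 2 : ℝ) : ℂ) by push_cast; ring,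
        norm_cpow_of_ne_zero hz0, ofReal_re, ofReal_im, mul_zero, Real.exp_zero, div_one,
        ← Real.rpow_add_one hn.ne']
      have h4 : T⁻¹ ≤ ‖vline T⁻¹ y‖ := by
        have := abs_re_le_norm (vline T⁻¹ y)
        rwa [vline_re, abs_of_pos (inv_pos.2 hT0)] at this
      refine (Real.rpow_le_rpow_of_nonpos (inv_pos.2 hT0) h4 (by linarith)).trans_eq ?_
      rw [Real.inv_rpow hT0.le, ← Real.rpow_neg hT0.le]
      congr 1
      ring
    rw [linePoint_eq_vline, blockHTilde, him, if_neg (by linarith), norm_mul, norm_mul, norm_mul,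
      norm_mul, h2, mul_one, norm_real, norm_real, Real.norm_of_nonneg (Real.exp_pos _).le,
      Real.norm_of_nonneg (by positivity), hz]
    calc _ = Real.exp (-(H * y) ^ 2) * ‖vline T⁻¹ y ^ (-4 * (k : ℂ) + 1 / 2)‖ *
          t ^ (4 * (k : ℝ) - 2) * (Real.exp (-Real.pi * t) *
            ‖blockH (1 / 2 + I * t) (1 - (vline T⁻¹ y ^ 2)⁻¹)‖) := by ring
      _ ≤ Real.exp (-(H * y) ^ 2) * ‖vline T⁻¹ y ^ (-4 * (k : ℂ) + 1 / 2)‖ *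
          t ^ (4 * (k : ℝ) - 2) * (8 * eulerMass * (‖vline T⁻¹ y‖ *
            Real.exp (-(t * (T⁻¹ / ‖vline T⁻¹ y‖))))) := by gcongr
      _ = ‖vline T⁻¹ y ^ (-4 * (k : ℂ) + 1 / 2)‖ * ‖vline T⁻¹ y‖ * t ^ (4 * (k : ℝ) - 2) *
          (8 * eulerMass) * (Real.exp (-(H * y) ^ 2) *
            Real.exp (-(t * (T⁻¹ / ‖vline T⁻¹ y‖)))) := by ring
      _ ≤ T ^ (4 * (k : ℝ) - 3 / 2) * t ^ (4 * (k : ℝ) - 2) * (8 * eulerMass) * S := by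
          gcongr
          exact hS y hy'
  have hint := intervalIntegral.norm_integral_le_of_norm_le_const hpt
  rw [WCheck, ← hH, ← hYdef, norm_mul, norm_real, Real.norm_of_nonneg (by positivity)]
  refine (mul_le_mul_of_nonneg_left hint (by positivity)).trans ?_
  rw [show |Y - -Y| = 2 * Y by rw [sub_neg_eq_add, ← two_mul, abs_of_pos (by positivity)]]
  have hHY : H * Y = T ^ ε := by rw [hYdef]; field_simp
  calc T ^ (-4 * (k : ℝ) + 5 / 2) * H *
        (T ^ (4 * (k : ℝ) - 3 / 2) * t ^ (4 * (k : ℝ) - 2) * (8 * eulerMass) * S * (2 * Y))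
      = 16 * eulerMass * (T ^ (-4 * (k : ℝ) + 5 / 2) * T ^ (4 * (k : ℝ) - 3 / 2) * (H * Y) *
          t ^ (4 * (k : ℝ) - 2) * S) := by ring
    _ ≤ 16 * eulerMass * (T ^ 2 * t ^ (4 * (k : ℝ) - 2) * S) := by
        rw [hHY, ← Real.rpow_add hT0, ← Real.rpow_add hT0]
        have : T ^ (-4 * (k : ℝ) + 5 / 2 + (4 * (k : ℝ) - 3 / 2) + ε) ≤ T ^ 2 := by
          rw [← Real.rpow_natCast]
          refine Real.rpow_le_rpow_of_exponent_le hT ?_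
          push_cast
          linarith
        gcongr

/-! ### Uniform estimates for large `T` -/

theorem log_pow_le_mul_rpow {δ T : ℝ} (hδ : 0 < δ) (hT : 1 ≤ T) {n : ℕ} (hn : n ≠ 0) :
    Real.log T ^ n ≤ (n / δ) ^ n * T ^ δ := by
  have hT0 : 0 < T := by linarith
  have hn0 : (0 : ℝ) < n := by exact_mod_cast Nat.pos_of_ne_zero hn
  have h := Real.log_le_rpow_div hT0.le (show 0 < δ / n by positivity)
  calc Real.log T ^ n ≤ (T ^ (δ / n) / (δ / n)) ^ n :=
        pow_le_pow_left₀ (Real.log_nonneg hT) h n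
    _ = (n / δ) ^ n * T ^ δ := by
        rw [div_pow, ← Real.rpow_natCast (T ^ (δ / n)), ← Real.rpow_mul hT0.le,
          div_mul_cancel₀ _ hn0.ne', div_pow, div_pow]
        field_simp

theorem eventually_mul_log_pow_le (c : ℝ) {s : ℝ} (hs : 0 < s) (n : ℕ) :
    ∀ᶠ T : ℝ in atTop, c * Real.log T ^ n ≤ T ^ s := by
  have h := (isLittleO_log_rpow_rpow_atTop (n : ℝ) hs).bound
    (show 0 < (|c| + 1)⁻¹ by positivity)
  filter_upwards [h, eventually_ge_atTop 1] with T hT h1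
  have hT0 : 0 < T := by linarith
  rw [Real.rpow_natCast, Real.norm_of_nonneg (pow_nonneg (Real.log_nonneg h1) _),
    Real.norm_of_nonneg (by positivity), inv_mul_eq_div, le_div_iff₀ (by positivity)] at hT
  have hlog := pow_nonneg (Real.log_nonneg h1) n
  nlinarith [le_abs_self c]

/-- The cutoff `(log T)⁴ T / H`. -/
noncomputable def blockCutoff (ε T : ℝ) : ℝ := Real.log T ^ 4 * (T / windowH ε T)

/-- The main term of the asymptotic formula. -/
noncomputable def blockMain (ε T t : ℝ) : ℝ :=
  Real.exp (-2) * windowH ε T * t ^ (-(1 / 2) : ℝ) *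
    Real.exp (-(t / (T / windowH ε T)) ^ 2) * Real.cos (phaseAlpha T t)

/-- `T` is large enough in terms of `k` and `ε` for the estimates to apply. -/
structure IsLargeFor (k : ℕ) (ε T : ℝ) : Prop where
  one_le : 1 ≤ T
  two_le_log : 2 ≤ Real.log T
  log_four_le : 72 * Real.log T ^ 4 ≤ T ^ (4 * ε)
  log_four_le' : 2 * Real.log T ^ 4 ≤ T ^ ε
  log_twelve_le : 32 * (k : ℝ) ^ 2 * Real.log T ^ 12 ≤ T ^ (2 / 3 - 2 * ε)
  log_twelve_le' : 32 * (k : ℝ) ^ 2 * Real.log T ^ 12 ≤ T ^ (6 * ε)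
  five_le : 5 ≤ T ^ (1 / 3 : ℝ)

theorem eventually_isLargeFor (k : ℕ) {ε : ℝ} (hε : 0 < ε) (hε' : ε < 1 / 3) :
    ∀ᶠ T : ℝ in atTop, IsLargeFor k ε T := by
  filter_upwards [eventually_ge_atTop 1, Real.tendsto_log_atTop.eventually_ge_atTop 2,
    eventually_mul_log_pow_le 72 (s := 4 * ε) (by positivity) 4,
    eventually_mul_log_pow_le 2 hε 4,
    eventually_mul_log_pow_le (32 * (k : ℝ) ^ 2) (s := 2 / 3 - 2 * ε) (by linarith) 12,
    eventually_mul_log_pow_le (32 * (k : ℝ) ^ 2) (s := 6 * ε) (by positivity) 12,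
    (tendsto_rpow_atTop (show (0 : ℝ) < 1 / 3 by norm_num)).eventually_ge_atTop 5]
    with T h1 h2 h3 h4 h5 h6 h7
  exact ⟨h1, h2, h3, h4, h5, h6, h7⟩

section

variable {k : ℕ} {ε T : ℝ}

theorem IsLargeFor.pos (h : IsLargeFor k ε T) : 0 < T := by linarith [h.one_le]

theorem IsLargeFor.windowH_pos (h : IsLargeFor k ε T) : 0 < windowH ε T :=
  Real.rpow_pos_of_pos h.pos _

theorem IsLargeFor.one_le_windowH (h : IsLargeFor k ε T) (hε : 0 < ε) : 1 ≤ windowH ε T :=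
  Real.one_le_rpow h.one_le (by positivity)

theorem IsLargeFor.windowH_mul (h : IsLargeFor k ε T) :
    windowH ε T * T ^ (2 / 3 - 2 * ε) = T := by
  rw [windowH, ← Real.rpow_add h.pos]
  convert Real.rpow_one T using 2
  ring

theorem IsLargeFor.windowH_le (h : IsLargeFor k ε T) (hε' : ε < 1 / 3) : windowH ε T ≤ T := by
  nth_rewrite 2 [← Real.rpow_one T]
  exact Real.rpow_le_rpow_of_exponent_le h.one_le (by linarith)

theorem IsLargeFor.norm_vline_le (h : IsLargeFor k ε T) (hε : 0 < ε) {y : ℝ}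
    (hy : |y| ≤ T ^ ε / windowH ε T) : ‖vline T⁻¹ y‖ ≤ 2 / 5 := by
  have hT := h.pos
  have h1 : T⁻¹ ≤ 1 / 5 := by
    rw [one_div]
    refine inv_anti₀ (by norm_num) (h.five_le.trans ?_)
    nth_rewrite 2 [← Real.rpow_one T]
    exact Real.rpow_le_rpow_of_exponent_le h.one_le (by norm_num)
  have h2 : T ^ ε / windowH ε T ≤ 1 / 5 := by
    rw [div_le_div_iff₀ h.windowH_pos (by norm_num), one_mul]
    calc T ^ ε * 5 ≤ T ^ ε * T ^ (1 / 3 : ℝ) := by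
          gcongr
          exact h.five_le
      _ = T ^ (ε + 1 / 3) := (Real.rpow_add hT _ _).symm
      _ ≤ windowH ε T := Real.rpow_le_rpow_of_exponent_le h.one_le (by linarith)
  have h3 := norm_le_abs_re_add_abs_im (vline T⁻¹ y)
  rw [vline_re, vline_im, abs_of_pos (inv_pos.2 hT)] at h3
  linarith

/-- The asymptotic formula below the cutoff. -/
theorem exists_norm_WCheck_sub_blockMain_le (hk : 1 ≤ k) : ∃ C : ℝ, 0 ≤ C ∧ ∀ ε T t : ℝ,
    IsLargeFor k ε T → 0 < ε → 1 < t → t ≤ blockCutoff ε T →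
      ‖WCheck k ε T (1 / 2 + I * (t : ℂ)) - (blockMain ε T t : ℂ)‖ ≤
        C * (windowH ε T * (t⁻¹ + t * windowH ε T ^ 2 / T ^ 2)) := by
  obtain ⟨C, hC0, hC⟩ := exists_norm_WCheck_sub_main_le hk
  refine ⟨C, hC0, fun ε T t h hε ht htτ => ?_⟩
  have hk' : (1 : ℝ) ≤ k := by exact_mod_cast hk
  have hT := h.pos
  have ht0 : 0 < t := by linarith
  have hH := h.windowH_pos
  have hHT := h.windowH_mul
  have hL := h.two_le_log
  have hL12 := h.log_twelve_le
  have hL1 : 1 ≤ Real.log T := by linarith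
  have hL4 : Real.log T ^ 4 ≤ Real.log T ^ 12 := pow_le_pow_right₀ hL1 (by norm_num)
  have hL4' : 1 ≤ Real.log T ^ 4 := one_le_pow₀ hL1
  rw [blockCutoff] at htτ
  set H := windowH ε T with hHdef
  have htH : t * H ≤ Real.log T ^ 4 * T := by
    rw [← mul_div_assoc, le_div_iff₀ hH] at htτ
    exact htτ
  refine hC ε T t hT ht ?_ ?_ ?_ ?_ ?_ ?_
  · rw [← one_div]
    exact div_le_div_of_nonneg_right (Real.one_le_rpow h.one_le hε.le) hH.le
  · calc 2 * k * H ≤ T ^ (2 / 3 - 2 * ε) * H := by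
          gcongr
          refine le_trans ?_ hL12
          nlinarith
      _ = T := by rw [mul_comm, hHT]
  · have h1 : T / H * (T ^ ε / H) ^ 2 = (T ^ (4 * ε))⁻¹ := by
      rw [← Real.rpow_neg hT.le, ← Real.rpow_natCast, hHdef, windowH, ← Real.rpow_sub hT,
        ← Real.rpow_mul hT.le]
      nth_rewrite 1 [← Real.rpow_one T]
      rw [← Real.rpow_sub hT, ← Real.rpow_add hT]
      congr 1
      push_cast
      ring
    calc 72 * (t * (T ^ ε / H) ^ 2) ≤ 72 * (Real.log T ^ 4 * (T / H) * (T ^ ε / H) ^ 2) := by gcongr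
      _ = 72 * Real.log T ^ 4 * (T ^ (4 * ε))⁻¹ := by rw [← h1]; ring
      _ ≤ 1 := by
        rw [← div_eq_mul_inv]
        exact div_le_one_of_le₀ h.log_four_le (by positivity)
  · rw [div_div, div_le_div_iff₀ hT (by positivity)]
    calc t * (H * 2) = 2 * (t * H) := by ring
      _ ≤ 2 * (Real.log T ^ 4 * T) := by gcongr
      _ = 2 * Real.log T ^ 4 * T := by ring
      _ ≤ T ^ ε * T := by gcongr; exact h.log_four_le'
  · calc 4 * (2 * (k : ℝ)) ^ 2 * (t * H ^ 2) = 16 * (k : ℝ) ^ 2 * (t * H) * H := by ring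
      _ ≤ 16 * (k : ℝ) ^ 2 * (Real.log T ^ 4 * T) * H := by gcongr
      _ = 16 * (k : ℝ) ^ 2 * Real.log T ^ 4 * (T * H) := by ring
      _ ≤ T ^ (2 / 3 - 2 * ε) * (T * H) := by
          gcongr
          refine le_trans ?_ hL12
          gcongr
          norm_num
      _ = T * (H * T ^ (2 / 3 - 2 * ε)) := by ring
      _ = T ^ 2 := by rw [hHT]; ring
  · have hH3 : H ^ 3 = T * T ^ (6 * ε) := by
      rw [hHdef, windowH, ← Real.rpow_natCast, ← Real.rpow_mul hT.le]
      nth_rewrite 2 [← Real.rpow_one T]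
      rw [← Real.rpow_add hT]
      congr 1
      push_cast
      ring
    have h2 : 8 * (2 * (k : ℝ)) ^ 2 * t ^ 3 * H ^ 3 ≤ T ^ 2 * H ^ 3 := by
      calc 8 * (2 * (k : ℝ)) ^ 2 * t ^ 3 * H ^ 3 = 32 * (k : ℝ) ^ 2 * (t * H) ^ 3 := by ring
        _ ≤ 32 * (k : ℝ) ^ 2 * (Real.log T ^ 4 * T) ^ 3 := by gcongr
        _ = 32 * (k : ℝ) ^ 2 * Real.log T ^ 12 * T ^ 3 := by ring
        _ ≤ T ^ (6 * ε) * T ^ 3 := by gcongr; exact h.log_twelve_le'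
        _ = T ^ 2 * H ^ 3 := by rw [hH3]; ring
    exact le_of_mul_le_mul_right h2 (by positivity)

theorem IsLargeFor.mul_sq_div_sq_le_rpow (h : IsLargeFor k ε T) (hk : 1 ≤ k) {t : ℝ} (ht : 1 < t)
    (htτ : t ≤ blockCutoff ε T) : t * windowH ε T ^ 2 / T ^ 2 ≤ t ^ (-(1 / 2) : ℝ) := by
  have hk' : (1 : ℝ) ≤ k := by exact_mod_cast hk
  have hT := h.pos
  have ht0 : 0 < t := by linarith
  have hH := h.windowH_pos
  have hHT := h.windowH_mul
  have hL12 : Real.log T ^ 12 ≤ T ^ (2 / 3 - 2 * ε) := by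
    refine le_trans ?_ h.log_twelve_le
    have h0 : 0 ≤ Real.log T ^ 12 := by positivity
    exact le_mul_of_one_le_left h0 (by nlinarith)
  rw [blockCutoff] at htτ
  set H := windowH ε T with hHdef
  have htH : t * H ≤ Real.log T ^ 4 * T := by
    rw [← mul_div_assoc, le_div_iff₀ hH] at htτ
    exact htτ
  have hst : √t ^ 2 = t := Real.sq_sqrt ht0.le
  have hs : √t * (t * H ^ 2) ≤ T ^ 2 := by
    refine le_of_sq_le_sq ?_ (by positivity)
    calc (√t * (t * H ^ 2)) ^ 2 = √t ^ 2 * t ^ 2 * H ^ 4 := by ring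
      _ = (t * H) ^ 3 * H := by rw [hst]; ring
      _ ≤ (Real.log T ^ 4 * T) ^ 3 * H := by gcongr
      _ = Real.log T ^ 12 * (T ^ 3 * H) := by ring
      _ ≤ T ^ (2 / 3 - 2 * ε) * (T ^ 3 * H) := by gcongr
      _ = T ^ 3 * (H * T ^ (2 / 3 - 2 * ε)) := by ring
      _ = (T ^ 2) ^ 2 := by rw [hHT]; ring
  rw [Real.rpow_neg ht0.le, ← Real.sqrt_eq_rpow, ← one_div,
    div_le_div_iff₀ (by positivity) (Real.sqrt_pos.2 ht0)]
  linarith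

theorem IsLargeFor.mul_sq_div_sq_le_log (h : IsLargeFor k ε T) {t : ℝ} (ht : 1 < t)
    (htτ : t ≤ blockCutoff ε T) : t * windowH ε T ^ 2 / T ^ 2 ≤ Real.log T ^ 8 * t⁻¹ := by
  have hT := h.pos
  have ht0 : 0 < t := by linarith
  have hH := h.windowH_pos
  rw [blockCutoff, ← mul_div_assoc, le_div_iff₀ hH] at htτ
  rw [← div_eq_mul_inv, div_le_div_iff₀ (by positivity) ht0]
  calc t * windowH ε T ^ 2 * t = (t * windowH ε T) ^ 2 := by ring
    _ ≤ (Real.log T ^ 4 * T) ^ 2 := by gcongr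
    _ = _ := by ring

end

theorem abs_blockMain_le {ε T t : ℝ} (hT : 0 < T) (ht : 0 < t) :
    |blockMain ε T t| ≤
      windowH ε T * t ^ (-(1 / 2) : ℝ) * Real.exp (-(t / (T / windowH ε T)) ^ 2) := by
  have hH : 0 < windowH ε T := Real.rpow_pos_of_pos hT _
  have he2 : Real.exp (-2) ≤ 1 := by rw [Real.exp_le_one_iff]; norm_num
  rw [blockMain, abs_mul, abs_of_nonneg (by positivity)]
  calc _ ≤ 1 * windowH ε T * t ^ (-(1 / 2) : ℝ) * Real.exp (-(t / (T / windowH ε T)) ^ 2) * 1 := by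
        gcongr
        exact Real.abs_cos_le_one _
    _ = _ := by ring

/-- Beyond the cutoff the averaged block and the main term both decay faster than any power. -/
theorem exists_norm_WCheck_add_main_le {k : ℕ} (hk : 1 ≤ k) {ε : ℝ} (hε : 0 < ε) (hε' : ε < 1 / 3)
    (n : ℕ) : ∃ C : ℝ, 0 ≤ C ∧ ∀ T t : ℝ, IsLargeFor k ε T → 1 < t → blockCutoff ε T < t →
      ‖WCheck k ε T (1 / 2 + I * (t : ℂ))‖ + |blockMain ε T t| ≤ C * t ^ (-(n : ℝ)) := by
  have hk' : (1 : ℝ) ≤ k := by exact_mod_cast hk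
  obtain ⟨C₁, hC₁0, hC₁⟩ := exists_rapid_decay (r := 4 * (k : ℝ) - 2) (n := n) (by linarith)
    (Nat.cast_nonneg n)
  obtain ⟨C₂, hC₂0, hC₂⟩ := exists_rapid_decay (r := 0) (n := n) le_rfl (Nat.cast_nonneg n)
  have hm := eulerMass_nonneg
  refine ⟨16 * eulerMass * C₁ + C₂, by positivity, fun T t h ht htτ => ?_⟩
  have hT := h.pos
  have ht0 : 0 < t := by linarith
  rw [blockCutoff] at htτ
  have hH1 := h.one_le_windowH hε
  have hHT := h.windowH_le hε'
  rw [add_mul]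
  refine add_le_add ?_ ?_
  · set S : ℝ := if t ≤ T ^ 2 then Real.exp (-(Real.log T ^ 2 / 4)) else Real.exp (-√t) with hS
    have hSle : ∀ y, |y| ≤ T ^ ε / windowH ε T → Real.exp (-(windowH ε T * y) ^ 2) *
        Real.exp (-(t * (T⁻¹ / ‖vline T⁻¹ y‖))) ≤ S := by
      intro y hy
      have hb := weight_mul_block_decay_le h.one_le hH1 hHT h.two_le_log htτ
        (h.norm_vline_le hε hy)
      rw [hS]
      split_ifs with hc
      · exact hb.1 hc
      · exact hb.2 (not_le.1 hc).le
    refine (norm_WCheck_le hk (by linarith) h.one_le ht (fun y hy => h.norm_vline_le hε hy)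
      hSle).trans ?_
    rw [mul_assoc (16 * eulerMass)]
    refine mul_le_mul_of_nonneg_left ?_ (by positivity)
    refine hC₁ T t S h.one_le ht.le (fun hc => ?_) (fun hc => ?_)
    · rw [hS, if_pos hc]
    · rw [hS, if_neg (not_le.2 hc)]
  · refine (abs_blockMain_le hT ht0).trans (le_trans ?_ (hC₂ T t _ h.one_le ht.le
      (gaussian_saddle_le h.one_le hH1 h.two_le_log htτ).1
      fun hc => (gaussian_saddle_le h.one_le hH1 h.two_le_log htτ).2 hc.le))
    gcongr
    · nlinarith [h.one_le]
    · exact ht.le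
    · norm_num

theorem mainTheorem7 (k : ℕ) (hk : 1 ≤ k) (ε : ℝ) (hε : 0 < ε) (hε' : ε < 1 / 3) :
    ∃ (T₀ : ℝ) (τ : ℝ → ℝ) (E : ℝ → ℝ → ℝ), 1 ≤ T₀ ∧
      -- the cutoff `t ≤ τ T` is a cutoff `t ⪅ T / H`
      (∀ δ : ℝ, 0 < δ → ∃ C : ℝ, ∀ T : ℝ, T₀ ≤ T → τ T ≤ C * T ^ δ * (T / windowH ε T)) ∧
      -- `E T t` is a `t ^ (-∞)`
      (∀ T t : ℝ, T₀ ≤ T → 1 < t → 0 ≤ E T t) ∧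
      (∀ n : ℕ, ∃ C : ℝ, ∀ T t : ℝ, T₀ ≤ T → 1 < t → E T t ≤ C * t ^ (-(n : ℝ))) ∧
      -- the asymptotic formula
      (∀ δ : ℝ, 0 < δ → ∃ C : ℝ, ∀ T t : ℝ, T₀ ≤ T → 1 < t →
        ‖WCheck k ε T (1 / 2 + Complex.I * (t : ℂ)) -
            ((Real.exp (-2) * windowH ε T * t ^ (-(1 / 2) : ℝ) *
              Real.exp (-(t / (T / windowH ε T)) ^ 2) * Real.cos (phaseAlpha T t) : ℝ) : ℂ)‖ ≤
          C * T ^ δ * ((if t ≤ τ T then 1 else 0) * (windowH ε T * t⁻¹) + E T t)) ∧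
      -- the upper bound
      (∃ C : ℝ, ∀ T t : ℝ, T₀ ≤ T → 1 < t →
        ‖WCheck k ε T (1 / 2 + Complex.I * (t : ℂ))‖ ≤
          C * ((if t ≤ τ T then 1 else 0) * (windowH ε T * t ^ (-(1 / 2) : ℝ)) + E T t)) := by
  obtain ⟨C₁, hC₁0, hC₁⟩ := exists_norm_WCheck_sub_blockMain_le hk
  obtain ⟨T₁, hT₁⟩ := eventually_atTop.1 (eventually_isLargeFor k hε hε')
  refine ⟨max 1 T₁, blockCutoff ε, fun T t => if t ≤ blockCutoff ε T then 0 else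
    ‖WCheck k ε T (1 / 2 + I * (t : ℂ))‖ + |blockMain ε T t|, le_max_left _ _, ?_, ?_, ?_, ?_, ?_⟩
  · intro δ hδ
    refine ⟨((4 : ℕ) / δ) ^ 4, fun T hT => ?_⟩
    have h := hT₁ T ((le_max_right _ _).trans hT)
    have hH := h.windowH_pos
    have hT0 := h.pos
    have := log_pow_le_mul_rpow hδ h.one_le (n := 4) (by norm_num)
    rw [blockCutoff]
    gcongr
  · intro T t _ _
    beta_reduce
    split_ifs
    · exact le_rfl
    · positivity
  · intro n
    obtain ⟨C, hC0, hC⟩ := exists_norm_WCheck_add_main_le hk hε hε' n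
    refine ⟨C, fun T t hT ht => ?_⟩
    beta_reduce
    split_ifs with hτ
    · have : 0 < t := by linarith
      positivity
    · exact hC T t (hT₁ T ((le_max_right _ _).trans hT)) ht (not_le.1 hτ)
  · intro δ hδ
    refine ⟨C₁ * (1 + ((8 : ℕ) / δ) ^ 8) + 1, fun T t hT ht => ?_⟩
    have h := hT₁ T ((le_max_right _ _).trans hT)
    have hH := h.windowH_pos
    have hTδ : 1 ≤ T ^ δ := Real.one_le_rpow h.one_le hδ.le
    have ht0 : 0 < t := by linarith
    change ‖_ - (blockMain ε T t : ℂ)‖ ≤ _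
    beta_reduce
    split_ifs with hτ
    · have h1 := hC₁ ε T t h hε ht hτ
      have h2 := h.mul_sq_div_sq_le_log ht hτ
      have h3 := log_pow_le_mul_rpow hδ h.one_le (n := 8) (by norm_num)
      calc _ ≤ C₁ * (windowH ε T * (t⁻¹ + t * windowH ε T ^ 2 / T ^ 2)) := h1
        _ ≤ C₁ * (windowH ε T * (T ^ δ * t⁻¹ + ((8 : ℕ) / δ) ^ 8 * T ^ δ * t⁻¹)) := by
            gcongr
            · exact le_mul_of_one_le_left (inv_pos.2 ht0).le hTδ
            · exact h2.trans (by gcongr)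
        _ = C₁ * (1 + ((8 : ℕ) / δ) ^ 8) * T ^ δ * (1 * (windowH ε T * t⁻¹) + 0) := by ring
        _ ≤ _ := by
            gcongr
            linarith
    · have hD : 1 ≤ (C₁ * (1 + ((8 : ℕ) / δ) ^ 8) + 1) * T ^ δ :=
        one_le_mul_of_one_le_of_one_le (le_add_of_nonneg_left (by positivity)) hTδ
      rw [zero_mul, zero_add]
      refine le_trans ?_ (le_mul_of_one_le_left (by positivity) hD)
      refine (norm_sub_le _ _).trans_eq ?_
      rw [norm_real, Real.norm_eq_abs]
  · refine ⟨2 * C₁ + 1, fun T t hT ht => ?_⟩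
    have h := hT₁ T ((le_max_right _ _).trans hT)
    have hH := h.windowH_pos
    have ht0 : 0 < t := by linarith
    beta_reduce
    split_ifs with hτ
    · have h1 := hC₁ ε T t h hε ht hτ
      have h2 := h.mul_sq_div_sq_le_rpow hk ht hτ
      have h3 : t⁻¹ ≤ t ^ (-(1 / 2) : ℝ) := by
        rw [← Real.rpow_neg_one]
        exact Real.rpow_le_rpow_of_exponent_le ht.le (by norm_num)
      have h4 : |blockMain ε T t| ≤ windowH ε T * t ^ (-(1 / 2) : ℝ) := by
        refine (abs_blockMain_le h.pos ht0).trans (mul_le_of_le_one_right (by positivity) ?_)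
        rw [Real.exp_le_one_iff]
        linarith [sq_nonneg (t / (T / windowH ε T))]
      have h5 : ‖WCheck k ε T (1 / 2 + I * (t : ℂ))‖ ≤
          ‖WCheck k ε T (1 / 2 + I * (t : ℂ)) - (blockMain ε T t : ℂ)‖ + |blockMain ε T t| := by
        have := norm_add_le (WCheck k ε T (1 / 2 + I * (t : ℂ)) - (blockMain ε T t : ℂ))
          (blockMain ε T t : ℂ)
        rwa [sub_add_cancel, norm_real, Real.norm_eq_abs] at this
      calc _ ≤ C₁ * (windowH ε T * (t⁻¹ + t * windowH ε T ^ 2 / T ^ 2)) +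
            windowH ε T * t ^ (-(1 / 2) : ℝ) := h5.trans (add_le_add h1 h4)
        _ ≤ C₁ * (windowH ε T * (t ^ (-(1 / 2) : ℝ) + t ^ (-(1 / 2) : ℝ))) +
            windowH ε T * t ^ (-(1 / 2) : ℝ) := by gcongr
        _ = _ := by ring
    · rw [zero_mul, zero_add]
      have h0 : 0 ≤ |blockMain ε T t| := abs_nonneg _
      have h1 := norm_nonneg (WCheck k ε T (1 / 2 + I * (t : ℂ)))
      nlinarith [mul_nonneg hC₁0 (add_nonneg h1 h0)]
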